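/- **Setting.** Let $\ell>0$, $\gamma\ge 0$, $\Omega=(0,\ell)$, $0<\underline\rho\le\overline\rho$. Let $P\in C^3((0,\infty))$ satisfy $P''\ge \underline C_{P''}$ on $[\underline\rho,\overline\rho]$ for some $\underline C_{P''}>0$. Write $\langle\cdot,\cdot\rangle$ and $\|\cdot\|$ for the inner product and norm of $L^2(\Omega)$, and put $\mathscr h(\rho,v)=\tfrac12v^2+P'(\rho)$. *Original system.* $\hat u=(\hat\rho,\hat v)$, with $\hat m=\hat\rho\hat v$ and $\hat{\mathscr h}=\mathscr h(\hat\rho,\hat v)$, solves on $[0,\infty)\times\Omega$ $$\partial_t\hat\rho+\partial_x\hat m=\hat s_1,\qquad \partial_t\hat v+\partial_x\hat{\mathscr h}=-\gamma|\hat v|\hat v+\hat s_2,$$ with boundary data $\hat m(t,0)=m_\partial(t)$, $\hat{\mathscr h}(t,\ell)=h_\partial(t)$. It satisfies $\underline\rho\le\hat\rho\le\overline\rho$, $|\hat v|\le\overline v$ and $|\partial_t\hat\rho|+|\partial_t\hat v|\le C_t$ pointwise, and $\hat\rho,\hat v\in W^{1,\infty}(0,\infty;W^{1,\infty}(\Omega))\cap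 W^{2,\infty}(0,\infty;L^\infty(\Omega))$ with $\partial_x$, $\partial_t$, $\partial_x\partial_t$, $\partial_{tt}$ of $\hat\rho$ and $\hat v$ bounded by a constant $K$. *Discretization.* Let $0=x_0<\dots<x_M=\ell$ be a partition with maximal cell length $\mathrm h$; $Q_{\mathrm h}$ is the space of piecewise constant functions, $R_{\mathrm h}$ that of continuous piecewise affine functions, $\Pi_{\mathrm h}$ the $L^2$-projection onto $Q_{\mathrm h}$, $I_{\mathrm h}$ the nodal interpolation onto $R_{\mathrm h}$. For $\tau>0$, $t^n=n\tau$, a superscript $n$ on a function of time means its value at $t^n$, and $\overline{\partial_\tau}a^n=(a^n-a^{n-1})/\tau$. The projected state is $\hat u_{\mathrm h}^n=(\hat\rho_{\mathrm h}^n,\hat w_{\mathrm h}^n)$ with $\hat\rho_{\mathrm h}^n=\Pi_{\mathrm h}\hat\rho^n$, $\hat w_{\mathrm h}^n=I_{\mathrm h}\hat m^n/\hat\rho_{\mathrm h}^n$, and $\hat{\mathscr h}_{\mathrm h}^n=\mathscr h(\hat\rho_{\mathrm h}^n,\hat w_{\mathrm h}^n)$. *Observer.* Let $\hat\eta\in L^\infty(0,\infty;L^2(\Omega))$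 be the measurement error, defined for every $t\ge 0$, with $\|\hat\eta\|_{L^\infty(L^2)}=\sup_{t\ge0}\|\hat\eta(t)\|$, and let $\hat\eta_{\mathrm h}^n\in L^2(\Omega)$, $\|\hat\eta^n_{\mathrm h}\|\le\|\hat\eta(t^n)\|$, be its discretization. For $\mu>0$ let $\rho_{\mathrm h}^n\in Q_{\mathrm h}$, $m_{\mathrm h}^n\in R_{\mathrm h}$ ($n\ge0$), $v_{\mathrm h}^n=m_{\mathrm h}^n/\rho_{\mathrm h}^n$, satisfy for all $n\ge1$: $m_{\mathrm h}^n(0)=m_\partial(t^n)$ and $$\langle\overline{\partial_\tau}\rho_{\mathrm h}^n,q\rangle+\langle\partial_xm_{\mathrm h}^n,q\rangle=\langle\Pi_{\mathrm h}\hat s_1^n,q\rangle,$$ $$\langle\overline{\partial_\tau}v_{\mathrm h}^n,r\rangle-\langle\mathscr h(\rho_{\mathrm h}^n,v_{\mathrm h}^n),\partial_xr\rangle+h_\partial(t^n)r(\ell)+\gamma\langle|v_{\mathrm h}^n|v_{\mathrm h}^n,r\rangle=\langle\hat s_2^n,r\rangle+\mu\langle I_{\mathrm h}\hat v^n+\hat\eta_{\mathrm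 h}^n-v_{\mathrm h}^n,r\rangle$$ for all $q\in Q_{\mathrm h}$ and all $r\in R_{\mathrm h}$ with $r(0)=0$; assume $\underline\rho\le\rho_{\mathrm h}^n\le\overline\rho$ and $|v_{\mathrm h}^n|\le\overline v$ on $\Omega$ for all $n\ge0$. Put $u_{\mathrm h}^n=(\rho_{\mathrm h}^n,v_{\mathrm h}^n)$, and let $\|u_{\mathrm h}^n-\hat u_{\mathrm h}^n\|^2=\|\rho_{\mathrm h}^n-\hat\rho_{\mathrm h}^n\|^2+\|v_{\mathrm h}^n-\hat w_{\mathrm h}^n\|^2$. *Functionals.* With $\mathcal H(\rho,v)=\int_0^\ell\tfrac12\rho v^2+P(\rho)\,dx$, for states $u=(\rho,v)$, $u'=(\rho',v')$ let $$\mathcal H(u,u')=\mathcal H(u)-\mathcal H(u')-\langle\mathscr h(\rho',v'),\rho-\rho'\rangle-\langle\rho'v',v-v'\rangle,$$ $$\mathcal G_{\mathrm h}(u,u')=\Big\langle-\int_0^x(\rho-\rho')\,ds,\;v-v'\Big\rangle,\qquad \mathcal D(u,u')=\tfrac14\gamma\langle\rho'(v-v'),(v-v')(|v|+|v'|)\rangle.$$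 **Lemma.** For every $\mu>0$ there is $\delta_0>0$ such that for every $\delta\in(0,\delta_0]$ there are $\overline v_0,C_{t,0}>0$ (these thresholds depending only on $\ell,\gamma,P,\underline\rho,\overline\rho,\mu$ and, for the latter two, $\delta$) such that for all $\overline v\in(0,\overline v_0]$, $C_t\in(0,C_{t,0}]$ and all $K$ the following holds. There are $\alpha_0,\tau_{\max},\mathrm h_0>0$, numbers $C_1(\alpha,\tau_0)$ and constants $C_2,C_3,C_4>0$ (independent of $n$, $\mathrm h$, $\tau$, $\alpha$, $\tau_0$, of $\hat u$ within the class above, of $\hat\eta$ and of $u_{\mathrm h}$; $C_1$ depends in addition only on $\alpha,\tau_0$) such that for all $\alpha\in(0,\alpha_0]$ and $\tau_0\in(0,\tau_{\max}]$ one has $C_1(\alpha,\tau_0)>0$, and for all original and discrete solutions as above with $0<\tau\le\tau_0$, $0<\mathrm h\le\mathrm h_0$ and all $n\ge1$, $$\begin{aligned}\overline{\partial_\tau}\big(\mathcal H(u_{\mathrm h}^n,\hat u_{\mathrm h}^n)+\delta\,\mathcal G_{\mathrm h}(u_{\mathrm h}^n,\hat u_{\mathrm h}^n)\big)\le{}&-C_1(\alpha,\tau_0)\|u_{\mathrm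 h}^n-\hat u_{\mathrm h}^n\|^2+(\alpha+\tau_0)C_2\|u_{\mathrm h}^{n-1}-\hat u_{\mathrm h}^{n-1}\|^2-\tfrac12\mathcal D(u_{\mathrm h}^n,\hat u_{\mathrm h}^n)\\&+\Big(1+\frac1\alpha\Big)(\tau^2+\mathrm h^2)C_3+\frac{\mu^2C_4}{\alpha}\|\hat\eta\|_{L^\infty(L^2)}^2+\overline{\partial_\tau}\big\langle\hat{\mathscr h}^n-\hat{\mathscr h}_{\mathrm h}^n,\rho_{\mathrm h}^n-\hat\rho_{\mathrm h}^n\big\rangle.\end{aligned}$$ Moreover there are $\alpha_1\in(0,\alpha_0]$ and $\tau_1\in(0,\tau_{\max}]$ such that $-C_1(\alpha,\tau_0)+(\alpha+\tau_0)C_2<0$ for all $\alpha\in(0,\alpha_1]$, $\tau_0\in(0,\tau_1]$. -/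

import Mathlib

open Set MeasureTheory

noncomputable section

namespace BarotropicObserver

/-! ### Integrals over `Ω = (0, ℓ)` -/

/-- The `L²(0, ℓ)` pairing. -/
def ip (ℓ : ℝ) (f g : ℝ → ℝ) : ℝ := ∫ x in (0 : ℝ)..ℓ, f x * g x

/-- The squared `L²(0, ℓ)` norm. -/
def normSq (ℓ : ℝ) (f : ℝ → ℝ) : ℝ := ∫ x in (0 : ℝ)..ℓ, f x ^ 2

/-- The `L²(0, ℓ)` norm. -/
def l2norm (ℓ : ℝ) (f : ℝ → ℝ) : ℝ := Real.sqrt (normSq ℓ f)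

/-- Membership in `L²(0, ℓ)`. -/
def InL2 (ℓ : ℝ) (f : ℝ → ℝ) : Prop := MemLp f 2 (volume.restrict (Ioo 0 ℓ))

/-- The norm of `L^∞(0, ∞; L²(0, ℓ))`. -/
def linftyL2 (ℓ : ℝ) (η : ℝ → ℝ → ℝ) : ℝ := sSup ((fun t => l2norm ℓ (η t)) '' Ici 0)

/-- Membership in `L^∞(0, ∞; L²(0, ℓ))`. -/
structure InLinftyL2 (ℓ : ℝ) (η : ℝ → ℝ → ℝ) : Prop where
  memLp : ∀ t, 0 ≤ t → InL2 ℓ (η t)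
  bdd : BddAbove ((fun t => l2norm ℓ (η t)) '' Ici 0)

/-- Squared norm of the difference of two states, `‖ρ - ρ'‖² + ‖v - v'‖²`. -/
def distSq (ℓ : ℝ) (ρ v ρ' v' : ℝ → ℝ) : ℝ :=
  normSq ℓ (fun x => ρ x - ρ' x) + normSq ℓ (fun x => v x - v' x)

/-! ### The barotropic Euler equations -/

/-- Time derivative on `[0, ∞)` (one-sided at `t = 0`). -/
def timeDeriv (f : ℝ → ℝ → ℝ) (t x : ℝ) : ℝ := derivWithin (fun s => f s x) (Ici 0) t

/-- The pressure potential `P` is three times continuously differentiable for positive densities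
and strongly convex on the admissible range of densities. -/
structure IsPressurePotential (P : ℝ → ℝ) (ρlo ρhi : ℝ) : Prop where
  contDiff : ContDiffOn ℝ 3 P (Ioi 0)
  convex : ∃ c, 0 < c ∧ ∀ r ∈ Icc ρlo ρhi, c ≤ deriv (deriv P) r

/-- The total specific enthalpy `v² / 2 + P'(ρ)`. -/
def enthalpy (P : ℝ → ℝ) (r w : ℝ) : ℝ := w ^ 2 / 2 + deriv P r

/-- `(ρ, v)` solves `∂ₜρ + ∂ₓ(ρv) = s₁`, `∂ₜv + ∂ₓ(v²/2 + P'(ρ)) = - γ|v|v + s₂` on `(0, ℓ)`, with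
mass flow prescribed at `x = 0` and enthalpy prescribed at `x = ℓ`. The equations are required at
every time and almost every point, as is appropriate for Lipschitz solutions. -/
structure IsEulerSolution (ℓ γ : ℝ) (P : ℝ → ℝ) (s₁ s₂ : ℝ → ℝ → ℝ) (mBd hBd : ℝ → ℝ)
    (ρ v : ℝ → ℝ → ℝ) : Prop where
  mass : ∀ t, 0 ≤ t → ∀ᵐ x ∂(volume.restrict (Ioo 0 ℓ)),
    timeDeriv ρ t x + deriv (fun y => ρ t y * v t y) x = s₁ t x
  momentum : ∀ t, 0 ≤ t → ∀ᵐ x ∂(volume.restrict (Ioo 0 ℓ)),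
    timeDeriv v t x + deriv (fun y => enthalpy P (ρ t y) (v t y)) x
      = - (γ * |v t x| * v t x) + s₂ t x
  bc_left : ∀ t, 0 ≤ t → ρ t 0 * v t 0 = mBd t
  bc_right : ∀ t, 0 ≤ t → enthalpy P (ρ t ℓ) (v t ℓ) = hBd t

/-- `f` is in `W^{1,∞}(0,∞; W^{1,∞}(0,ℓ)) ∩ W^{2,∞}(0,∞; L^∞(0,ℓ))` with derivatives bounded by `K`,
expressed through the continuous representative: `W^{1,∞}` bounds are Lipschitz bounds. -/
structure IsRegular (ℓ K : ℝ) (f : ℝ → ℝ → ℝ) : Prop where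
  diff : ∀ x ∈ Icc 0 ℓ, DifferentiableOn ℝ (fun t => f t x) (Ici 0)
  lip_x : ∀ t, 0 ≤ t → ∀ x ∈ Icc 0 ℓ, ∀ y ∈ Icc 0 ℓ, |f t x - f t y| ≤ K * |x - y|
  bdd_t : ∀ t, 0 ≤ t → ∀ x ∈ Icc 0 ℓ, |timeDeriv f t x| ≤ K
  lip_tx : ∀ t, 0 ≤ t → ∀ x ∈ Icc 0 ℓ, ∀ y ∈ Icc 0 ℓ,
    |timeDeriv f t x - timeDeriv f t y| ≤ K * |x - y|
  lip_tt : ∀ t, 0 ≤ t → ∀ s, 0 ≤ s → ∀ x ∈ Icc 0 ℓ,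
    |timeDeriv f t x - timeDeriv f s x| ≤ K * |t - s|

/-- Uniform bounds and regularity of the original state, and smallness of its time derivatives. -/
structure IsUniformState (ℓ ρlo ρhi vbar Ct K : ℝ) (ρ v : ℝ → ℝ → ℝ) : Prop where
  density : ∀ t, 0 ≤ t → ∀ x ∈ Icc 0 ℓ, ρlo ≤ ρ t x ∧ ρ t x ≤ ρhi
  velocity : ∀ t, 0 ≤ t → ∀ x ∈ Icc 0 ℓ, |v t x| ≤ vbar
  smallDerivs : ∀ t, 0 ≤ t → ∀ x ∈ Icc 0 ℓ, |timeDeriv ρ t x| + |timeDeriv v t x| ≤ Ct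
  regular_density : IsRegular ℓ K ρ
  regular_velocity : IsRegular ℓ K v

/-! ### Meshes, discrete spaces and projections -/

/-- A partition `0 = x₀ < x₁ < ⋯ < x_M = ℓ` of the interval. -/
structure Mesh (ℓ : ℝ) where
  M : ℕ
  node : ℕ → ℝ
  M_pos : 0 < M
  node_zero : node 0 = 0
  node_last : node M = ℓ
  node_lt : ∀ i < M, node i < node (i + 1)

namespace Mesh

variable {ℓ : ℝ} (T : Mesh ℓ)

/-- The mesh size `h`, the largest length of a cell. -/
def size : ℝ :=
  (Finset.range T.M).sup' (Finset.nonempty_range_iff.2 T.M_pos.ne')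
    (fun i => T.node (i + 1) - T.node i)

/-- The space `Q_h` of piecewise constant functions (values at nodes are immaterial). -/
def IsQ (q : ℝ → ℝ) : Prop :=
  ∀ i < T.M, ∃ c, ∀ x ∈ Ioo (T.node i) (T.node (i + 1)), q x = c

/-- The space `R_h` of continuous piecewise affine functions: affine on each closed cell. -/
def IsR (r : ℝ → ℝ) : Prop :=
  ∀ i < T.M, ∃ a b, ∀ x ∈ Icc (T.node i) (T.node (i + 1)), r x = a + b * x

/-- The `L²`-orthogonal projection `Π_h` onto `Q_h`, that is, the cell averages. -/
def proj (f : ℝ → ℝ) (x : ℝ) : ℝ :=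
  ∑ i ∈ Finset.range T.M, (Ico (T.node i) (T.node (i + 1))).indicator
    (fun _ => (∫ y in T.node i..T.node (i + 1), f y) / (T.node (i + 1) - T.node i)) x

/-- The nodal interpolation `I_h` onto `R_h`: the increment of `f` over a cell is gained
linearly while `x` crosses that cell. -/
def interp (f : ℝ → ℝ) (x : ℝ) : ℝ :=
  f (T.node 0) + ∑ i ∈ Finset.range T.M, (f (T.node (i + 1)) - f (T.node i)) *
    max 0 (min 1 ((x - T.node i) / (T.node (i + 1) - T.node i)))

/-- Density `Π_h ρ(tⁿ)`, `tⁿ = nτ`, of the projected state. -/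
def projDensity (τ : ℝ) (ρ : ℝ → ℝ → ℝ) (n : ℕ) : ℝ → ℝ := T.proj (ρ (n * τ))

/-- Velocity `I_h (ρv)(tⁿ) / Π_h ρ(tⁿ)` of the projected state. -/
def projVelocity (τ : ℝ) (ρ v : ℝ → ℝ → ℝ) (n : ℕ) (x : ℝ) : ℝ :=
  T.interp (fun y => ρ (n * τ) y * v (n * τ) y) x / T.projDensity τ ρ n x

end Mesh

/-! ### The discrete observer -/

/-- The backward difference quotient `(aⁿ - aⁿ⁻¹) / τ` (used for `n ≥ 1`). -/
def backwardDiff (τ : ℝ) (a : ℕ → ℝ) (n : ℕ) : ℝ := (a n - a (n - 1)) / τ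

/-- The discrete velocity `v_h = m_h / ρ_h`. -/
def vel (ρh mh : ℕ → ℝ → ℝ) (n : ℕ) (x : ℝ) : ℝ := mh n x / ρh n x

/-- `(ρh, mh)` solves the mixed finite element / implicit Euler scheme for the observer system:
for all `n ≥ 1`, all `q ∈ Q_h` and all `r ∈ R_h` with `r(0) = 0`,
`⟨∂̄ρ_hⁿ, q⟩ + ⟨∂ₓm_hⁿ, q⟩ = ⟨Π_h s₁ⁿ, q⟩` and
`⟨∂̄v_hⁿ, r⟩ - ⟨h_hⁿ, ∂ₓr⟩ + h_∂ⁿ r(ℓ) + γ⟨|v_hⁿ|v_hⁿ, r⟩ = ⟨s₂ⁿ, r⟩ + μ⟨yⁿ - v_hⁿ, r⟩`,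
where `yⁿ` is the discrete velocity measurement. -/
structure IsObserverSolution {ℓ : ℝ} (T : Mesh ℓ) (τ γ μ : ℝ) (P : ℝ → ℝ) (s₁ s₂ : ℝ → ℝ → ℝ)
    (mBd hBd : ℝ → ℝ) (y : ℕ → ℝ → ℝ) (ρh mh : ℕ → ℝ → ℝ) : Prop where
  density_mem : ∀ n, T.IsQ (ρh n)
  flow_mem : ∀ n, T.IsR (mh n)
  mass : ∀ n, 1 ≤ n → ∀ q, T.IsQ q →
    ip ℓ (fun x => backwardDiff τ (fun k => ρh k x) n) q + ip ℓ (deriv (mh n)) q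
      = ip ℓ (T.proj (s₁ (n * τ))) q
  momentum : ∀ n, 1 ≤ n → ∀ r, T.IsR r → r 0 = 0 →
    ip ℓ (fun x => backwardDiff τ (fun k => vel ρh mh k x) n) r
        - ip ℓ (fun x => enthalpy P (ρh n x) (vel ρh mh n x)) (deriv r)
        + hBd (n * τ) * r ℓ
        + γ * ip ℓ (fun x => |vel ρh mh n x| * vel ρh mh n x) r
      = ip ℓ (s₂ (n * τ)) r + μ * ip ℓ (fun x => y n x - vel ρh mh n x) r
  bc_left : ∀ n, 1 ≤ n → mh n 0 = mBd (n * τ)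

/-- Uniform bounds on the iterates of the discrete observer. -/
def IsUniformDiscrete (ℓ ρlo ρhi vbar : ℝ) (ρh mh : ℕ → ℝ → ℝ) : Prop :=
  ∀ n, ∀ x ∈ Ioo 0 ℓ, (ρlo ≤ ρh n x ∧ ρh n x ≤ ρhi) ∧ |vel ρh mh n x| ≤ vbar

/-! ### Relative energy, auxiliary functional, relative dissipation -/

/-- The energy `∫ ρv²/2 + P(ρ)`, whose variational derivatives are the enthalpy and `ρv`. -/
def energy (ℓ : ℝ) (P : ℝ → ℝ) (ρ v : ℝ → ℝ) : ℝ :=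
  ∫ x in (0 : ℝ)..ℓ, (ρ x * v x ^ 2 / 2 + P (ρ x))

/-- The relative energy `H(u, u') = H(u) - H(u') - ⟨H'(u'), u - u'⟩`. -/
def relEnergy (ℓ : ℝ) (P : ℝ → ℝ) (ρ v ρ' v' : ℝ → ℝ) : ℝ :=
  energy ℓ P ρ v - energy ℓ P ρ' v'
    - (ip ℓ (fun x => enthalpy P (ρ' x) (v' x)) (fun x => ρ x - ρ' x)
      + ip ℓ (fun x => ρ' x * v' x) (fun x => v x - v' x))

/-- `M(x) = -∫₀ˣ ρ`. -/
def negPrimitive (ρ : ℝ → ℝ) (x : ℝ) : ℝ := - ∫ s in (0 : ℝ)..x, ρ s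

/-- The auxiliary functional `G_h(u, u') = ⟨M - M', v - v'⟩`. -/
def auxG (ℓ : ℝ) (ρ v ρ' v' : ℝ → ℝ) : ℝ :=
  ip ℓ (fun x => negPrimitive ρ x - negPrimitive ρ' x) (fun x => v x - v' x)

/-- The relative dissipation `(γ/4) ⟨ρ'(v - v'), (v - v')(|v| + |v'|)⟩`. -/
def relDissipation (ℓ γ : ℝ) (v ρ' v' : ℝ → ℝ) : ℝ :=
  γ / 4 * ip ℓ (fun x => ρ' x * (v x - v' x)) (fun x => (v x - v' x) * (|v x| + |v' x|))

/-- The modified relative energy `H + δ G_h` between `u_hⁿ` and the projected state. -/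
def modEnergy {ℓ : ℝ} (T : Mesh ℓ) (τ δ : ℝ) (P : ℝ → ℝ) (ρ v : ℝ → ℝ → ℝ)
    (ρh mh : ℕ → ℝ → ℝ) (n : ℕ) : ℝ :=
  relEnergy ℓ P (ρh n) (vel ρh mh n) (T.projDensity τ ρ n) (T.projVelocity τ ρ v n)
    + δ * auxG ℓ (ρh n) (vel ρh mh n) (T.projDensity τ ρ n) (T.projVelocity τ ρ v n)

/-- The squared error `‖u_hⁿ - û_hⁿ‖²`. -/
def errSq {ℓ : ℝ} (T : Mesh ℓ) (τ : ℝ) (ρ v : ℝ → ℝ → ℝ) (ρh mh : ℕ → ℝ → ℝ) (n : ℕ) : ℝ :=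
  distSq ℓ (ρh n) (vel ρh mh n) (T.projDensity τ ρ n) (T.projVelocity τ ρ v n)

/-- The pairing of the enthalpy projection error with the density error at time `tⁿ`. -/
def projPairing {ℓ : ℝ} (T : Mesh ℓ) (τ : ℝ) (P : ℝ → ℝ) (ρ v : ℝ → ℝ → ℝ)
    (ρh : ℕ → ℝ → ℝ) (n : ℕ) : ℝ :=
  ip ℓ (fun x => enthalpy P (ρ (n * τ) x) (v (n * τ) x)
      - enthalpy P (T.projDensity τ ρ n x) (T.projVelocity τ ρ v n x))
    (fun x => ρh n x - T.projDensity τ ρ n x)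

end BarotropicObserver

end

noncomputable section
namespace BarotropicObserver

/-- Essentially bounded measurable functions on `(0, ℓ)`. -/
@[fun_prop]
structure EssBdd (ℓ : ℝ) (f : ℝ → ℝ) : Prop where
  meas : AEStronglyMeasurable f (volume.restrict (Ioo 0 ℓ))
  bdd : ∃ C, ∀ᵐ x ∂(volume.restrict (Ioo 0 ℓ)), |f x| ≤ C

namespace EssBdd

variable {ℓ : ℝ} {f g : ℝ → ℝ}

@[fun_prop]
theorem const (c : ℝ) : EssBdd ℓ (fun _ => c) :=
  ⟨aestronglyMeasurable_const, |c|, by simp⟩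

@[fun_prop]
theorem add (hf : EssBdd ℓ f) (hg : EssBdd ℓ g) : EssBdd ℓ (fun x => f x + g x) := by
  obtain ⟨hm, C, hC⟩ := hf
  obtain ⟨hm', D, hD⟩ := hg
  refine ⟨hm.add hm', C + D, ?_⟩
  filter_upwards [hC, hD] with x h1 h2
  exact (abs_add_le _ _).trans (add_le_add h1 h2)

@[fun_prop]
theorem mul (hf : EssBdd ℓ f) (hg : EssBdd ℓ g) : EssBdd ℓ (fun x => f x * g x) := by
  obtain ⟨hm, C, hC⟩ := hf
  obtain ⟨hm', D, hD⟩ := hg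
  refine ⟨hm.mul hm', C * D, ?_⟩
  filter_upwards [hC, hD] with x h1 h2
  rw [abs_mul]
  exact mul_le_mul h1 h2 (abs_nonneg _) ((abs_nonneg _).trans h1)

@[fun_prop]
theorem neg (hf : EssBdd ℓ f) : EssBdd ℓ (fun x => - f x) := by
  simpa using (const (-1)).mul hf

@[fun_prop]
theorem sub (hf : EssBdd ℓ f) (hg : EssBdd ℓ g) : EssBdd ℓ (fun x => f x - g x) := by
  simpa only [sub_eq_add_neg] using hf.add hg.neg

@[fun_prop]
theorem div_const (hf : EssBdd ℓ f) (c : ℝ) : EssBdd ℓ (fun x => f x / c) := by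
  simpa only [div_eq_mul_inv] using hf.mul (const c⁻¹)

@[fun_prop]
theorem pow (hf : EssBdd ℓ f) (n : ℕ) : EssBdd ℓ (fun x => f x ^ n) := by
  induction n with
  | zero => simpa using const 1
  | succ n ih => simpa only [pow_succ] using ih.mul hf

@[fun_prop]
theorem abs (hf : EssBdd ℓ f) : EssBdd ℓ (fun x => |f x|) := by
  obtain ⟨hm, C, hC⟩ := hf
  exact ⟨by simpa using hm.norm, C, by simpa using hC⟩

theorem congr (hf : EssBdd ℓ f) (h : f =ᵐ[volume.restrict (Ioo 0 ℓ)] g) : EssBdd ℓ g := by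
  obtain ⟨hm, C, hC⟩ := hf
  refine ⟨hm.congr h, C, ?_⟩
  filter_upwards [hC, h] with x h1 h2
  rwa [← h2]

theorem integrable (hf : EssBdd ℓ f) : Integrable f (volume.restrict (Ioo 0 ℓ)) := by
  obtain ⟨hm, C, hC⟩ := hf
  exact Integrable.of_bound hm C (by simpa using hC)

theorem intervalIntegrable (hℓ : 0 ≤ ℓ) (hf : EssBdd ℓ f) :
    IntervalIntegrable f volume 0 ℓ := by
  rw [intervalIntegrable_iff_integrableOn_Ioo_of_le hℓ]
  exact hf.integrable

theorem memLp_two (hf : EssBdd ℓ f) : InL2 ℓ f := by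
  obtain ⟨hm, C, hC⟩ := hf
  exact MemLp.of_bound hm C (by simpa using hC)

theorem of_continuousOn (h : ContinuousOn f (Icc 0 ℓ)) : EssBdd ℓ f := by
  obtain ⟨C, hC⟩ := isCompact_Icc.exists_bound_of_continuousOn h
  refine ⟨(h.mono Ioo_subset_Icc_self).aestronglyMeasurable measurableSet_Ioo, C, ?_⟩
  filter_upwards [ae_restrict_mem measurableSet_Ioo] with x hx
  exact hC x (Ioo_subset_Icc_self hx)

theorem comp_continuousOn {F : ℝ → ℝ} {a b : ℝ} (hab : a ≤ b) (hF : ContinuousOn F (Icc a b))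
    (hf : EssBdd ℓ f) (h : ∀ᵐ x ∂(volume.restrict (Ioo 0 ℓ)), f x ∈ Icc a b) :
    EssBdd ℓ (fun x => F (f x)) := by
  obtain ⟨C, hC⟩ := isCompact_Icc.exists_bound_of_continuousOn hF
  have hcont : Continuous (IccExtend hab ((Icc a b).domRestrict F)) :=
    (continuousOn_iff_continuous_domRestrict.1 hF).Icc_extend'
  refine ⟨(hcont.comp_aestronglyMeasurable hf.meas).congr ?_, C, ?_⟩
  · filter_upwards [h] with x hx
    simp [IccExtend_of_mem _ _ hx]
  · filter_upwards [h] with x hx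
    exact hC _ hx

end EssBdd

/-- Two-sided bounds for the pressure potential on the range of admissible densities. -/
structure PressureBounds (P : ℝ → ℝ) (a b c L : ℝ) : Prop where
  pos : 0 < c
  hasDeriv : ∀ x ∈ Icc a b, HasDerivAt P (deriv P x) x
  hasDeriv2 : ∀ x ∈ Icc a b, HasDerivAt (deriv P) (deriv (deriv P) x) x
  lower : ∀ x ∈ Icc a b, c ≤ deriv (deriv P) x
  upper : ∀ x ∈ Icc a b, deriv (deriv P) x ≤ L
  lip : ∀ x ∈ Icc a b, ∀ y ∈ Icc a b, |deriv (deriv P) x - deriv (deriv P) y| ≤ L * |x - y|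

theorem IsPressurePotential.exists_bounds {P : ℝ → ℝ} {a b : ℝ} (ha : 0 < a)
    (h : IsPressurePotential P a b) : ∃ c L, 1 ≤ L ∧ PressureBounds P a b c L := by
  obtain ⟨hP, c, hc, hlow⟩ := h
  have hsub : Icc a b ⊆ Ioi 0 := fun x hx => ha.trans_le hx.1
  have h1 : ContDiffOn ℝ 2 (deriv P) (Ioi 0) :=
    ((contDiffOn_succ_iff_deriv_of_isOpen (n := 2) isOpen_Ioi).1 (by rw [two_add_one_eq_three]; exact hP)).2.2
  have h2 : ContDiffOn ℝ 1 (deriv (deriv P)) (Ioi 0) :=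
    ((contDiffOn_succ_iff_deriv_of_isOpen (n := 1) isOpen_Ioi).1 (by rw [one_add_one_eq_two]; exact h1)).2.2
  have h3 : ContinuousOn (deriv (deriv (deriv P))) (Ioi 0) :=
    h2.continuousOn_deriv_of_isOpen isOpen_Ioi le_rfl
  obtain ⟨C2, hC2⟩ := isCompact_Icc.exists_bound_of_continuousOn (h2.continuousOn.mono hsub)
  obtain ⟨C3, hC3⟩ := isCompact_Icc.exists_bound_of_continuousOn (h3.mono hsub)
  have hd : ∀ {f : ℝ → ℝ} {n : WithTop ℕ∞}, n ≠ 0 → ContDiffOn ℝ n f (Ioi 0) →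
      ∀ x ∈ Icc a b, HasDerivAt f (deriv f x) x := fun hn hf x hx =>
    ((hf.differentiableOn hn).differentiableAt (isOpen_Ioi.mem_nhds (hsub hx))).hasDerivAt
  refine ⟨c, max 1 (max C2 C3), le_max_left _ _, hc, hd (by simp) hP, hd (by simp) h1, hlow,
    fun x hx => ?_, fun x hx y hy => ?_⟩
  · exact ((le_abs_self _).trans (hC2 x hx)).trans ((le_max_left _ _).trans (le_max_right _ _))
  · exact (convex_Icc a b).norm_image_sub_le_of_norm_hasDerivWithin_le
      (fun z hz => (hd (by simp) h2 z hz).hasDerivWithinAt)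
      (fun z hz => (hC3 z hz).trans ((le_max_right _ _).trans (le_max_right _ _))) hy hx

namespace PressureBounds

variable {P : ℝ → ℝ} {a b c L : ℝ}

theorem abs_deriv_sub_le (h : PressureBounds P a b c L) {x y : ℝ} (hx : x ∈ Icc a b)
    (hy : y ∈ Icc a b) : |deriv P x - deriv P y| ≤ L * |x - y| :=
  (convex_Icc a b).norm_image_sub_le_of_norm_hasDerivWithin_le
    (fun z hz => (h.hasDeriv2 z hz).hasDerivWithinAt)
    (fun z hz => by
      rw [Real.norm_eq_abs, abs_of_pos (h.pos.trans_le (h.lower z hz))]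
      exact h.upper z hz) hy hx

theorem abs_taylor_le (h : PressureBounds P a b c L) {x y : ℝ} (hx : x ∈ Icc a b)
    (hy : y ∈ Icc a b) :
    |deriv P x - deriv P y - deriv (deriv P) y * (x - y)| ≤ L * (x - y) ^ 2 := by
  have hsub : uIcc y x ⊆ Icc a b := ordConnected_Icc.uIcc_subset hy hx
  have hL : 0 ≤ L := (h.pos.trans_le (h.lower x hx)).le.trans (h.upper x hx)
  have := (convex_uIcc y x).norm_image_sub_le_of_norm_hasDerivWithin_le
    (f := fun z => deriv P z - deriv (deriv P) y * z) (C := L * |x - y|)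
    (fun z hz => (((h.hasDeriv2 z (hsub hz)).sub
      ((hasDerivAt_id z).const_mul (deriv (deriv P) y)))).hasDerivWithinAt)
    (fun z hz => by
      rw [Real.norm_eq_abs, mul_one]
      exact (h.lip z (hsub hz) y hy).trans
        (mul_le_mul_of_nonneg_left (abs_sub_left_of_mem_uIcc hz) hL))
    left_mem_uIcc right_mem_uIcc
  rw [Real.norm_eq_abs, Real.norm_eq_abs, mul_assoc, ← pow_two, sq_abs] at this
  convert this using 2
  ring

theorem continuousOn (h : PressureBounds P a b c L) : ContinuousOn P (Icc a b) :=
  fun x hx => (h.hasDeriv x hx).continuousAt.continuousWithinAt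

theorem continuousOn_deriv (h : PressureBounds P a b c L) : ContinuousOn (deriv P) (Icc a b) :=
  fun x hx => (h.hasDeriv2 x hx).continuousAt.continuousWithinAt

theorem mul_sq_le (h : PressureBounds P a b c L) {x y : ℝ} (hx : x ∈ Icc a b)
    (hy : y ∈ Icc a b) : c * (x - y) ^ 2 ≤ (deriv P x - deriv P y) * (x - y) := by
  have key : ∀ {x y : ℝ}, x ∈ Icc a b → y ∈ Icc a b → x ≤ y →
      c * (y - x) ≤ deriv P y - deriv P x := fun hx hy hxy =>
    (convex_Icc a b).mul_sub_le_image_sub_of_le_deriv h.continuousOn_deriv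
      (fun z hz => (h.hasDeriv2 z (interior_subset hz)).differentiableAt.differentiableWithinAt)
      (fun z hz => h.lower z (interior_subset hz)) _ hx _ hy hxy
  rcases le_total x y with hxy | hxy
  · nlinarith [key hx hy hxy]
  · nlinarith [key hy hx hxy]

/-- Second differences of `P'` along two pairs of densities. -/
theorem abs_second_diff_le (h : PressureBounds P a b c L) {a₀ a₁ b₀ b₁ : ℝ}
    (ha₀ : a₀ ∈ Icc a b) (ha₁ : a₁ ∈ Icc a b) (hb₀ : b₀ ∈ Icc a b) (hb₁ : b₁ ∈ Icc a b) :
    |(deriv P a₁ - deriv P b₁) - (deriv P a₀ - deriv P b₀)|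
      ≤ L * |(a₁ - b₁) - (a₀ - b₀)| + L * (|a₀ - b₀| + |a₁ - b₁|) * |b₁ - b₀| := by
  have hL : 0 ≤ L := (h.pos.trans_le (h.lower _ ha₀)).le.trans (h.upper _ ha₀)
  have hmem : ∀ {x y s : ℝ}, x ∈ Icc a b → y ∈ Icc a b → s ∈ Icc (0 : ℝ) 1 →
      x + s * (y - x) ∈ Icc a b := fun {x y s} hx hy hs => by
    constructor <;> nlinarith [hx.1, hx.2, hy.1, hy.2, hs.1, hs.2]
  have hder : ∀ {x y s : ℝ}, HasDerivAt (fun s : ℝ => x + s * (y - x)) (y - x) s :=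
    fun {x y s} => by simpa using ((hasDerivAt_id s).mul_const (y - x)).const_add x
  have hφd : ∀ s ∈ Icc (0 : ℝ) 1, HasDerivAt
      (fun s => deriv P (a₀ + s * (a₁ - a₀)) - deriv P (b₀ + s * (b₁ - b₀)))
      (deriv (deriv P) (a₀ + s * (a₁ - a₀)) * (a₁ - a₀)
        - deriv (deriv P) (b₀ + s * (b₁ - b₀)) * (b₁ - b₀)) s := fun s hs => by
    have d1 : HasDerivAt (fun s => deriv P (a₀ + s * (a₁ - a₀)))
      (deriv (deriv P) (a₀ + s * (a₁ - a₀)) * (a₁ - a₀)) s :=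
      HasDerivAt.comp (h₂ := deriv P) s (h.hasDeriv2 _ (hmem ha₀ ha₁ hs)) hder
    have d2 : HasDerivAt (fun s => deriv P (b₀ + s * (b₁ - b₀)))
      (deriv (deriv P) (b₀ + s * (b₁ - b₀)) * (b₁ - b₀)) s :=
      HasDerivAt.comp (h₂ := deriv P) s (h.hasDeriv2 _ (hmem hb₀ hb₁ hs)) hder
    exact d1.sub d2
  have := (convex_Icc (0 : ℝ) 1).norm_image_sub_le_of_norm_hasDerivWithin_le
    (f := fun s => deriv P (a₀ + s * (a₁ - a₀)) - deriv P (b₀ + s * (b₁ - b₀)))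
    (C := L * |(a₁ - b₁) - (a₀ - b₀)| + L * (|a₀ - b₀| + |a₁ - b₁|) * |b₁ - b₀|)
    (fun s hs => (hφd s hs).hasDerivWithinAt)
    (fun s hs => by
      have hA := hmem ha₀ ha₁ hs
      have hB := hmem hb₀ hb₁ hs
      have e1 : deriv (deriv P) (a₀ + s * (a₁ - a₀)) * (a₁ - a₀)
          - deriv (deriv P) (b₀ + s * (b₁ - b₀)) * (b₁ - b₀)
          = deriv (deriv P) (a₀ + s * (a₁ - a₀)) * ((a₁ - b₁) - (a₀ - b₀))
          + (deriv (deriv P) (a₀ + s * (a₁ - a₀)) - deriv (deriv P) (b₀ + s * (b₁ - b₀)))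
            * (b₁ - b₀) := by ring
      have e2 : |(a₀ + s * (a₁ - a₀)) - (b₀ + s * (b₁ - b₀))| ≤ |a₀ - b₀| + |a₁ - b₁| := by
        have : (a₀ + s * (a₁ - a₀)) - (b₀ + s * (b₁ - b₀))
          = (1 - s) * (a₀ - b₀) + s * (a₁ - b₁) := by ring
        rw [this]
        refine (abs_add_le _ _).trans (add_le_add ?_ ?_)
        · rw [abs_mul, abs_of_nonneg (by linarith [hs.2])]
          exact mul_le_of_le_one_left (abs_nonneg _) (by linarith [hs.1])
        · rw [abs_mul, abs_of_nonneg hs.1]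
          exact mul_le_of_le_one_left (abs_nonneg _) hs.2
      rw [Real.norm_eq_abs, e1]
      refine (abs_add_le _ _).trans (add_le_add ?_ ?_)
      · rw [abs_mul, abs_of_pos (h.pos.trans_le (h.lower _ hA))]
        exact mul_le_mul_of_nonneg_right (h.upper _ hA) (abs_nonneg _)
      · rw [abs_mul]
        exact mul_le_mul_of_nonneg_right ((h.lip _ hA _ hB).trans
          (mul_le_mul_of_nonneg_left e2 hL)) (abs_nonneg _))
    (left_mem_Icc.2 zero_le_one) (right_mem_Icc.2 zero_le_one)
  simpa using this

/-- One time step of the relative pressure energy: discrete chain rule with numerical dissipation. -/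
theorem relative_step_le (h : PressureBounds P a b c L) {a₀ a₁ b₀ b₁ : ℝ}
    (ha₀ : a₀ ∈ Icc a b) (ha₁ : a₁ ∈ Icc a b) (hb₀ : b₀ ∈ Icc a b) (hb₁ : b₁ ∈ Icc a b) :
    (P a₁ - P b₁ - deriv P b₁ * (a₁ - b₁)) - (P a₀ - P b₀ - deriv P b₀ * (a₀ - b₀))
      ≤ (deriv P a₁ - deriv P b₁) * ((a₁ - b₁) - (a₀ - b₀))
        - c / 2 * ((a₁ - b₁) - (a₀ - b₀)) ^ 2
        + 4 * L * |b₁ - b₀| * ((a₀ - b₀) ^ 2 + (a₁ - b₁) ^ 2) := by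
  have hL : 0 ≤ L := (h.pos.trans_le (h.lower _ ha₀)).le.trans (h.upper _ ha₀)
  have hmem : ∀ {x y s : ℝ}, x ∈ Icc a b → y ∈ Icc a b → s ∈ Icc (0 : ℝ) 1 →
      x + s * (y - x) ∈ Icc a b := fun {x y s} hx hy hs => by
    constructor <;> nlinarith [hx.1, hx.2, hy.1, hy.2, hs.1, hs.2]
  have hder : ∀ {x y s : ℝ}, HasDerivAt (fun s : ℝ => x + s * (y - x)) (y - x) s :=
    fun {x y s} => by simpa using ((hasDerivAt_id s).mul_const (y - x)).const_add x
  set e := (a₁ - b₁) - (a₀ - b₀) with he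
  set B := |a₀ - b₀| + |a₁ - b₁| with hB
  have hB0 : 0 ≤ B := by positivity
  have heB : |e| ≤ B := by
    rw [he, hB, add_comm]; exact abs_sub _ _
  have hes : ∀ {s : ℝ}, s ∈ Icc (0 : ℝ) 1 →
      |(a₀ + s * (a₁ - a₀)) - (b₀ + s * (b₁ - b₀))| ≤ B := fun {s} hs => by
    have : (a₀ + s * (a₁ - a₀)) - (b₀ + s * (b₁ - b₀))
      = (1 - s) * (a₀ - b₀) + s * (a₁ - b₁) := by ring
    rw [this]
    refine (abs_add_le _ _).trans (add_le_add ?_ ?_)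
    · rw [abs_mul, abs_of_nonneg (by linarith [hs.2])]
      exact mul_le_of_le_one_left (abs_nonneg _) (by linarith [hs.1])
    · rw [abs_mul, abs_of_nonneg hs.1]
      exact mul_le_of_le_one_left (abs_nonneg _) hs.2
  set φ : ℝ → ℝ := fun s => deriv P (a₀ + s * (a₁ - a₀)) - deriv P (b₀ + s * (b₁ - b₀)) with hφ
  have hφd : ∀ s ∈ Icc (0 : ℝ) 1, HasDerivAt φ
      (deriv (deriv P) (a₀ + s * (a₁ - a₀)) * (a₁ - a₀)
        - deriv (deriv P) (b₀ + s * (b₁ - b₀)) * (b₁ - b₀)) s := fun s hs => by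
    have d1 : HasDerivAt (fun s => deriv P (a₀ + s * (a₁ - a₀)))
      (deriv (deriv P) (a₀ + s * (a₁ - a₀)) * (a₁ - a₀)) s :=
      HasDerivAt.comp (h₂ := deriv P) s (h.hasDeriv2 _ (hmem ha₀ ha₁ hs)) hder
    have d2 : HasDerivAt (fun s => deriv P (b₀ + s * (b₁ - b₀)))
      (deriv (deriv P) (b₀ + s * (b₁ - b₀)) * (b₁ - b₀)) s :=
      HasDerivAt.comp (h₂ := deriv P) s (h.hasDeriv2 _ (hmem hb₀ hb₁ hs)) hder
    exact d1.sub d2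
  have hmono : ∀ s ∈ Icc (0 : ℝ) 1,
      (c * e ^ 2 - L * B * |b₁ - b₀| * |e|) * (1 - s) ≤ φ 1 * e - φ s * e := by
    intro s hs
    refine (convex_Icc (0 : ℝ) 1).mul_sub_le_image_sub_of_le_deriv (f := fun s => φ s * e)
      (fun z hz => ((hφd z hz).mul_const e).continuousAt.continuousWithinAt)
      (fun z hz =>
        ((hφd z (interior_subset hz)).mul_const e).differentiableAt.differentiableWithinAt)
      (fun z hz => ?_) _ hs _ (right_mem_Icc.2 zero_le_one) hs.2
    have hz := interior_subset hz
    have hA := hmem ha₀ ha₁ hz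
    have hBm := hmem hb₀ hb₁ hz
    rw [((hφd z hz).mul_const e).deriv]
    have e1 : (deriv (deriv P) (a₀ + z * (a₁ - a₀)) * (a₁ - a₀)
        - deriv (deriv P) (b₀ + z * (b₁ - b₀)) * (b₁ - b₀)) * e
        = deriv (deriv P) (a₀ + z * (a₁ - a₀)) * e ^ 2
        + (deriv (deriv P) (a₀ + z * (a₁ - a₀)) - deriv (deriv P) (b₀ + z * (b₁ - b₀)))
          * (b₁ - b₀) * e := by rw [he]; ring
    have e2 : |(deriv (deriv P) (a₀ + z * (a₁ - a₀)) - deriv (deriv P) (b₀ + z * (b₁ - b₀)))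
          * (b₁ - b₀) * e| ≤ L * B * |b₁ - b₀| * |e| := by
      rw [abs_mul, abs_mul]
      gcongr
      exact (h.lip _ hA _ hBm).trans (mul_le_mul_of_nonneg_left (hes hz) hL)
    have e3 := mul_le_mul_of_nonneg_right (h.lower _ hA) (sq_nonneg e)
    rw [e1]
    linarith [neg_abs_le ((deriv (deriv P) (a₀ + z * (a₁ - a₀))
      - deriv (deriv P) (b₀ + z * (b₁ - b₀))) * (b₁ - b₀) * e)]
  set k : ℝ → ℝ := fun s => P (a₀ + s * (a₁ - a₀)) - P (b₀ + s * (b₁ - b₀))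
    - deriv P (b₀ + s * (b₁ - b₀)) * ((a₀ + s * (a₁ - a₀)) - (b₀ + s * (b₁ - b₀)))
    - φ 1 * e * s - c / 2 * e ^ 2 * (1 - s) ^ 2 with hk
  have hkd : ∀ s ∈ Icc (0 : ℝ) 1, HasDerivAt k
      (φ s * e + (φ s - deriv (deriv P) (b₀ + s * (b₁ - b₀))
        * ((a₀ + s * (a₁ - a₀)) - (b₀ + s * (b₁ - b₀)))) * (b₁ - b₀)
        - φ 1 * e + c * e ^ 2 * (1 - s)) s := by
    intro s hs
    have d1 := (h.hasDeriv _ (hmem ha₀ ha₁ hs)).comp s hder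
    have d2 := (h.hasDeriv _ (hmem hb₀ hb₁ hs)).comp s hder
    have d3 := (HasDerivAt.comp (h₂ := deriv P) s (h.hasDeriv2 _ (hmem hb₀ hb₁ hs)) hder).mul
      ((hder (x := a₀) (y := a₁) (s := s)).sub (hder (x := b₀) (y := b₁) (s := s)))
    have d4 := (hasDerivAt_id s).const_mul (φ 1 * e)
    have d5 := (((hasDerivAt_id s).const_sub 1).pow 2).const_mul (c / 2 * e ^ 2)
    have := (((d1.sub d2).sub d3).sub d4).sub d5
    refine this.congr_deriv ?_
    simp only [Function.comp, id, he, hφ, Pi.sub_apply]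
    push_cast
    ring
  have hfin := (convex_Icc (0 : ℝ) 1).image_sub_le_mul_sub_of_deriv_le (f := k)
    (C := 2 * L * B ^ 2 * |b₁ - b₀|)
    (fun z hz => (hkd z hz).continuousAt.continuousWithinAt)
    (fun z hz => (hkd z (interior_subset hz)).differentiableAt.differentiableWithinAt)
    (fun z hz => by
      have hz := interior_subset hz
      rw [(hkd z hz).deriv]
      have e1 := hmono z hz
      have e2 : |(φ z - deriv (deriv P) (b₀ + z * (b₁ - b₀))
        * ((a₀ + z * (a₁ - a₀)) - (b₀ + z * (b₁ - b₀)))) * (b₁ - b₀)|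
          ≤ L * B ^ 2 * |b₁ - b₀| := by
        rw [abs_mul]
        gcongr
        refine (h.abs_taylor_le (hmem ha₀ ha₁ hz) (hmem hb₀ hb₁ hz)).trans ?_
        refine mul_le_mul_of_nonneg_left ?_ hL
        rw [← sq_abs]
        exact pow_le_pow_left₀ (abs_nonneg _) (hes hz) 2
      have e3 : L * B * |b₁ - b₀| * |e| * (1 - z) ≤ L * B ^ 2 * |b₁ - b₀| := by
        calc L * B * |b₁ - b₀| * |e| * (1 - z) ≤ L * B * |b₁ - b₀| * B * 1 := by
              gcongr
              · linarith [hz.2]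
              · linarith [hz.1]
          _ = _ := by ring
      linarith [le_abs_self ((φ z - deriv (deriv P) (b₀ + z * (b₁ - b₀))
        * ((a₀ + z * (a₁ - a₀)) - (b₀ + z * (b₁ - b₀)))) * (b₁ - b₀))])
    _ (left_mem_Icc.2 zero_le_one) _ (right_mem_Icc.2 zero_le_one) zero_le_one
  simp only [hk, hφ, zero_mul, one_mul, add_zero, add_sub_cancel, mul_zero, mul_one, sub_zero,
    sub_self] at hfin
  have hB2 : B ^ 2 ≤ 2 * ((a₀ - b₀) ^ 2 + (a₁ - b₁) ^ 2) := by
    rw [hB]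
    nlinarith [sq_abs (a₀ - b₀), sq_abs (a₁ - b₁), sq_nonneg (|a₀ - b₀| - |a₁ - b₁|)]
  have := mul_le_mul_of_nonneg_left hB2 (by positivity : 0 ≤ 2 * L * |b₁ - b₀|)
  linarith

end PressureBounds

namespace Mesh

variable {ℓ : ℝ} (T : Mesh ℓ)

theorem node_mono {i j : ℕ} (hij : i ≤ j) (hj : j ≤ T.M) : T.node i ≤ T.node j := by
  induction j, hij using Nat.le_induction with
  | base => exact le_rfl
  | succ k hk ih => exact (ih (by omega)).trans (T.node_lt k (by omega)).le

theorem node_mem {i : ℕ} (hi : i ≤ T.M) : T.node i ∈ Icc 0 ℓ := by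
  constructor
  · rw [← T.node_zero]; exact T.node_mono (Nat.zero_le _) hi
  · exact (T.node_mono hi le_rfl).trans_eq T.node_last

theorem length_pos {i : ℕ} (hi : i < T.M) : 0 < T.node (i + 1) - T.node i :=
  sub_pos.2 (T.node_lt i hi)

theorem length_le_size {i : ℕ} (hi : i < T.M) : T.node (i + 1) - T.node i ≤ T.size :=
  Finset.le_sup' (fun i => T.node (i + 1) - T.node i) (Finset.mem_range.2 hi)

theorem size_pos : 0 < T.size := (T.length_pos T.M_pos).trans_le (T.length_le_size T.M_pos)

theorem cell_subset {i : ℕ} (hi : i < T.M) :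
    Icc (T.node i) (T.node (i + 1)) ⊆ Icc 0 ℓ := fun _ hx =>
  ⟨(T.node_mem hi.le).1.trans hx.1, hx.2.trans (T.node_mem hi).2⟩

theorem abs_sub_le_size {i : ℕ} (hi : i < T.M) {x y : ℝ}
    (hx : x ∈ Icc (T.node i) (T.node (i + 1))) (hy : y ∈ Icc (T.node i) (T.node (i + 1))) :
    |x - y| ≤ T.size :=
  (abs_sub_le_iff.2 ⟨by linarith [hx.2, hy.1], by linarith [hy.2, hx.1]⟩).trans
    (T.length_le_size hi)

theorem exists_cell {k : ℕ} (hk : k ≤ T.M) {x : ℝ} (h0 : T.node 0 ≤ x) (hx : x < T.node k) :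
    ∃ i < k, x ∈ Ico (T.node i) (T.node (i + 1)) := by
  induction k with
  | zero => exact absurd hx (not_lt.2 h0)
  | succ k ih =>
    rcases lt_or_ge x (T.node k) with h | h
    · obtain ⟨i, hi, hxi⟩ := ih (by omega) h
      exact ⟨i, by omega, hxi⟩
    · exact ⟨k, by omega, h, hx⟩

theorem exists_mem_cell {x : ℝ} (hx : x ∈ Ico 0 ℓ) :
    ∃ i < T.M, x ∈ Ico (T.node i) (T.node (i + 1)) :=
  T.exists_cell le_rfl (T.node_zero.trans_le hx.1) (hx.2.trans_eq T.node_last.symm)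

/-- Almost every point lies in the interior of a cell. -/
theorem ae_mem_cell : ∀ᵐ x ∂(volume.restrict (Ioo 0 ℓ)),
    ∃ i < T.M, x ∈ Ioo (T.node i) (T.node (i + 1)) := by
  have hfin : (T.node '' (Finset.range T.M : Set ℕ)).Finite := (Finset.finite_toSet _).image _
  have h0 : ∀ᵐ x ∂(volume.restrict (Ioo 0 ℓ)), x ∉ T.node '' (Finset.range T.M : Set ℕ) :=
    ae_restrict_of_ae (measure_eq_zero_iff_ae_notMem.1 (hfin.measure_zero _))
  filter_upwards [ae_restrict_mem measurableSet_Ioo, h0] with x hx hn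
  obtain ⟨i, hi, hxi⟩ := T.exists_mem_cell (Ioo_subset_Ico_self hx)
  refine ⟨i, hi, lt_of_le_of_ne hxi.1 fun he => hn ⟨i, by simpa using hi, he⟩, hxi.2⟩

theorem proj_eq {i : ℕ} (hi : i < T.M) {x : ℝ} (hx : x ∈ Ico (T.node i) (T.node (i + 1)))
    (f : ℝ → ℝ) : T.proj f x
      = (∫ y in T.node i..T.node (i + 1), f y) / (T.node (i + 1) - T.node i) := by
  unfold proj
  rw [Finset.sum_eq_single_of_mem i (Finset.mem_range.2 hi), indicator_of_mem hx]
  intro j hj hji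
  have hj := Finset.mem_range.1 hj
  refine indicator_of_notMem (fun hxj => ?_) _
  rcases lt_or_gt_of_ne hji with h | h
  · exact absurd (hxj.2.trans_le (T.node_mono (Nat.succ_le_of_lt h) hi.le)) (not_lt.2 hx.1)
  · exact absurd (hx.2.trans_le (T.node_mono (Nat.succ_le_of_lt h) hj.le)) (not_lt.2 hxj.1)

theorem interp_eq {i : ℕ} (hi : i < T.M) {x : ℝ} (hx : x ∈ Icc (T.node i) (T.node (i + 1)))
    (f : ℝ → ℝ) : T.interp f x = f (T.node i) + (f (T.node (i + 1)) - f (T.node i))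
      * ((x - T.node i) / (T.node (i + 1) - T.node i)) := by
  unfold interp
  have key : ∀ j < T.M, (f (T.node (j + 1)) - f (T.node j)) *
      max 0 (min 1 ((x - T.node j) / (T.node (j + 1) - T.node j)))
      = (if j < i then f (T.node (j + 1)) - f (T.node j) else 0) + (if j = i then
        (f (T.node (i + 1)) - f (T.node i)) * ((x - T.node i) / (T.node (i + 1) - T.node i))
        else 0) := by
    intro j hj
    have hl := T.length_pos hj
    rcases lt_trichotomy j i with h | h | h
    · have : 1 ≤ (x - T.node j) / (T.node (j + 1) - T.node j) := by
        rw [one_le_div hl]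
        linarith [T.node_mono (Nat.succ_le_of_lt h) hi.le, hx.1]
      simp [h, h.ne, min_eq_left this]
    · subst h
      have h1 : 0 ≤ (x - T.node j) / (T.node (j + 1) - T.node j) :=
        div_nonneg (by linarith [hx.1]) hl.le
      have h2 : (x - T.node j) / (T.node (j + 1) - T.node j) ≤ 1 := by
        rw [div_le_one hl]; linarith [hx.2]
      simp [min_eq_right h2, max_eq_right h1]
    · have : (x - T.node j) / (T.node (j + 1) - T.node j) ≤ 0 :=
        div_nonpos_of_nonpos_of_nonneg
          (by linarith [T.node_mono (Nat.succ_le_of_lt h) hj.le, hx.2]) hl.le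
      simp [h.not_gt, h.ne', min_eq_right (this.trans zero_le_one), max_eq_left this]
  rw [Finset.sum_congr rfl fun j hj => key j (Finset.mem_range.1 hj), Finset.sum_add_distrib,
    Finset.sum_ite_eq' (Finset.range T.M) i, if_pos (Finset.mem_range.2 hi), ← Finset.sum_filter]
  have hfil : (Finset.range T.M).filter (fun j => j < i) = Finset.range i := by
    ext j; simp only [Finset.mem_filter, Finset.mem_range]; omega
  rw [hfil, Finset.sum_range_sub (fun j => f (T.node j))]
  ring

theorem interp_zero (f : ℝ → ℝ) : T.interp f 0 = f 0 := by
  have h := T.node_lt 0 T.M_pos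
  have := T.interp_eq T.M_pos (x := T.node 0) ⟨le_rfl, h.le⟩ f
  rw [T.node_zero] at this
  simpa using this

theorem lipschitz_interp (f : ℝ → ℝ) : ∃ K, LipschitzWith K (T.interp f) := by
  have : ∀ s : Finset ℕ, ∃ K, LipschitzWith K (fun x => ∑ i ∈ s,
      (f (T.node (i + 1)) - f (T.node i)) *
        max 0 (min 1 ((x - T.node i) / (T.node (i + 1) - T.node i)))) := by
    intro s
    induction s using Finset.induction_on with
    | empty => exact ⟨0, by simp⟩
    | insert a s ha ih =>
      obtain ⟨K, hK⟩ := ih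
      simp only [Finset.sum_insert ha]
      have h1 : LipschitzWith ‖(T.node (a + 1) - T.node a)⁻¹‖₊
          (fun x : ℝ => (x - T.node a) / (T.node (a + 1) - T.node a)) := by
        refine LipschitzWith.of_dist_le_mul fun x y => ?_
        simp only [Real.dist_eq, coe_nnnorm, Real.norm_eq_abs]
        rw [← abs_mul, ← sub_div, div_eq_inv_mul]
        simp
      have h2 := (h1.const_min 1).const_max 0
      refine ⟨_, LipschitzWith.add (LipschitzWith.of_dist_le_mul (K :=
        ‖f (T.node (a + 1)) - f (T.node a)‖₊ * ‖(T.node (a + 1) - T.node a)⁻¹‖₊)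
        fun x y => ?_) hK⟩
      rw [Real.dist_eq, ← mul_sub, abs_mul, NNReal.coe_mul, mul_assoc]
      exact mul_le_mul_of_nonneg_left (by simpa only [Real.dist_eq] using h2.dist_le_mul x y)
        (abs_nonneg _)
  obtain ⟨K, hK⟩ := this (Finset.range T.M)
  exact ⟨_, (LipschitzWith.const (f (T.node 0))).add hK⟩

theorem isR_interp (f : ℝ → ℝ) : T.IsR (T.interp f) := fun i hi =>
  ⟨f (T.node i) - (f (T.node (i + 1)) - f (T.node i)) / (T.node (i + 1) - T.node i) * T.node i,
    (f (T.node (i + 1)) - f (T.node i)) / (T.node (i + 1) - T.node i), fun x hx => by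
      rw [T.interp_eq hi hx]; ring⟩

theorem isQ_proj (f : ℝ → ℝ) : T.IsQ (T.proj f) := fun _ hi =>
  ⟨_, fun _ hx => T.proj_eq hi (Ioo_subset_Ico_self hx) f⟩

theorem interp_sub (f g : ℝ → ℝ) (x : ℝ) :
    T.interp (fun y => f y - g y) x = T.interp f x - T.interp g x := by
  unfold interp
  rw [add_sub_add_comm, ← Finset.sum_sub_distrib]
  congr 1
  refine Finset.sum_congr rfl fun i _ => by ring

theorem intervalIntegrable_cell {i : ℕ} (hi : i < T.M) {f : ℝ → ℝ}
    (hf : ContinuousOn f (Icc 0 ℓ)) :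
    IntervalIntegrable f volume (T.node i) (T.node (i + 1)) :=
  ContinuousOn.intervalIntegrable_of_Icc (T.node_lt i hi).le (hf.mono (T.cell_subset hi))

theorem proj_sub {f g : ℝ → ℝ} (hf : ContinuousOn f (Icc 0 ℓ)) (hg : ContinuousOn g (Icc 0 ℓ))
    (x : ℝ) : T.proj (fun y => f y - g y) x = T.proj f x - T.proj g x := by
  unfold proj
  rw [← Finset.sum_sub_distrib]
  refine Finset.sum_congr rfl fun i hi => ?_
  have hi := Finset.mem_range.1 hi
  rw [intervalIntegral.integral_sub (T.intervalIntegrable_cell hi hf)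
    (T.intervalIntegrable_cell hi hg)]
  by_cases hx : x ∈ Ico (T.node i) (T.node (i + 1)) <;> simp [hx, sub_div]

theorem proj_const_mul (a : ℝ) (f : ℝ → ℝ)
    (x : ℝ) : T.proj (fun y => a * f y) x = a * T.proj f x := by
  unfold proj
  rw [Finset.mul_sum]
  refine Finset.sum_congr rfl fun i hi => ?_
  by_cases hx : x ∈ Ico (T.node i) (T.node (i + 1)) <;> simp [hx, mul_div_assoc]

theorem proj_mem_Icc {f : ℝ → ℝ} (hf : ContinuousOn f (Icc 0 ℓ)) {i : ℕ} (hi : i < T.M) {x : ℝ}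
    (hx : x ∈ Ico (T.node i) (T.node (i + 1))) {a b : ℝ}
    (h : ∀ y ∈ Icc (T.node i) (T.node (i + 1)), f y ∈ Icc a b) : T.proj f x ∈ Icc a b := by
  have hl := T.length_pos hi
  have hle := (T.node_lt i hi).le
  have hint := T.intervalIntegrable_cell hi hf
  rw [T.proj_eq hi hx]
  constructor
  · rw [le_div_iff₀ hl]
    have := intervalIntegral.integral_mono_on hle intervalIntegrable_const hint
      fun y hy => (h y hy).1
    rw [intervalIntegral.integral_const, smul_eq_mul] at this
    linarith
  · rw [div_le_iff₀ hl]
    have := intervalIntegral.integral_mono_on hle hint intervalIntegrable_const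
      fun y hy => (h y hy).2
    rw [intervalIntegral.integral_const, smul_eq_mul] at this
    linarith

theorem abs_proj_sub_le {f : ℝ → ℝ} (hf : ContinuousOn f (Icc 0 ℓ)) {i : ℕ} (hi : i < T.M)
    {x : ℝ} (hx : x ∈ Ico (T.node i) (T.node (i + 1))) {c B : ℝ}
    (h : ∀ y ∈ Icc (T.node i) (T.node (i + 1)), |f y - c| ≤ B) : |T.proj f x - c| ≤ B := by
  have := T.proj_mem_Icc hf hi hx (a := c - B) (b := c + B) fun y hy => by
    have := abs_sub_le_iff.1 (h y hy)
    constructor <;> linarith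
  exact abs_sub_le_iff.2 ⟨by linarith [this.2], by linarith [this.1]⟩

theorem abs_interp_sub_le (f : ℝ → ℝ) {i : ℕ} (hi : i < T.M)
    {x : ℝ} (hx : x ∈ Icc (T.node i) (T.node (i + 1))) {c B : ℝ}
    (h : ∀ y ∈ Icc (T.node i) (T.node (i + 1)), |f y - c| ≤ B) : |T.interp f x - c| ≤ B := by
  have hl := T.length_pos hi
  have hle := (T.node_lt i hi).le
  rw [T.interp_eq hi hx]
  set s := (x - T.node i) / (T.node (i + 1) - T.node i) with hs
  have h1 : 0 ≤ s := div_nonneg (by linarith [hx.1]) hl.le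
  have h2 : s ≤ 1 := by rw [hs, div_le_one hl]; linarith [hx.2]
  have ha := abs_sub_le_iff.1 (h (T.node i) ⟨le_rfl, hle⟩)
  have hb := abs_sub_le_iff.1 (h (T.node (i + 1)) ⟨hle, le_rfl⟩)
  rw [abs_sub_le_iff]
  constructor <;> nlinarith [ha.1, ha.2, hb.1, hb.2]

variable {T}

theorem IsR.eqOn_interp {r : ℝ → ℝ} (hr : T.IsR r) : EqOn r (T.interp r) (Icc 0 ℓ) := by
  have cell : ∀ i < T.M, ∀ x ∈ Icc (T.node i) (T.node (i + 1)), r x = T.interp r x := by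
    intro i hi x hx
    obtain ⟨a, b, hab⟩ := hr i hi
    have hle := (T.node_lt i hi).le
    have hl := (T.length_pos hi).ne'
    rw [T.interp_eq hi hx, hab x hx, hab _ ⟨le_rfl, hle⟩, hab _ ⟨hle, le_rfl⟩]
    field_simp
    ring
  intro x hx
  rcases hx.2.lt_or_eq with h | h
  · obtain ⟨i, hi, hxi⟩ := T.exists_mem_cell ⟨hx.1, h⟩
    exact cell i hi x (Ico_subset_Icc_self hxi)
  · have hM := T.M_pos
    refine cell (T.M - 1) (by omega) x ⟨(T.node_mem (by omega)).2.trans_eq h.symm, ?_⟩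
    rw [Nat.sub_add_cancel hM, T.node_last]
    exact hx.2

theorem IsR.lipschitzOnWith {r : ℝ → ℝ} (hr : T.IsR r) :
    ∃ K, LipschitzOnWith K r (Icc 0 ℓ) := by
  obtain ⟨K, hK⟩ := T.lipschitz_interp r
  refine ⟨K, LipschitzOnWith.of_dist_le_mul fun x hx y hy => ?_⟩
  rw [hr.eqOn_interp hx, hr.eqOn_interp hy]
  exact hK.dist_le_mul x y

theorem IsR.continuousOn {r : ℝ → ℝ} (hr : T.IsR r) : ContinuousOn r (Icc 0 ℓ) :=
  let ⟨_, h⟩ := hr.lipschitzOnWith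
  h.continuousOn

theorem IsR.essBdd {r : ℝ → ℝ} (hr : T.IsR r) : EssBdd ℓ r := .of_continuousOn hr.continuousOn

theorem IsR.exists_hasDerivAt {r : ℝ → ℝ} (hr : T.IsR r) {i : ℕ} (hi : i < T.M) :
    ∃ b, ∀ x ∈ Ioo (T.node i) (T.node (i + 1)), HasDerivAt r b x := by
  obtain ⟨a, b, hab⟩ := hr i hi
  refine ⟨b, fun x hx => ?_⟩
  have h : HasDerivAt (fun x => a + b * x) b x := by
    simpa using ((hasDerivAt_id x).const_mul b).const_add a
  refine h.congr_of_eventuallyEq ?_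
  filter_upwards [Ioo_mem_nhds hx.1 hx.2] with y hy
  exact hab y (Ioo_subset_Icc_self hy)

theorem IsR.isQ_deriv {r : ℝ → ℝ} (hr : T.IsR r) : T.IsQ (deriv r) := fun _ hi =>
  let ⟨b, hb⟩ := hr.exists_hasDerivAt hi
  ⟨b, fun x hx => (hb x hx).deriv⟩

theorem IsR.sub {r s : ℝ → ℝ} (hr : T.IsR r) (hs : T.IsR s) : T.IsR (fun x => r x - s x) :=
  fun i hi => by
    obtain ⟨a, b, h⟩ := hr i hi
    obtain ⟨a', b', h'⟩ := hs i hi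
    exact ⟨a - a', b - b', fun x hx => by simp only [h x hx, h' x hx]; ring⟩

theorem IsQ.sub {q r : ℝ → ℝ} (hq : T.IsQ q) (hr : T.IsQ r) : T.IsQ (fun x => q x - r x) :=
  fun i hi => by
    obtain ⟨a, h⟩ := hq i hi
    obtain ⟨b, h'⟩ := hr i hi
    exact ⟨a - b, fun x hx => by simp only [h x hx, h' x hx]⟩

theorem IsQ.ae_eq_proj {q : ℝ → ℝ} (hq : T.IsQ q) :
    T.proj q =ᵐ[volume.restrict (Ioo 0 ℓ)] q := by
  filter_upwards [T.ae_mem_cell] with x ⟨i, hi, hx⟩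
  obtain ⟨c, hc⟩ := hq i hi
  have hle := (T.node_lt i hi).le
  have h : ∫ y in T.node i..T.node (i + 1), q y = ∫ y in T.node i..T.node (i + 1), c :=
    intervalIntegral.integral_congr_Ioo_of_le hle hc
  rw [T.proj_eq hi (Ioo_subset_Ico_self hx), hc x hx, h,
    intervalIntegral.integral_const, smul_eq_mul,
    mul_div_cancel_left₀ _ (T.length_pos hi).ne']

theorem IsQ.essBdd {q : ℝ → ℝ} (hq : T.IsQ q) : EssBdd ℓ q := by
  refine EssBdd.congr ?_ hq.ae_eq_proj
  have : ∀ s : Finset ℕ, EssBdd ℓ (fun x => ∑ i ∈ s,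
      (Ico (T.node i) (T.node (i + 1))).indicator (fun _ =>
        (∫ y in T.node i..T.node (i + 1), q y) / (T.node (i + 1) - T.node i)) x) := by
    intro s
    induction s using Finset.induction_on with
    | empty => simpa using EssBdd.const 0
    | insert a s ha ih =>
      simp only [Finset.sum_insert ha]
      refine EssBdd.add ⟨aestronglyMeasurable_const.indicator measurableSet_Ico,
        |(∫ y in T.node a..T.node (a + 1), q y) / (T.node (a + 1) - T.node a)|,
        Filter.Eventually.of_forall fun x => ?_⟩ ih
      by_cases hx : x ∈ Ico (T.node a) (T.node (a + 1)) <;> simp [hx]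
  exact this _

end Mesh

section Integrals

variable {ℓ : ℝ} {f g : ℝ → ℝ}

theorem intervalIntegral_eq (hℓ : 0 ≤ ℓ) (f : ℝ → ℝ) :
    ∫ x in (0 : ℝ)..ℓ, f x = ∫ x, f x ∂(volume.restrict (Ioo 0 ℓ)) := by
  rw [intervalIntegral.integral_of_le hℓ, integral_Ioc_eq_integral_Ioo]

theorem integral_congr_Ioo_ae (hℓ : 0 ≤ ℓ)
    (h : ∀ᵐ x ∂(volume.restrict (Ioo 0 ℓ)), f x = g x) :
    ∫ x in (0 : ℝ)..ℓ, f x = ∫ x in (0 : ℝ)..ℓ, g x := by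
  rw [intervalIntegral_eq hℓ, intervalIntegral_eq hℓ]
  exact integral_congr_ae h

theorem integral_mono_Ioo_ae (hℓ : 0 ≤ ℓ) (hf : EssBdd ℓ f) (hg : EssBdd ℓ g)
    (h : ∀ᵐ x ∂(volume.restrict (Ioo 0 ℓ)), f x ≤ g x) :
    ∫ x in (0 : ℝ)..ℓ, f x ≤ ∫ x in (0 : ℝ)..ℓ, g x := by
  rw [intervalIntegral_eq hℓ, intervalIntegral_eq hℓ]
  exact integral_mono_ae hf.integrable hg.integrable h

namespace EssBdd

theorem integral_add (hℓ : 0 ≤ ℓ) (hf : EssBdd ℓ f) (hg : EssBdd ℓ g) :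
    ∫ x in (0 : ℝ)..ℓ, (f x + g x) = (∫ x in (0 : ℝ)..ℓ, f x) + ∫ x in (0 : ℝ)..ℓ, g x :=
  intervalIntegral.integral_add (hf.intervalIntegrable hℓ) (hg.intervalIntegrable hℓ)

theorem integral_sub (hℓ : 0 ≤ ℓ) (hf : EssBdd ℓ f) (hg : EssBdd ℓ g) :
    ∫ x in (0 : ℝ)..ℓ, (f x - g x) = (∫ x in (0 : ℝ)..ℓ, f x) - ∫ x in (0 : ℝ)..ℓ, g x :=
  intervalIntegral.integral_sub (hf.intervalIntegrable hℓ) (hg.intervalIntegrable hℓ)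

theorem sq_integral_abs_le (hℓ : 0 < ℓ) (hf : EssBdd ℓ f) :
    (∫ x in (0 : ℝ)..ℓ, |f x|) ^ 2 ≤ ℓ * normSq ℓ f := by
  set m := ∫ x in (0 : ℝ)..ℓ, |f x| with hm
  have h0 : 0 ≤ ∫ x in (0 : ℝ)..ℓ, (f x ^ 2 - 2 * m / ℓ * |f x| + m ^ 2 / ℓ ^ 2) := by
    refine intervalIntegral.integral_nonneg hℓ.le fun x _ => ?_
    have : f x ^ 2 - 2 * m / ℓ * |f x| + m ^ 2 / ℓ ^ 2 = (|f x| - m / ℓ) ^ 2 := by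
      rw [← sq_abs]; ring
    rw [this]; positivity
  rw [integral_add hℓ.le (by fun_prop) (by fun_prop),
    integral_sub hℓ.le (by fun_prop) (by fun_prop),
    intervalIntegral.integral_const_mul, ← hm, intervalIntegral.integral_const, smul_eq_mul,
    sub_zero] at h0
  have h1 : ℓ * (normSq ℓ f - 2 * m / ℓ * m + ℓ * (m ^ 2 / ℓ ^ 2)) = ℓ * normSq ℓ f - m ^ 2 := by
    field_simp; ring
  have h2 := mul_nonneg hℓ.le h0
  unfold normSq at h1 ⊢
  linarith

theorem intervalIntegrable_of_mem (hf : EssBdd ℓ f) {a b : ℝ} (ha : a ∈ Icc 0 ℓ)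
    (hb : b ∈ Icc 0 ℓ) : IntervalIntegrable f volume a b := by
  have hℓ : 0 ≤ ℓ := ha.1.trans ha.2
  refine (hf.intervalIntegrable hℓ).mono_set ?_
  rw [uIcc_of_le hℓ]
  exact ordConnected_Icc.uIcc_subset ha hb

theorem negPrimitive_sq_le (hℓ : 0 < ℓ) (hf : EssBdd ℓ f) {x : ℝ} (hx : x ∈ Icc 0 ℓ) :
    negPrimitive f x ^ 2 ≤ ℓ * normSq ℓ f := by
  refine le_trans ?_ (hf.sq_integral_abs_le hℓ)
  rw [← sq_abs]
  refine pow_le_pow_left₀ (abs_nonneg _) ?_ 2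
  unfold negPrimitive
  rw [abs_neg]
  refine (intervalIntegral.abs_integral_le_integral_abs hx.1).trans ?_
  exact intervalIntegral.integral_mono_interval le_rfl hx.1 hx.2
    (Filter.Eventually.of_forall fun _ => abs_nonneg _) (hf.abs.intervalIntegrable hℓ.le)

theorem negPrimitive_sub (hf : EssBdd ℓ f) (hg : EssBdd ℓ g) {x : ℝ} (hx : x ∈ Icc 0 ℓ) :
    negPrimitive f x - negPrimitive g x = negPrimitive (fun y => f y - g y) x := by
  have h0 : (0 : ℝ) ∈ Icc 0 ℓ := ⟨le_rfl, hx.1.trans hx.2⟩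
  unfold negPrimitive
  rw [intervalIntegral.integral_sub (hf.intervalIntegrable_of_mem h0 hx)
    (hg.intervalIntegrable_of_mem h0 hx)]
  ring

theorem continuousOn_negPrimitive (hℓ : 0 ≤ ℓ) (hf : EssBdd ℓ f) :
    ContinuousOn (negPrimitive f) (Icc 0 ℓ) := by
  have := intervalIntegral.continuousOn_primitive_interval' (hf.intervalIntegrable hℓ)
    (left_mem_uIcc)
  rw [uIcc_of_le hℓ] at this
  exact this.neg

theorem normSq_negPrimitive_le (hℓ : 0 < ℓ) (hf : EssBdd ℓ f) :
    normSq ℓ (negPrimitive f) ≤ ℓ ^ 2 * normSq ℓ f := by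
  have hM : EssBdd ℓ (negPrimitive f) := .of_continuousOn (hf.continuousOn_negPrimitive hℓ.le)
  have := integral_mono_Ioo_ae hℓ.le (hM.pow 2) (.const (ℓ * normSq ℓ f)) (by
    filter_upwards [ae_restrict_mem measurableSet_Ioo] with x hx
    exact hf.negPrimitive_sq_le hℓ (Ioo_subset_Icc_self hx))
  rw [intervalIntegral.integral_const, smul_eq_mul, sub_zero] at this
  unfold normSq at this ⊢
  linarith

theorem abs_negPrimitive_le {C : ℝ} (hC : 0 ≤ C)
    (h : ∀ᵐ x ∂(volume.restrict (Ioo 0 ℓ)), |f x| ≤ C) {x : ℝ} (hx : x ∈ Icc 0 ℓ) :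
    |negPrimitive f x| ≤ ℓ * C := by
  unfold negPrimitive
  rw [abs_neg]
  have h' : ∀ᵐ y, y ∈ Ioc 0 ℓ → |f y| ≤ C := by
    rw [← ae_restrict_iff' measurableSet_Ioc, ← restrict_Ioo_eq_restrict_Ioc]
    exact h
  have := intervalIntegral.norm_integral_le_of_norm_le_const_ae (a := 0) (b := x) (C := C) (f := f)
    (by
      filter_upwards [h'] with y hy hyx
      rw [uIoc_of_le hx.1] at hyx
      exact hy ⟨hyx.1, hyx.2.trans hx.2⟩)
  rw [sub_zero, abs_of_nonneg hx.1, Real.norm_eq_abs] at this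
  nlinarith [hx.2]

end EssBdd

end Integrals

namespace Mesh

variable {ℓ : ℝ} {T : Mesh ℓ}

theorem nonneg_length (T : Mesh ℓ) : 0 ≤ ℓ := (T.node_mem le_rfl).1.trans (T.node_mem le_rfl).2

theorem IsQ.negPrimitive_eq {q : ℝ → ℝ} (hq : T.IsQ q) {i : ℕ} (hi : i < T.M) {c : ℝ}
    (hc : ∀ x ∈ Ioo (T.node i) (T.node (i + 1)), q x = c) {x : ℝ}
    (hx : x ∈ Icc (T.node i) (T.node (i + 1))) :
    negPrimitive q x = negPrimitive q (T.node i) - c * (x - T.node i) := by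
  have h0 : (0 : ℝ) ∈ Icc 0 ℓ := ⟨le_rfl, T.nonneg_length⟩
  unfold negPrimitive
  rw [← intervalIntegral.integral_add_adjacent_intervals
    (hq.essBdd.intervalIntegrable_of_mem h0 (T.node_mem hi.le))
    (hq.essBdd.intervalIntegrable_of_mem (T.node_mem hi.le) (T.cell_subset hi hx)),
    intervalIntegral.integral_congr_Ioo_of_le hx.1 (g := fun _ => c)
      (fun y hy => hc y ⟨hy.1, hy.2.trans_le hx.2⟩),
    intervalIntegral.integral_const, smul_eq_mul]
  ring

theorem IsQ.isR_negPrimitive {q : ℝ → ℝ} (hq : T.IsQ q) : T.IsR (negPrimitive q) := fun i hi => by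
  obtain ⟨c, hc⟩ := hq i hi
  exact ⟨negPrimitive q (T.node i) + c * T.node i, -c, fun x hx => by
    rw [hq.negPrimitive_eq hi hc hx]; ring⟩

theorem IsQ.deriv_negPrimitive {q : ℝ → ℝ} (hq : T.IsQ q) {i : ℕ} (hi : i < T.M) {x : ℝ}
    (hx : x ∈ Ioo (T.node i) (T.node (i + 1))) : deriv (negPrimitive q) x = - q x := by
  obtain ⟨c, hc⟩ := hq i hi
  have h : HasDerivAt (fun x => negPrimitive q (T.node i) - c * (x - T.node i)) (-c) x := by
    simpa using (((hasDerivAt_id x).sub_const (T.node i)).const_mul c).const_sub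
      (negPrimitive q (T.node i))
  rw [hc x hx]
  refine (h.congr_of_eventuallyEq ?_).deriv
  filter_upwards [Ioo_mem_nhds hx.1 hx.2] with y hy
  exact hq.negPrimitive_eq hi hc (Ioo_subset_Icc_self hy)

theorem deriv_interp {i : ℕ} (hi : i < T.M) {x : ℝ} (f : ℝ → ℝ)
    (hx : x ∈ Ioo (T.node i) (T.node (i + 1))) : deriv (T.interp f) x =
      (f (T.node (i + 1)) - f (T.node i)) / (T.node (i + 1) - T.node i) := by
  have h : HasDerivAt (fun x => f (T.node i) + (f (T.node (i + 1)) - f (T.node i))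
      * ((x - T.node i) / (T.node (i + 1) - T.node i)))
      ((f (T.node (i + 1)) - f (T.node i)) / (T.node (i + 1) - T.node i)) x := by
    have := (((((hasDerivAt_id x).sub_const (T.node i)).div_const
      (T.node (i + 1) - T.node i)).const_mul (f (T.node (i + 1)) - f (T.node i))).const_add
      (f (T.node i)))
    refine this.congr_deriv (by ring)
  refine (h.congr_of_eventuallyEq ?_).deriv
  filter_upwards [Ioo_mem_nhds hx.1 hx.2] with y hy
  exact T.interp_eq hi (Ioo_subset_Icc_self hy) f

theorem IsR.deriv_sub {r s : ℝ → ℝ} (hr : T.IsR r) (hs : T.IsR s) {i : ℕ} (hi : i < T.M) {x : ℝ}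
    (hx : x ∈ Ioo (T.node i) (T.node (i + 1))) :
    deriv (fun y => r y - s y) x = deriv r x - deriv s x := by
  obtain ⟨b, hb⟩ := hr.exists_hasDerivAt hi
  obtain ⟨b', hb'⟩ := hs.exists_hasDerivAt hi
  exact deriv_fun_sub (hb x hx).differentiableAt (hb' x hx).differentiableAt

theorem IsQ.ip_indicator {q : ℝ → ℝ} (hq : T.IsQ q) {i : ℕ} (hi : i < T.M) {x : ℝ}
    (hx : x ∈ Ioo (T.node i) (T.node (i + 1))) :
    ip ℓ q ((Ioo (T.node i) (T.node (i + 1))).indicator fun _ => 1)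
      = q x * (T.node (i + 1) - T.node i) := by
  obtain ⟨c, hc⟩ := hq i hi
  have hsub : Ioo (T.node i) (T.node (i + 1)) ⊆ Ioo 0 ℓ := fun y hy =>
    ⟨(T.node_mem hi.le).1.trans_lt hy.1, hy.2.trans_le (T.node_mem hi).2⟩
  unfold ip
  rw [intervalIntegral_eq T.nonneg_length, hc x hx]
  have : (fun y => q y * (Ioo (T.node i) (T.node (i + 1))).indicator (fun _ => (1 : ℝ)) y)
      = (Ioo (T.node i) (T.node (i + 1))).indicator (fun _ => c) := by
    ext y
    by_cases hy : y ∈ Ioo (T.node i) (T.node (i + 1))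
    · simp only [indicator_of_mem hy, hc y hy, mul_one]
    · simp only [indicator_of_notMem hy, mul_zero]
  rw [this, integral_indicator measurableSet_Ioo, Measure.restrict_restrict measurableSet_Ioo,
    inter_eq_left.2 hsub, setIntegral_const, Real.volume_real_Ioo_of_le (T.node_lt i hi).le,
    smul_eq_mul, mul_comm]

theorem isQ_indicator {i : ℕ} (hi : i < T.M) :
    T.IsQ ((Ioo (T.node i) (T.node (i + 1))).indicator fun _ => 1) := fun j hj => by
  by_cases hij : j = i
  · subst hij
    exact ⟨1, fun x hx => indicator_of_mem hx _⟩
  · refine ⟨0, fun x hx => indicator_of_notMem (fun hxi => ?_) _⟩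
    rcases lt_or_gt_of_ne hij with h | h
    · exact absurd (hx.2.trans_le (T.node_mono (Nat.succ_le_of_lt h) hi.le)) (not_lt.2 hxi.1.le)
    · exact absurd (hxi.2.trans_le (T.node_mono (Nat.succ_le_of_lt h) hj.le)) (not_lt.2 hx.1.le)

end Mesh

theorem lipschitzOnWith_of_abs_sub_le {f : ℝ → ℝ} {s : Set ℝ} {K : ℝ}
    (h : ∀ x ∈ s, ∀ y ∈ s, |f x - f y| ≤ K * |x - y|) : LipschitzOnWith K.toNNReal f s :=
  LipschitzOnWith.of_dist_le_mul fun x hx y hy => (h x hx y hy).trans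
    (mul_le_mul_of_nonneg_right (Real.le_coe_toNNReal K) (abs_nonneg _))

theorem EssBdd.div_of_bdd {ℓ C : ℝ} {f g : ℝ → ℝ} (hf : EssBdd ℓ f) (hg : EssBdd ℓ g)
    (h : ∀ᵐ x ∂(volume.restrict (Ioo 0 ℓ)), |f x / g x| ≤ C) : EssBdd ℓ (fun x => f x / g x) :=
  ⟨(hf.meas.aemeasurable.div hg.meas.aemeasurable).aestronglyMeasurable, C, h⟩

section Continuous

variable {ℓ K ρlo ρhi vbar Ct c L : ℝ} {P : ℝ → ℝ} {ρ v : ℝ → ℝ → ℝ} {t : ℝ}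

theorem IsRegular.continuousOn {f : ℝ → ℝ → ℝ} (hf : IsRegular ℓ K f) (ht : 0 ≤ t) :
    ContinuousOn (f t) (Icc 0 ℓ) :=
  (lipschitzOnWith_of_abs_sub_le (hf.lip_x t ht)).continuousOn

theorem IsRegular.continuousOn_timeDeriv {f : ℝ → ℝ → ℝ} (hf : IsRegular ℓ K f) (ht : 0 ≤ t) :
    ContinuousOn (timeDeriv f t) (Icc 0 ℓ) :=
  (lipschitzOnWith_of_abs_sub_le (hf.lip_tx t ht)).continuousOn

theorem IsRegular.absolutelyContinuous {f : ℝ → ℝ → ℝ} (hℓ : 0 ≤ ℓ) (hf : IsRegular ℓ K f)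
    (ht : 0 ≤ t) : AbsolutelyContinuousOnInterval (f t) 0 ℓ := by
  refine LipschitzOnWith.absolutelyContinuousOnInterval (K := K.toNNReal) ?_
  rw [uIcc_of_le hℓ]
  exact lipschitzOnWith_of_abs_sub_le (hf.lip_x t ht)

theorem Mesh.IsR.absolutelyContinuous {T : Mesh ℓ} {r : ℝ → ℝ} (hr : T.IsR r) :
    AbsolutelyContinuousOnInterval r 0 ℓ := by
  obtain ⟨K, hK⟩ := hr.lipschitzOnWith
  refine LipschitzOnWith.absolutelyContinuousOnInterval (K := K) ?_
  rwa [uIcc_of_le T.nonneg_length]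

theorem IsUniformState.flow_absolutelyContinuous (hℓ : 0 ≤ ℓ)
    (h : IsUniformState ℓ ρlo ρhi vbar Ct K ρ v) (ht : 0 ≤ t) :
    AbsolutelyContinuousOnInterval (fun x => ρ t x * v t x) 0 ℓ :=
  (h.regular_density.absolutelyContinuous hℓ ht).fun_mul
    (h.regular_velocity.absolutelyContinuous hℓ ht)

theorem IsUniformState.enthalpy_absolutelyContinuous (hℓ : 0 ≤ ℓ) (hP : PressureBounds P ρlo ρhi c L)
    (hL : 0 ≤ L) (h : IsUniformState ℓ ρlo ρhi vbar Ct K ρ v) (ht : 0 ≤ t) :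
    AbsolutelyContinuousOnInterval (fun x => enthalpy P (ρ t x) (v t x)) 0 ℓ := by
  have hv := h.regular_velocity.absolutelyContinuous hℓ ht
  have h1 : AbsolutelyContinuousOnInterval (fun x => 1 / 2 * (v t x * v t x)) 0 ℓ :=
    AbsolutelyContinuousOnInterval.const_mul (1 / 2) (hv.fun_mul hv)
  have h2 : AbsolutelyContinuousOnInterval (fun x => deriv P (ρ t x)) 0 ℓ := by
    refine LipschitzOnWith.absolutelyContinuousOnInterval (K := (L * K).toNNReal) ?_
    rw [uIcc_of_le hℓ]
    refine lipschitzOnWith_of_abs_sub_le fun x hx y hy => ?_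
    refine (hP.abs_deriv_sub_le (h.density t ht x hx) (h.density t ht y hy)).trans ?_
    rw [mul_assoc]
    exact mul_le_mul_of_nonneg_left (h.regular_density.lip_x t ht x hx y hy) hL
  have : (fun x => enthalpy P (ρ t x) (v t x))
      = fun x => 1 / 2 * (v t x * v t x) + deriv P (ρ t x) := by
    ext x; unfold enthalpy; ring
  rw [this]
  exact h1.fun_add h2

end Continuous

section Discrete

variable {ℓ τ γ μ K ρlo ρhi vbar Ct c L : ℝ} {P : ℝ → ℝ} {s₁ s₂ : ℝ → ℝ → ℝ} {mBd hBd : ℝ → ℝ}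
  {ρ v : ℝ → ℝ → ℝ} {T : Mesh ℓ} {y ρh mh : ℕ → ℝ → ℝ}

/-- The cell averages of the source of the mass balance. -/
theorem IsEulerSolution.proj_source (heul : IsEulerSolution ℓ γ P s₁ s₂ mBd hBd ρ v)
    (hst : IsUniformState ℓ ρlo ρhi vbar Ct K ρ v) {t : ℝ} (ht : 0 ≤ t) {i : ℕ} (hi : i < T.M)
    {x : ℝ} (hx : x ∈ Ioo (T.node i) (T.node (i + 1))) :
    T.proj (s₁ t) x
      = T.proj (timeDeriv ρ t) x + deriv (T.interp fun y => ρ t y * v t y) x := by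
  have hxI := Ioo_subset_Ico_self hx
  have hle := (T.node_lt i hi).le
  have hac : AbsolutelyContinuousOnInterval (fun y => ρ t y * v t y) (T.node i)
      (T.node (i + 1)) := by
    refine (hst.flow_absolutelyContinuous T.nonneg_length ht).mono ?_
    rw [uIcc_of_le hle, uIcc_of_le T.nonneg_length]
    exact T.cell_subset hi
  have hcongr : ∫ y in T.node i..T.node (i + 1), s₁ t y
      = ∫ y in T.node i..T.node (i + 1), (timeDeriv ρ t y + deriv (fun z => ρ t z * v t z) y) := by
    refine intervalIntegral.integral_congr_ae_restrict ?_
    rw [uIoc_of_le hle, ← restrict_Ioo_eq_restrict_Ioc]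
    have hsub : Ioo (T.node i) (T.node (i + 1)) ⊆ Ioo 0 ℓ := fun y hy =>
      ⟨(T.node_mem hi.le).1.trans_lt hy.1, hy.2.trans_le (T.node_mem hi).2⟩
    filter_upwards [ae_restrict_of_ae_restrict_of_subset hsub (heul.mass t ht)] with y hy
    exact hy.symm
  rw [T.proj_eq hi hxI, T.proj_eq hi hxI, Mesh.deriv_interp hi _ hx, hcongr,
    intervalIntegral.integral_add
      (T.intervalIntegrable_cell hi (hst.regular_density.continuousOn_timeDeriv ht))
      hac.intervalIntegrable_deriv, hac.integral_deriv_eq_sub, add_div]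

/-- The discrete mass balance in terms of the original state. -/
theorem IsObserverSolution.mass_eq (hobs : IsObserverSolution T τ γ μ P s₁ s₂ mBd hBd y ρh mh)
    (heul : IsEulerSolution ℓ γ P s₁ s₂ mBd hBd ρ v)
    (hst : IsUniformState ℓ ρlo ρhi vbar Ct K ρ v) (hτ : 0 < τ) {n : ℕ} (hn : 1 ≤ n)
    {i : ℕ} (hi : i < T.M) {x : ℝ} (hx : x ∈ Ioo (T.node i) (T.node (i + 1))) :
    (ρh n x - ρh (n - 1) x) / τ + deriv (mh n) x
      = T.proj (timeDeriv ρ (n * τ)) x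
        + deriv (T.interp fun y => ρ (n * τ) y * v (n * τ) y) x := by
  rw [← heul.proj_source hst (by positivity) hi hx]
  have h := hobs.mass n hn _ (T.isQ_indicator hi)
  have hq : T.IsQ (fun x => backwardDiff τ (fun k => ρh k x) n) := fun j hj => by
    obtain ⟨a, ha⟩ := hobs.density_mem n j hj
    obtain ⟨b, hb⟩ := hobs.density_mem (n - 1) j hj
    exact ⟨(a - b) / τ, fun x hx => by simp only [backwardDiff, ha x hx, hb x hx]⟩
  rw [hq.ip_indicator hi hx, (hobs.flow_mem n).isQ_deriv.ip_indicator hi hx,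
    (T.isQ_proj _).ip_indicator hi hx, ← add_mul] at h
  exact mul_right_cancel₀ (T.length_pos hi).ne' h

theorem IsUniformDiscrete.essBdd_vel (hu : IsUniformDiscrete ℓ ρlo ρhi vbar ρh mh)
    (hobs : IsObserverSolution T τ γ μ P s₁ s₂ mBd hBd y ρh mh) (n : ℕ) :
    EssBdd ℓ (vel ρh mh n) :=
  (hobs.flow_mem n).essBdd.div_of_bdd (C := vbar) (hobs.density_mem n).essBdd (by
    filter_upwards [ae_restrict_mem measurableSet_Ioo] with x hx
    exact (hu n x hx).2)

theorem InL2.integrable_mul {f g : ℝ → ℝ} (hf : InL2 ℓ f) (hg : EssBdd ℓ g) :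
    Integrable (fun x => f x * g x) (volume.restrict (Ioo 0 ℓ)) :=
  MemLp.integrable_mul hf hg.memLp_two

/-- The discrete momentum balance tested with `θ`, in terms of the original state. -/
theorem IsObserverSolution.momentum_eq {ηh : ℕ → ℝ → ℝ}
    (hobs : IsObserverSolution T τ γ μ P s₁ s₂ mBd hBd
      (fun n x => T.interp (v (n * τ)) x + ηh n x) ρh mh)
    (hη : ∀ n, InL2 ℓ (ηh n)) (hu : IsUniformDiscrete ℓ ρlo ρhi vbar ρh mh)
    (hP : PressureBounds P ρlo ρhi c L) (hL : 0 ≤ L) (hρ : ρlo ≤ ρhi)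
    (heul : IsEulerSolution ℓ γ P s₁ s₂ mBd hBd ρ v)
    (hst : IsUniformState ℓ ρlo ρhi vbar Ct K ρ v) (hτ : 0 < τ) {n : ℕ} (hn : 1 ≤ n)
    {θ : ℝ → ℝ} (hθ : T.IsR θ) (hθ0 : θ 0 = 0) :
    ∫ x in (0 : ℝ)..ℓ, (((vel ρh mh n x - vel ρh mh (n - 1) x) / τ - timeDeriv v (n * τ) x) * θ x
        - (enthalpy P (ρh n x) (vel ρh mh n x) - enthalpy P (ρ (n * τ) x) (v (n * τ) x))
          * deriv θ x
        + γ * (|vel ρh mh n x| * vel ρh mh n x - |v (n * τ) x| * v (n * τ) x) * θ x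
        - μ * (T.interp (v (n * τ)) x - vel ρh mh n x) * θ x)
      = μ * ip ℓ (ηh n) θ := by
  have hℓ : 0 ≤ ℓ := T.nonneg_length
  have ht : 0 ≤ n * τ := by positivity
  have e1 := hu.essBdd_vel hobs n
  have e2 := hu.essBdd_vel hobs (n - 1)
  have e3 := hθ.essBdd
  have e4 := hθ.isQ_deriv.essBdd
  have e5 : EssBdd ℓ (v (n * τ)) := .of_continuousOn (hst.regular_velocity.continuousOn ht)
  have e6 : EssBdd ℓ (timeDeriv v (n * τ)) :=
    .of_continuousOn (hst.regular_velocity.continuousOn_timeDeriv ht)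
  have hac := hst.enthalpy_absolutelyContinuous hℓ hP hL ht
  have e7 : EssBdd ℓ (fun x => enthalpy P (ρ (n * τ) x) (v (n * τ) x)) := by
    refine .of_continuousOn ?_
    have := hac.continuousOn
    rwa [uIcc_of_le hℓ] at this
  have e8 : EssBdd ℓ (fun x => enthalpy P (ρh n x) (vel ρh mh n x)) := by
    have := EssBdd.comp_continuousOn hρ hP.continuousOn_deriv (hobs.density_mem n).essBdd (by
      filter_upwards [ae_restrict_mem measurableSet_Ioo] with x hx
      exact (hu n x hx).1)
    unfold enthalpy
    fun_prop
  have e9 : EssBdd ℓ (T.interp (v (n * τ))) := (T.isR_interp _).essBdd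
  have hparts := hac.integral_mul_deriv_eq_deriv_mul hθ.absolutelyContinuous
  rw [hθ0, heul.bc_right _ ht, mul_zero, sub_zero] at hparts
  have hdint : IntervalIntegrable
      (fun x => deriv (fun z => enthalpy P (ρ (n * τ) z) (v (n * τ) z)) x * θ x) volume 0 ℓ :=
    hac.intervalIntegrable_deriv.mul_continuousOn (by
      rw [uIcc_of_le hℓ]; exact hθ.continuousOn)
  have hs2 : ip ℓ (s₂ (n * τ)) θ = (∫ x in (0 : ℝ)..ℓ, timeDeriv v (n * τ) x * θ x)
      + (∫ x in (0 : ℝ)..ℓ, deriv (fun z => enthalpy P (ρ (n * τ) z) (v (n * τ) z)) x * θ x)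
      + ∫ x in (0 : ℝ)..ℓ, γ * |v (n * τ) x| * v (n * τ) x * θ x := by
    rw [← intervalIntegral.integral_add ((e6.mul e3).intervalIntegrable hℓ) hdint,
      ← intervalIntegral.integral_add (((e6.mul e3).intervalIntegrable hℓ).add hdint)
        (EssBdd.intervalIntegrable hℓ (by fun_prop))]
    refine integral_congr_Ioo_ae hℓ ?_
    filter_upwards [heul.momentum _ ht] with x hx
    have : s₂ (n * τ) x = timeDeriv v (n * τ) x
      + deriv (fun z => enthalpy P (ρ (n * τ) z) (v (n * τ) z)) x
      + γ * |v (n * τ) x| * v (n * τ) x := by linarith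
    rw [this]; ring
  have hy : ip ℓ (fun x => T.interp (v (n * τ)) x + ηh n x - vel ρh mh n x) θ
      = (∫ x in (0 : ℝ)..ℓ, (T.interp (v (n * τ)) x - vel ρh mh n x) * θ x)
        + ip ℓ (ηh n) θ := by
    unfold ip
    have hi : IntervalIntegrable (fun x => ηh n x * θ x) volume 0 ℓ := by
      rw [intervalIntegrable_iff_integrableOn_Ioo_of_le hℓ]
      exact (hη n).integrable_mul e3
    rw [← intervalIntegral.integral_add (EssBdd.intervalIntegrable hℓ (by fun_prop)) hi]
    congr 1; ext x; ring
  have hmom := hobs.momentum n hn θ hθ hθ0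
  rw [hs2, hy] at hmom
  have key : ∫ x in (0 : ℝ)..ℓ, (((vel ρh mh n x - vel ρh mh (n - 1) x) / τ
          - timeDeriv v (n * τ) x) * θ x
        - (enthalpy P (ρh n x) (vel ρh mh n x) - enthalpy P (ρ (n * τ) x) (v (n * τ) x))
          * deriv θ x
        + γ * (|vel ρh mh n x| * vel ρh mh n x - |v (n * τ) x| * v (n * τ) x) * θ x
        - μ * (T.interp (v (n * τ)) x - vel ρh mh n x) * θ x)
      = ip ℓ (fun x => backwardDiff τ (fun k => vel ρh mh k x) n) θ
        - (∫ x in (0 : ℝ)..ℓ, timeDeriv v (n * τ) x * θ x)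
        - ip ℓ (fun x => enthalpy P (ρh n x) (vel ρh mh n x)) (deriv θ)
        + (∫ x in (0 : ℝ)..ℓ, enthalpy P (ρ (n * τ) x) (v (n * τ) x) * deriv θ x)
        + γ * ip ℓ (fun x => |vel ρh mh n x| * vel ρh mh n x) θ
        - (∫ x in (0 : ℝ)..ℓ, γ * |v (n * τ) x| * v (n * τ) x * θ x)
        - μ * ∫ x in (0 : ℝ)..ℓ, (T.interp (v (n * τ)) x - vel ρh mh n x) * θ x := by
    unfold ip backwardDiff
    rw [← intervalIntegral.integral_const_mul, ← intervalIntegral.integral_const_mul,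
      ← EssBdd.integral_sub hℓ (by fun_prop) (by fun_prop),
      ← EssBdd.integral_sub hℓ (by fun_prop) (by fun_prop),
      ← EssBdd.integral_add hℓ (by fun_prop) (by fun_prop),
      ← EssBdd.integral_add hℓ (by fun_prop) (by fun_prop),
      ← EssBdd.integral_sub hℓ (by fun_prop) (by fun_prop),
      ← EssBdd.integral_sub hℓ (by fun_prop) (by fun_prop)]
    congr 1; ext x; ring
  rw [key, hparts]
  linarith

end Discrete

section TimeSteps

variable {ℓ K : ℝ} {f : ℝ → ℝ → ℝ}

theorem IsRegular.mono {K' : ℝ} (hK : K ≤ K') (hf : IsRegular ℓ K f) : IsRegular ℓ K' f where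
  diff := hf.diff
  lip_x t ht x hx y hy :=
    (hf.lip_x t ht x hx y hy).trans (mul_le_mul_of_nonneg_right hK (abs_nonneg _))
  bdd_t t ht x hx := (hf.bdd_t t ht x hx).trans hK
  lip_tx t ht x hx y hy :=
    (hf.lip_tx t ht x hx y hy).trans (mul_le_mul_of_nonneg_right hK (abs_nonneg _))
  lip_tt t ht s hs x hx :=
    (hf.lip_tt t ht s hs x hx).trans (mul_le_mul_of_nonneg_right hK (abs_nonneg _))

theorem IsUniformState.mono {ρlo ρhi vbar Ct K' : ℝ} {ρ v : ℝ → ℝ → ℝ} (hK : K ≤ K')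
    (h : IsUniformState ℓ ρlo ρhi vbar Ct K ρ v) : IsUniformState ℓ ρlo ρhi vbar Ct K' ρ v :=
  { h with
    regular_density := h.regular_density.mono hK
    regular_velocity := h.regular_velocity.mono hK }

theorem IsRegular.abs_step_le (hf : IsRegular ℓ K f) {x C : ℝ} (hx : x ∈ Icc 0 ℓ)
    (hC : ∀ t, 0 ≤ t → |timeDeriv f t x| ≤ C) {t₀ t₁ : ℝ} (h₀ : 0 ≤ t₀) (h₁ : t₀ ≤ t₁) :
    |f t₁ x - f t₀ x| ≤ C * (t₁ - t₀) := by
  have := (convex_Ici (0 : ℝ)).norm_image_sub_le_of_norm_derivWithin_le (hf.diff x hx)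
    (fun s hs => hC s hs) (mem_Ici.2 h₀) (mem_Ici.2 (h₀.trans h₁))
  simpa only [Real.norm_eq_abs, abs_of_nonneg (sub_nonneg.2 h₁)] using this

theorem IsRegular.abs_step_sub_le (hf : IsRegular ℓ K f) {x y : ℝ} (hx : x ∈ Icc 0 ℓ)
    (hy : y ∈ Icc 0 ℓ) {t₀ t₁ : ℝ} (h₀ : 0 ≤ t₀) (h₁ : t₀ ≤ t₁) :
    |(f t₁ x - f t₀ x) - (f t₁ y - f t₀ y)| ≤ K * |x - y| * (t₁ - t₀) := by
  have := (convex_Ici (0 : ℝ)).norm_image_sub_le_of_norm_hasDerivWithin_le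
    (f := fun s => f s x - f s y) (C := K * |x - y|)
    (fun s hs => ((hf.diff x hx s hs).hasDerivWithinAt).sub (hf.diff y hy s hs).hasDerivWithinAt)
    (fun s hs => hf.lip_tx s hs x hx y hy) (mem_Ici.2 h₀) (mem_Ici.2 (h₀.trans h₁))
  rw [Real.norm_eq_abs, Real.norm_eq_abs, abs_of_nonneg (sub_nonneg.2 h₁)] at this
  convert this using 2
  ring

theorem IsRegular.abs_timeDeriv_sub_le (hf : IsRegular ℓ K f) (hK : 0 ≤ K) {x : ℝ}
    (hx : x ∈ Icc 0 ℓ) {t₀ t₁ : ℝ} (h₀ : 0 ≤ t₀) (h₁ : t₀ < t₁) :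
    |timeDeriv f t₁ x - (f t₁ x - f t₀ x) / (t₁ - t₀)| ≤ K * (t₁ - t₀) := by
  have hp := sub_pos.2 h₁
  have := (convex_Icc t₀ t₁).norm_image_sub_le_of_norm_hasDerivWithin_le
    (f := fun s => f s x - timeDeriv f t₁ x * s) (C := K * (t₁ - t₀))
    (fun s hs => (((hf.diff x hx s (h₀.trans hs.1)).hasDerivWithinAt).mono
      (fun z hz => h₀.trans hz.1)).sub ((hasDerivWithinAt_id s _).const_mul (timeDeriv f t₁ x)))
    (fun s hs => by
      rw [mul_one]
      refine (hf.lip_tt s (h₀.trans hs.1) t₁ (h₀.trans h₁.le) x hx).trans ?_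
      refine mul_le_mul_of_nonneg_left ?_ hK
      rw [abs_sub_comm, abs_of_nonneg (by linarith [hs.2])]
      linarith [hs.1]) (left_mem_Icc.2 h₁.le) (right_mem_Icc.2 h₁.le)
  rw [Real.norm_eq_abs, Real.norm_eq_abs, abs_of_pos hp] at this
  have e : timeDeriv f t₁ x - (f t₁ x - f t₀ x) / (t₁ - t₀)
      = -((f t₁ x - timeDeriv f t₁ x * t₁ - (f t₀ x - timeDeriv f t₁ x * t₀)) / (t₁ - t₀)) := by
    field_simp
    ring
  rw [e, abs_neg, abs_div, abs_of_pos hp, div_le_iff₀ hp]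
  exact this

end TimeSteps

/-- Consistency errors at one point of a cell: `r` are cell averages of the density, `I` is the
interpolated mass flow, and `σ` measures the time step and the mesh size. -/
structure ConsistentAt (P : ℝ → ℝ) (τ V b σ ρ₁ ρ₀ v₁ v₀ r₁ r₀ w₁ w₀ A B : ℝ) : Prop where
  w₁_le : |w₁| ≤ V
  w₀_le : |w₀| ≤ V
  dr : |r₁ - r₀| ≤ b * τ
  dw : |w₁ - w₀| ≤ b * τ
  accel : |A| ≤ σ
  meas : |B| ≤ σ
  fric : |(|v₁| * v₁ - |w₁| * w₁)| ≤ σ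
  enth : |enthalpy P ρ₁ v₁ - enthalpy P r₁ w₁| ≤ σ
  denth : |(enthalpy P ρ₁ v₁ - enthalpy P r₁ w₁) - (enthalpy P ρ₀ v₀ - enthalpy P r₀ w₀)| ≤ σ * τ

theorem abs_mul_abs_sub_le (a b : ℝ) : |(|a| * a - |b| * b)| ≤ (|a| + |b|) * |a - b| := by
  have : |a| * a - |b| * b = |a| * (a - b) + (|a| - |b|) * b := by ring
  rw [this, add_mul]
  refine (abs_add_le _ _).trans (add_le_add ?_ ?_)
  · rw [abs_mul, abs_abs]
  · rw [abs_mul, mul_comm]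
    exact mul_le_mul_of_nonneg_left (abs_abs_sub_abs_le a b) (abs_nonneg _)

theorem abs_mul_le_mul {a b A B : ℝ} (ha : |a| ≤ A) (hb : |b| ≤ B) : |a * b| ≤ A * B := by
  rw [abs_mul]
  exact mul_le_mul ha hb (abs_nonneg _) ((abs_nonneg _).trans ha)

theorem abs_le_div_of_mul {ρ r x C : ℝ} (hρ : 0 < ρ) (hr : ρ ≤ r) (h : |r * x| ≤ C) :
    |x| ≤ C / ρ := by
  rw [le_div_iff₀ hρ, mul_comm]
  rw [abs_mul, abs_of_pos (hρ.trans_le hr)] at h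
  exact (mul_le_mul_of_nonneg_right hr (abs_nonneg _)).trans h

/-- The constant in the consistency estimates. -/
def consistencyConst (ρlo ρhi L Λ : ℝ) : ℝ :=
  let W := 2 * Λ / ρlo
  let W₂ := (2 * Λ + Λ ^ 2 + W) / ρlo
  Λ + W + W₂ + (1 + ρhi / ρlo) * (W + W₂) + W * (2 * Λ + W₂) + 3 * L * Λ

theorem consistentAt_of_bounds {P : ℝ → ℝ} {c L ρlo ρhi vbar Ct Λ τ h : ℝ}
    (hP : PressureBounds P ρlo ρhi c L) (hL : 1 ≤ L) (hlo : 0 < ρlo)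
    (hΛ : 1 ≤ Λ) (hτ : 0 < τ) (hh : 0 < h) (hh1 : h ≤ 1) (hvb : vbar ≤ 1) (hCt : Ct ≤ 1)
    {ρ₁ ρ₀ v₁ v₀ r₁ r₀ I₁ I₀ J a : ℝ}
    (hρ₁ : ρ₁ ∈ Icc ρlo ρhi) (hρ₀ : ρ₀ ∈ Icc ρlo ρhi)
    (hr₁ : r₁ ∈ Icc ρlo ρhi) (hr₀ : r₀ ∈ Icc ρlo ρhi)
    (hv₁ : |v₁| ≤ vbar) (hv₀ : |v₀| ≤ vbar) (hI₁ : |I₁| ≤ ρhi * vbar) (hI₀ : |I₀| ≤ ρhi * vbar)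
    (hd₁ : |ρ₁ - r₁| ≤ Λ * h) (hd₀ : |ρ₀ - r₀| ≤ Λ * h)
    (hdd : |(ρ₁ - r₁) - (ρ₀ - r₀)| ≤ Λ * τ * h)
    (hm₁ : |I₁ - ρ₁ * v₁| ≤ Λ * h) (hm₀ : |I₀ - ρ₀ * v₀| ≤ Λ * h)
    (hmm : |(I₁ - ρ₁ * v₁) - (I₀ - ρ₀ * v₀)| ≤ Λ * τ * h)
    (hdv : |v₁ - v₀| ≤ Λ * τ) (hdr : |r₁ - r₀| ≤ Ct * τ) (hdI : |I₁ - I₀| ≤ (ρhi + 1) * Ct * τ)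
    (hJ : |J - v₁| ≤ Λ * h) (ha : |a - (v₁ - v₀) / τ| ≤ Λ * τ) :
    ConsistentAt P τ (ρhi / ρlo * vbar) (((ρhi + 1 + ρhi / ρlo) / ρlo + 1) * Ct)
      (consistencyConst ρlo ρhi L Λ * (τ + h)) ρ₁ ρ₀ v₁ v₀ r₁ r₀ (I₁ / r₁) (I₀ / r₀)
      (a - (I₁ / r₁ - I₀ / r₀) / τ) (J - I₁ / r₁) := by
  have hr₁p : 0 < r₁ := hlo.trans_le hr₁.1
  have hr₀p : 0 < r₀ := hlo.trans_le hr₀.1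
  have hhi : 0 < ρhi := hr₁p.trans_le hr₁.2
  have hvb0 : 0 ≤ vbar := (abs_nonneg _).trans hv₁
  have hCt0 : 0 ≤ Ct := nonneg_of_mul_nonneg_left ((abs_nonneg _).trans hdr) hτ
  set κ := ρhi / ρlo with hκ
  have hκ0 : 0 < κ := div_pos hhi hlo
  set w₁ := I₁ / r₁ with hw₁
  set w₀ := I₀ / r₀ with hw₀
  have eI₁ : r₁ * w₁ = I₁ := mul_div_cancel₀ _ hr₁p.ne'
  have eI₀ : r₀ * w₀ = I₀ := mul_div_cancel₀ _ hr₀p.ne'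
  clear_value w₁ w₀
  have bw₁ : |w₁| ≤ κ * vbar := by
    refine (abs_le_div_of_mul hlo hr₁.1 (C := ρhi * vbar) (by rwa [eI₁])).trans_eq ?_
    rw [hκ]; ring
  have bw₀ : |w₀| ≤ κ * vbar := by
    refine (abs_le_div_of_mul hlo hr₀.1 (C := ρhi * vbar) (by rwa [eI₀])).trans_eq ?_
    rw [hκ]; ring
  have hκv : κ * vbar ≤ κ := mul_le_of_le_one_right hκ0.le hvb
  set W := 2 * Λ / ρlo with hW
  set W₂ := (2 * Λ + Λ ^ 2 + W) / ρlo with hW₂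
  have hKc : consistencyConst ρlo ρhi L Λ
      = Λ + W + W₂ + (1 + κ) * (W + W₂) + W * (2 * Λ + W₂) + 3 * L * Λ := rfl
  set Kc := consistencyConst ρlo ρhi L Λ with hKcd
  clear_value Kc W₂ W κ
  have hW0 : 0 ≤ W := by rw [hW]; positivity
  have hW₂0 : 0 ≤ W₂ := by rw [hW₂]; positivity
  have z₁ : |I₁ - r₁ * v₁| ≤ 2 * Λ * h := by
    have := abs_add_le (I₁ - ρ₁ * v₁) ((ρ₁ - r₁) * v₁)
    have h2 := abs_mul_le_mul hd₁ (hv₁.trans hvb)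
    rw [show I₁ - r₁ * v₁ = (I₁ - ρ₁ * v₁) + (ρ₁ - r₁) * v₁ by ring]
    linarith
  have z₀ : |I₀ - r₀ * v₀| ≤ 2 * Λ * h := by
    have := abs_add_le (I₀ - ρ₀ * v₀) ((ρ₀ - r₀) * v₀)
    have h2 := abs_mul_le_mul hd₀ (hv₀.trans hvb)
    rw [show I₀ - r₀ * v₀ = (I₀ - ρ₀ * v₀) + (ρ₀ - r₀) * v₀ by ring]
    linarith
  have hwv₁ : |w₁ - v₁| ≤ W * h := by
    refine (abs_le_div_of_mul hlo hr₁.1 (C := 2 * Λ * h)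
      (by rwa [mul_sub, eI₁])).trans_eq ?_
    rw [hW]; ring
  have hwv₀ : |w₀ - v₀| ≤ W * h := by
    refine (abs_le_div_of_mul hlo hr₀.1 (C := 2 * Λ * h)
      (by rwa [mul_sub, eI₀])).trans_eq ?_
    rw [hW]; ring
  have hdr1 : |r₁ - r₀| ≤ τ := hdr.trans (mul_le_of_le_one_left hτ.le hCt)
  have zz : |(I₁ - r₁ * v₁) - (I₀ - r₀ * v₀)| ≤ (2 * Λ + Λ ^ 2) * (τ * h) := by
    have e : (I₁ - r₁ * v₁) - (I₀ - r₀ * v₀) = ((I₁ - ρ₁ * v₁) - (I₀ - ρ₀ * v₀))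
      + ((ρ₁ - r₁) - (ρ₀ - r₀)) * v₁ + (ρ₀ - r₀) * (v₁ - v₀) := by ring
    have h1 := abs_mul_le_mul hdd (hv₁.trans hvb)
    have h2 := abs_mul_le_mul hd₀ hdv
    rw [e]
    refine (abs_add_three _ _ _).trans ?_
    linarith
  have hdwv : |(w₁ - v₁) - (w₀ - v₀)| ≤ W₂ * (τ * h) := by
    refine (abs_le_div_of_mul hlo hr₁.1 (C := (2 * Λ + Λ ^ 2 + W) * (τ * h)) ?_).trans_eq
      (by rw [hW₂]; ring)
    have e : r₁ * ((w₁ - v₁) - (w₀ - v₀)) = ((I₁ - r₁ * v₁) - (I₀ - r₀ * v₀))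
      - (r₁ - r₀) * (w₀ - v₀) := by rw [← eI₁, ← eI₀]; ring
    have h1 := abs_mul_le_mul hdr1 hwv₀
    rw [e]
    refine (abs_sub _ _).trans ?_
    linarith
  have hdw : |w₁ - w₀| ≤ (ρhi + 1 + κ) / ρlo * (Ct * τ) := by
    refine (abs_le_div_of_mul hlo hr₁.1 (C := (ρhi + 1 + κ) * (Ct * τ)) ?_).trans_eq (by ring)
    have e : r₁ * (w₁ - w₀) = (I₁ - I₀) - (r₁ - r₀) * w₀ := by rw [← eI₁, ← eI₀]; ring
    have h1 := abs_mul_le_mul hdr (bw₀.trans hκv)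
    rw [e]
    refine (abs_sub _ _).trans ?_
    linarith
  have hsum : ∀ {v w : ℝ}, |v| ≤ vbar → |w| ≤ κ * vbar → |v + w| ≤ 1 + κ := fun {v w} hv hw =>
    (abs_add_le _ _).trans (by linarith)
  have hvw : ∀ {v w : ℝ}, |w - v| ≤ W * h → |v - w| ≤ W * h := fun hx => by
    rwa [abs_sub_comm]
  have hdP := hP.abs_second_diff_le hρ₀ hρ₁ hr₀ hr₁
  have hP₁ := hP.abs_deriv_sub_le hρ₁ hr₁
  have n1 : 0 ≤ κ * (W + W₂) := by positivity
  have n2 : 0 ≤ W * (2 * Λ + W₂) := by positivity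
  have n3 : 0 ≤ 3 * L * Λ := by positivity
  have hKτ : ∀ {A : ℝ}, 0 ≤ A → A ≤ Kc → A * h ≤ Kc * (τ + h) := fun {A} h0 hA => by
    linarith [mul_le_mul_of_nonneg_right hA hh.le, mul_nonneg (h0.trans hA) hτ.le]
  have hfr : (1 + κ) * W ≤ (1 + κ) * (W + W₂) := by
    have : 0 ≤ (1 + κ) * W₂ := by positivity
    linarith
  have hfr2 : (1 + κ) * W₂ ≤ (1 + κ) * (W + W₂) := by
    have : 0 ≤ (1 + κ) * W := by positivity
    linarith
  have n4 : 0 ≤ (1 + κ) * (W + W₂) := by positivity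
  refine ⟨bw₁, bw₀, ?_, ?_, ?_, ?_, ?_, ?_, ?_⟩
  · have : 0 ≤ (ρhi + 1 + κ) / ρlo * Ct * τ := by positivity
    linarith
  · have : 0 ≤ Ct * τ := by positivity
    linarith
  · have e : a - (w₁ - w₀) / τ = (a - (v₁ - v₀) / τ) - ((w₁ - v₁) - (w₀ - v₀)) / τ := by ring
    have h1 : |((w₁ - v₁) - (w₀ - v₀)) / τ| ≤ W₂ * h := by
      rw [abs_div, abs_of_pos hτ, div_le_iff₀ hτ]
      linarith
    rw [e]
    refine (abs_sub _ _).trans ?_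
    have h2 : Λ * τ ≤ Kc * τ := mul_le_mul_of_nonneg_right (by linarith) hτ.le
    have h3 : W₂ * h ≤ Kc * h := mul_le_mul_of_nonneg_right (by linarith) hh.le
    linarith
  · have e : J - w₁ = (J - v₁) - (w₁ - v₁) := by ring
    rw [e]
    refine (abs_sub _ _).trans ?_
    have := hKτ (A := Λ + W) (by positivity) (by linarith)
    linarith
  · refine (abs_mul_abs_sub_le _ _).trans ?_
    have h1 : (|v₁| + |w₁|) * |v₁ - w₁| ≤ (1 + κ) * (W * h) :=
      mul_le_mul (by linarith) (hvw hwv₁) (abs_nonneg _) (by positivity)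
    have := hKτ (A := (1 + κ) * W) (by positivity) (by linarith)
    linarith
  · have e : enthalpy P ρ₁ v₁ - enthalpy P r₁ w₁ = (v₁ - w₁) * (v₁ + w₁) / 2
      + (deriv P ρ₁ - deriv P r₁) := by unfold enthalpy; ring
    have h1 := abs_mul_le_mul (hvw hwv₁) (hsum hv₁ bw₁)
    have h2 : L * |ρ₁ - r₁| ≤ L * (Λ * h) := mul_le_mul_of_nonneg_left hd₁ (by linarith)
    have h3 := abs_add_le ((v₁ - w₁) * (v₁ + w₁) / 2) (deriv P ρ₁ - deriv P r₁)
    rw [abs_div, abs_two] at h3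
    rw [e]
    have n5 : 0 ≤ L * Λ := by positivity
    have := hKτ (A := (1 + κ) * W + L * Λ) (by positivity) (by linarith)
    have n6 : 0 ≤ W * h * (1 + κ) := by positivity
    linarith
  · have e : (enthalpy P ρ₁ v₁ - enthalpy P r₁ w₁) - (enthalpy P ρ₀ v₀ - enthalpy P r₀ w₀)
      = (-((w₁ - v₁) - (w₀ - v₀)) * (v₁ + w₁)
        + (v₀ - w₀) * (2 * (v₁ - v₀) + ((w₁ - v₁) - (w₀ - v₀)))) / 2
      + ((deriv P ρ₁ - deriv P r₁) - (deriv P ρ₀ - deriv P r₀)) := by unfold enthalpy; ring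
    have h1 : |-((w₁ - v₁) - (w₀ - v₀)) * (v₁ + w₁)| ≤ W₂ * (τ * h) * (1 + κ) :=
      abs_mul_le_mul (by rwa [abs_neg]) (hsum hv₁ bw₁)
    have h2 : |2 * (v₁ - v₀) + ((w₁ - v₁) - (w₀ - v₀))| ≤ (2 * Λ + W₂) * τ := by
      refine (abs_add_le _ _).trans ?_
      rw [abs_mul, abs_two]
      have : W₂ * (τ * h) ≤ W₂ * τ := by
        refine mul_le_mul_of_nonneg_left (mul_le_of_le_one_right hτ.le hh1) hW₂0
      linarith
    have h3 := abs_mul_le_mul (hvw hwv₀) h2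
    have h4 : L * |(ρ₁ - r₁) - (ρ₀ - r₀)| ≤ L * (Λ * τ * h) :=
      mul_le_mul_of_nonneg_left hdd (by linarith)
    have h5 : L * (|ρ₀ - r₀| + |ρ₁ - r₁|) * |r₁ - r₀| ≤ L * (Λ * h + Λ * h) * τ := by
      gcongr
    have h6 := abs_add_le (-((w₁ - v₁) - (w₀ - v₀)) * (v₁ + w₁))
      ((v₀ - w₀) * (2 * (v₁ - v₀) + ((w₁ - v₁) - (w₀ - v₀))))
    have h7 := abs_add_le ((-((w₁ - v₁) - (w₀ - v₀)) * (v₁ + w₁)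
        + (v₀ - w₀) * (2 * (v₁ - v₀) + ((w₁ - v₁) - (w₀ - v₀)))) / 2)
      ((deriv P ρ₁ - deriv P r₁) - (deriv P ρ₀ - deriv P r₀))
    rw [abs_div, abs_two] at h7
    rw [e]
    have h8 := hKτ (A := (1 + κ) * W₂ + W * (2 * Λ + W₂) + 3 * L * Λ) (by positivity)
      (by linarith)
    have h9 := mul_le_mul_of_nonneg_right h8 hτ.le
    have n6 : 0 ≤ W₂ * (τ * h) * (1 + κ) := by positivity
    have n7 : 0 ≤ W * h * ((2 * Λ + W₂) * τ) := by positivity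
    linarith


section UniformState

variable {ℓ K ρlo ρhi vbar Ct c L τ : ℝ} {P : ℝ → ℝ} {ρ v : ℝ → ℝ → ℝ}

theorem IsUniformState.abs_flow_sub_le (h : IsUniformState ℓ ρlo ρhi vbar Ct K ρ v)
    (hlo : 0 < ρlo) (hK : 1 ≤ K) (hvb : vbar ≤ 1) {t : ℝ} (ht : 0 ≤ t) {x y : ℝ}
    (hx : x ∈ Icc 0 ℓ) (hy : y ∈ Icc 0 ℓ) :
    |ρ t y * v t y - ρ t x * v t x| ≤ K * (ρhi + 2 * K + 1) * |y - x| := by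
  have e : ρ t y * v t y - ρ t x * v t x
    = ρ t y * (v t y - v t x) + (ρ t y - ρ t x) * v t x := by ring
  have hρ : |ρ t y| ≤ ρhi := by
    have := h.density t ht y hy
    rw [abs_of_nonneg (hlo.le.trans this.1)]; exact this.2
  have h1 := abs_mul_le_mul hρ (h.regular_velocity.lip_x t ht y hy x hx)
  have h2 := abs_mul_le_mul (h.regular_density.lip_x t ht y hy x hx)
    ((h.velocity t ht x hx).trans hvb)
  rw [e]
  refine (abs_add_le _ _).trans ?_
  have : 0 ≤ 2 * K * K * |y - x| := by positivity
  linarith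

theorem IsUniformState.abs_flow_step_le (h : IsUniformState ℓ ρlo ρhi vbar Ct K ρ v)
    (hlo : 0 < ρlo) (hvb : vbar ≤ 1) {t₀ t₁ : ℝ} (h₀ : 0 ≤ t₀) (h₁ : t₀ ≤ t₁)
    {x : ℝ} (hx : x ∈ Icc 0 ℓ) :
    |ρ t₁ x * v t₁ x - ρ t₀ x * v t₀ x| ≤ (ρhi + 1) * Ct * (t₁ - t₀) := by
  have e : ρ t₁ x * v t₁ x - ρ t₀ x * v t₀ x
    = ρ t₁ x * (v t₁ x - v t₀ x) + (ρ t₁ x - ρ t₀ x) * v t₀ x := by ring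
  have hρ : |ρ t₁ x| ≤ ρhi := by
    have := h.density t₁ (h₀.trans h₁) x hx
    rw [abs_of_nonneg (hlo.le.trans this.1)]; exact this.2
  have h1 := abs_mul_le_mul hρ (h.regular_velocity.abs_step_le hx (C := Ct) (fun t ht => by
    linarith [h.smallDerivs t ht x hx, abs_nonneg (timeDeriv ρ t x)]) h₀ h₁)
  have h2 := abs_mul_le_mul (h.regular_density.abs_step_le hx (C := Ct) (fun t ht => by
    linarith [h.smallDerivs t ht x hx, abs_nonneg (timeDeriv v t x)]) h₀ h₁)
    ((h.velocity t₀ h₀ x hx).trans hvb)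
  rw [e]
  refine (abs_add_le _ _).trans ?_
  linarith

theorem IsUniformState.abs_flow_step_sub_le (h : IsUniformState ℓ ρlo ρhi vbar Ct K ρ v)
    (hlo : 0 < ρlo) (hvb : vbar ≤ 1) {t₀ t₁ : ℝ} (h₀ : 0 ≤ t₀) (h₁ : t₀ ≤ t₁)
    {x y : ℝ} (hx : x ∈ Icc 0 ℓ) (hy : y ∈ Icc 0 ℓ) :
    |(ρ t₁ y * v t₁ y - ρ t₀ y * v t₀ y) - (ρ t₁ x * v t₁ x - ρ t₀ x * v t₀ x)|
      ≤ K * (ρhi + 2 * K + 1) * |y - x| * (t₁ - t₀) := by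
  have e : (ρ t₁ y * v t₁ y - ρ t₀ y * v t₀ y) - (ρ t₁ x * v t₁ x - ρ t₀ x * v t₀ x)
    = ρ t₀ y * ((v t₁ y - v t₀ y) - (v t₁ x - v t₀ x))
      + (ρ t₀ y - ρ t₀ x) * (v t₁ x - v t₀ x)
      + (((ρ t₁ y - ρ t₀ y) - (ρ t₁ x - ρ t₀ x)) * v t₁ y
        + (ρ t₁ x - ρ t₀ x) * (v t₁ y - v t₁ x)) := by ring
  have hρ : |ρ t₀ y| ≤ ρhi := by
    have := h.density t₀ h₀ y hy
    rw [abs_of_nonneg (hlo.le.trans this.1)]; exact this.2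
  have ht := h₀.trans h₁
  have h1 := abs_mul_le_mul hρ (h.regular_velocity.abs_step_sub_le hy hx h₀ h₁)
  have h2 := abs_mul_le_mul (h.regular_density.lip_x t₀ h₀ y hy x hx)
    (h.regular_velocity.abs_step_le hx (fun t ht => h.regular_velocity.bdd_t t ht x hx) h₀ h₁)
  have h3 := abs_mul_le_mul (h.regular_density.abs_step_sub_le hy hx h₀ h₁)
    ((h.velocity t₁ ht y hy).trans hvb)
  have h4 := abs_mul_le_mul
    (h.regular_density.abs_step_le hx (fun t ht => h.regular_density.bdd_t t ht x hx) h₀ h₁)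
    (h.regular_velocity.lip_x t₁ ht y hy x hx)
  rw [e]
  refine (abs_add_le _ _).trans
    (le_trans (add_le_add (abs_add_le _ _) (abs_add_le _ _)) ?_)
  linarith

/-- The consistency errors of the projected state are of first order. -/
theorem IsUniformState.consistentAt (h : IsUniformState ℓ ρlo ρhi vbar Ct K ρ v)
    (hP : PressureBounds P ρlo ρhi c L) (hL : 1 ≤ L) (hlo : 0 < ρlo) (hK : 1 ≤ K)
    (hvb : vbar ≤ 1) (hCt : Ct ≤ 1) (hτ : 0 < τ) (T : Mesh ℓ) (hT : T.size ≤ 1)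
    {n : ℕ} (hn : 1 ≤ n) {i : ℕ} (hi : i < T.M) {x : ℝ}
    (hx : x ∈ Ioo (T.node i) (T.node (i + 1))) :
    ConsistentAt P τ (ρhi / ρlo * vbar) (((ρhi + 1 + ρhi / ρlo) / ρlo + 1) * Ct)
      (consistencyConst ρlo ρhi L (K * (ρhi + 2 * K + 1)) * (τ + T.size))
      (ρ (n * τ) x) (ρ ((n - 1 : ℕ) * τ) x) (v (n * τ) x) (v ((n - 1 : ℕ) * τ) x)
      (T.projDensity τ ρ n x) (T.projDensity τ ρ (n - 1) x)
      (T.projVelocity τ ρ v n x) (T.projVelocity τ ρ v (n - 1) x)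
      (timeDeriv v (n * τ) x - (T.projVelocity τ ρ v n x - T.projVelocity τ ρ v (n - 1) x) / τ)
      (T.interp (v (n * τ)) x - T.projVelocity τ ρ v n x)
    ∧ |T.proj (timeDeriv ρ (n * τ)) x - (T.projDensity τ ρ n x - T.projDensity τ ρ (n - 1) x) / τ|
      ≤ consistencyConst ρlo ρhi L (K * (ρhi + 2 * K + 1)) * (τ + T.size) := by
  have ht₀ : 0 ≤ ((n - 1 : ℕ) : ℝ) * τ := by positivity
  have hstep : (n : ℝ) * τ - ((n - 1 : ℕ) : ℝ) * τ = τ := by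
    rw [Nat.cast_sub hn]; push_cast; ring
  unfold Mesh.projVelocity Mesh.projDensity
  set t₁ := (n : ℝ) * τ
  set t₀ := ((n - 1 : ℕ) : ℝ) * τ
  have hlt : t₀ < t₁ := by linarith
  have ht₁ : 0 ≤ t₁ := ht₀.trans hlt.le
  have hxI := Ioo_subset_Ico_self hx
  have hxC := Ioo_subset_Icc_self hx
  have hx0 := T.cell_subset hi hxC
  have hs := T.size_pos
  have hhi : 0 < ρhi := hlo.trans_le ((h.density _ ht₀ x hx0).1.trans (h.density _ ht₀ x hx0).2)
  set Λ := K * (ρhi + 2 * K + 1) with hΛ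
  have hΛK : K ≤ Λ := le_mul_of_one_le_right (by linarith) (by linarith)
  have hdist : ∀ y ∈ Icc (T.node i) (T.node (i + 1)), |y - x| ≤ T.size := fun y hy =>
    T.abs_sub_le_size hi hy hxC
  have cρ := fun {t : ℝ} (ht : 0 ≤ t) => h.regular_density.continuousOn ht
  have hKs : ∀ {y}, y ∈ Icc (T.node i) (T.node (i + 1)) → K * |y - x| ≤ Λ * T.size :=
    fun hy => mul_le_mul hΛK (hdist _ hy) (abs_nonneg _) (by linarith)
  have hΛs : ∀ {y}, y ∈ Icc (T.node i) (T.node (i + 1)) → Λ * |y - x| ≤ Λ * T.size :=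
    fun hy => mul_le_mul_of_nonneg_left (hdist _ hy) (by linarith)
  have hKsτ : ∀ {y}, y ∈ Icc (T.node i) (T.node (i + 1)) →
      K * |y - x| * (t₁ - t₀) ≤ Λ * τ * T.size := fun hy => by
    rw [hstep]; linarith [mul_le_mul_of_nonneg_right (hKs hy) hτ.le]
  have hΛsτ : ∀ {y}, y ∈ Icc (T.node i) (T.node (i + 1)) →
      Λ * |y - x| * (t₁ - t₀) ≤ Λ * τ * T.size := fun hy => by
    rw [hstep]; linarith [mul_le_mul_of_nonneg_right (hΛs hy) hτ.le]
  have hrmem : ∀ {t}, 0 ≤ t → T.proj (ρ t) x ∈ Icc ρlo ρhi := fun {t} ht =>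
    T.proj_mem_Icc (cρ ht) hi hxI fun y hy => h.density t ht y (T.cell_subset hi hy)
  have hflow : ∀ {t}, 0 ≤ t → |T.interp (fun y => ρ t y * v t y) x| ≤ ρhi * vbar := by
    intro t ht
    have := T.abs_interp_sub_le (fun y => ρ t y * v t y) hi hxC (c := 0) (B := ρhi * vbar)
      fun y hy => by
        have hy0 := T.cell_subset hi hy
        rw [sub_zero]
        refine abs_mul_le_mul ?_ (h.velocity t ht y hy0)
        have := h.density t ht y hy0
        rw [abs_of_nonneg (hlo.le.trans this.1)]; exact this.2
    simpa using this
  have hd : ∀ {t}, 0 ≤ t → |ρ t x - T.proj (ρ t) x| ≤ Λ * T.size := fun {t} ht => by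
    rw [abs_sub_comm]
    exact T.abs_proj_sub_le (cρ ht) hi hxI fun y hy =>
      (h.regular_density.lip_x t ht y (T.cell_subset hi hy) x hx0).trans (hKs hy)
  have hm : ∀ {t}, 0 ≤ t → |T.interp (fun y => ρ t y * v t y) x - ρ t x * v t x| ≤ Λ * T.size :=
    fun {t} ht => T.abs_interp_sub_le _ hi hxC fun y hy =>
      (h.abs_flow_sub_le hlo hK hvb ht hx0 (T.cell_subset hi hy)).trans (hΛs hy)
  have hCρ : ∀ y ∈ Icc 0 ℓ, ∀ t, 0 ≤ t → |timeDeriv ρ t y| ≤ Ct := fun y hy t ht => by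
    linarith [h.smallDerivs t ht y hy, abs_nonneg (timeDeriv v t y)]
  have hprojd := T.proj_sub (cρ ht₁) (cρ ht₀) x
  constructor
  · refine consistentAt_of_bounds hP hL hlo (hK.trans hΛK) hτ hs hT hvb hCt
      (h.density _ ht₁ x hx0) (h.density _ ht₀ x hx0) (hrmem ht₁) (hrmem ht₀)
      (h.velocity _ ht₁ x hx0) (h.velocity _ ht₀ x hx0) (hflow ht₁) (hflow ht₀)
      (hd ht₁) (hd ht₀) ?_ (hm ht₁) (hm ht₀) ?_ ?_ ?_ ?_ ?_ ?_
    · have := T.abs_proj_sub_le ((cρ ht₁).sub (cρ ht₀)) hi hxI (c := ρ t₁ x - ρ t₀ x)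
        fun y hy => (h.regular_density.abs_step_sub_le (T.cell_subset hi hy) hx0 ht₀
          hlt.le).trans (hKsτ hy)
      rw [abs_sub_comm] at this
      convert this using 2
      have : T.proj (ρ t₁ - ρ t₀) x = T.proj (ρ t₁) x - T.proj (ρ t₀) x := hprojd
      rw [this]; ring
    · have := T.abs_interp_sub_le (fun y => ρ t₁ y * v t₁ y - ρ t₀ y * v t₀ y) hi hxC
        (c := ρ t₁ x * v t₁ x - ρ t₀ x * v t₀ x) fun y hy =>
          (h.abs_flow_step_sub_le hlo hvb ht₀ hlt.le hx0 (T.cell_subset hi hy)).trans (hΛsτ hy)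
      rw [T.interp_sub] at this
      convert this using 2
      ring
    · refine (h.regular_velocity.abs_step_le hx0
        (fun t ht => h.regular_velocity.bdd_t t ht x hx0) ht₀ hlt.le).trans ?_
      rw [hstep]
      exact mul_le_mul_of_nonneg_right hΛK hτ.le
    · have := T.abs_proj_sub_le ((cρ ht₁).sub (cρ ht₀)) hi hxI (c := 0) (B := Ct * τ)
        fun y hy => by
          rw [sub_zero, ← hstep]
          exact h.regular_density.abs_step_le (T.cell_subset hi hy)
            (hCρ y (T.cell_subset hi hy)) ht₀ hlt.le
      have e : T.proj (ρ t₁ - ρ t₀) x = T.proj (ρ t₁) x - T.proj (ρ t₀) x := hprojd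
      rwa [e, sub_zero] at this
    · have := T.abs_interp_sub_le (fun y => ρ t₁ y * v t₁ y - ρ t₀ y * v t₀ y) hi hxC
        (c := 0) (B := (ρhi + 1) * Ct * τ) fun y hy => by
          rw [sub_zero, ← hstep]
          exact h.abs_flow_step_le hlo hvb ht₀ hlt.le (T.cell_subset hi hy)
      rwa [T.interp_sub, sub_zero] at this
    · exact T.abs_interp_sub_le _ hi hxC fun y hy =>
        (h.regular_velocity.lip_x t₁ ht₁ y (T.cell_subset hi hy) x hx0).trans (hKs hy)
    · have := h.regular_velocity.abs_timeDeriv_sub_le (by linarith) hx0 ht₀ hlt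
      rw [hstep] at this
      exact this.trans (mul_le_mul_of_nonneg_right hΛK hτ.le)
  · have cd := h.regular_density.continuousOn_timeDeriv ht₁
    have hc2 : ContinuousOn (fun y => τ⁻¹ * (ρ t₁ y - ρ t₀ y)) (Icc 0 ℓ) :=
      continuousOn_const.mul ((cρ ht₁).sub (cρ ht₀))
    have := T.abs_proj_sub_le (cd.sub hc2) hi hxI (c := 0) (B := Λ * τ) fun y hy => by
      have := h.regular_density.abs_timeDeriv_sub_le (by linarith) (T.cell_subset hi hy) ht₀ hlt
      rw [hstep, div_eq_inv_mul] at this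
      rw [sub_zero]
      exact this.trans (mul_le_mul_of_nonneg_right hΛK hτ.le)
    have e : T.proj (timeDeriv ρ t₁ - fun y => τ⁻¹ * (ρ t₁ y - ρ t₀ y)) x
        = T.proj (timeDeriv ρ t₁) x - (T.proj (ρ t₁) x - T.proj (ρ t₀) x) / τ := by
      rw [div_eq_inv_mul, ← hprojd, ← T.proj_const_mul]
      exact T.proj_sub cd hc2 x
    rw [e, sub_zero] at this
    refine this.trans ?_
    have hΛ0 : 0 < Λ := by linarith
    have hle : Λ ≤ consistencyConst ρlo ρhi L Λ := by
      unfold consistencyConst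
      have h1 : 0 ≤ 2 * Λ / ρlo := by positivity
      have h2 : 0 ≤ (2 * Λ + Λ ^ 2 + 2 * Λ / ρlo) / ρlo := by positivity
      have h3 : 0 ≤ (1 + ρhi / ρlo) * (2 * Λ / ρlo + (2 * Λ + Λ ^ 2 + 2 * Λ / ρlo) / ρlo) := by
        positivity
      have h4 : 0 ≤ 2 * Λ / ρlo * (2 * Λ + (2 * Λ + Λ ^ 2 + 2 * Λ / ρlo) / ρlo) := by positivity
      have h5 : 0 ≤ 3 * L * Λ := by positivity
      simp only
      linarith
    exact mul_le_mul hle (by linarith) hτ.le (hΛ0.le.trans hle)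


end UniformState

theorem abs_mul_le_half_sq (a b : ℝ) : |a * b| ≤ (a ^ 2 + b ^ 2) / 2 := by
  rw [abs_le]
  constructor <;> linarith only [sq_nonneg (a + b), sq_nonneg (a - b), add_sq a b, sub_sq a b]

/-- The density of the relative energy. -/
def relEnergyDensity (P : ℝ → ℝ) (ρ v r w : ℝ) : ℝ :=
  ρ * v ^ 2 / 2 + P ρ - (r * w ^ 2 / 2 + P r)
    - (enthalpy P r w * (ρ - r) + r * w * (v - w))

/-- One time step of the relative energy density. -/
theorem PressureBounds.relEnergyDensity_step_le {P : ℝ → ℝ} {a b c L V β : ℝ}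
    (hP : PressureBounds P a b c L) (hL : 1 ≤ L)
    (hVc : V ≤ c / 2) (hVa : V ≤ a / 2) {ρ₁ ρ₀ v₁ v₀ r₁ r₀ w₁ w₀ : ℝ}
    (hρ₁ : ρ₁ ∈ Icc a b) (hρ₀ : ρ₀ ∈ Icc a b) (hr₁ : r₁ ∈ Icc a b) (hr₀ : r₀ ∈ Icc a b)
    (hv₁ : |v₁| ≤ V) (hdr : |r₁ - r₀| ≤ β) (hdw : |w₁ - w₀| ≤ β) :
    relEnergyDensity P ρ₁ v₁ r₁ w₁ - relEnergyDensity P ρ₀ v₀ r₀ w₀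
      ≤ (enthalpy P ρ₁ v₁ - enthalpy P r₁ w₁) * ((ρ₁ - r₁) - (ρ₀ - r₀))
        + (ρ₁ * v₁ - r₁ * w₁) * ((v₁ - w₁) - (v₀ - w₀))
        - min c a / 4 * (((ρ₁ - r₁) - (ρ₀ - r₀)) ^ 2 + ((v₁ - w₁) - (v₀ - w₀)) ^ 2)
        + 15 * L * β * ((ρ₁ - r₁) ^ 2 + (v₁ - w₁) ^ 2
          + ((ρ₁ - r₁) - (ρ₀ - r₀)) ^ 2 + ((v₁ - w₁) - (v₀ - w₀)) ^ 2) := by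
  have h1 := hP.relative_step_le hρ₀ hρ₁ hr₀ hr₁
  have hβ : 0 ≤ β := (abs_nonneg _).trans hdr
  obtain ⟨p₁, hp₁⟩ : ∃ p, p = ρ₁ - r₁ := ⟨_, rfl⟩
  obtain ⟨q₁, hq₁⟩ : ∃ q, q = v₁ - w₁ := ⟨_, rfl⟩
  obtain ⟨d, hd⟩ : ∃ d, d = (ρ₁ - r₁) - (ρ₀ - r₀) := ⟨_, rfl⟩
  obtain ⟨e, he⟩ : ∃ e, e = (v₁ - w₁) - (v₀ - w₀) := ⟨_, rfl⟩
  have hp₀ : ρ₀ - r₀ = p₁ - d := by rw [hp₁, hd]; ring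
  have hq₀ : v₀ - w₀ = q₁ - e := by rw [hq₁, he]; ring
  have key : relEnergyDensity P ρ₁ v₁ r₁ w₁ - relEnergyDensity P ρ₀ v₀ r₀ w₀
      = (P ρ₁ - P r₁ - deriv P r₁ * (ρ₁ - r₁)) - (P ρ₀ - P r₀ - deriv P r₀ * (ρ₀ - r₀))
      + (enthalpy P ρ₁ v₁ - enthalpy P r₁ w₁) * d + (ρ₁ * v₁ - r₁ * w₁) * e
      - (deriv P ρ₁ - deriv P r₁) * d
      - ρ₀ * e ^ 2 / 2 - v₁ * d * e - (r₁ - r₀) * e ^ 2 / 2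
      + (r₁ - r₀) * (v₀ - w₀) ^ 2 / 2 + (ρ₀ - r₀) * (v₀ - w₀) * (w₁ - w₀) := by
    rw [hd, he]; unfold relEnergyDensity enthalpy; ring
  rw [← hd, hp₀, ← hp₁] at h1
  rw [key, ← hd, ← he, hp₀, hq₀, ← hp₁, ← hq₁]
  have hLβ : 4 * L * |r₁ - r₀| * ((p₁ - d) ^ 2 + p₁ ^ 2) ≤ 4 * L * β * ((p₁ - d) ^ 2 + p₁ ^ 2) := by
    gcongr
  have t1 : -(v₁ * d * e) ≤ V * ((d ^ 2 + e ^ 2) / 2) := by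
    have := abs_mul_le_mul hv₁ (abs_mul_le_half_sq d e)
    rw [← mul_assoc] at this
    exact (neg_le_abs _).trans this
  have t2 : -((r₁ - r₀) * e ^ 2 / 2) ≤ β * e ^ 2 / 2 := by
    have := mul_le_mul_of_nonneg_right ((neg_le_abs _).trans hdr) (sq_nonneg e)
    linarith only [this]
  have t3 : (r₁ - r₀) * (q₁ - e) ^ 2 / 2 ≤ β * (q₁ - e) ^ 2 / 2 := by
    have := mul_le_mul_of_nonneg_right ((le_abs_self _).trans hdr) (sq_nonneg (q₁ - e))
    linarith only [this]
  have t4 : (p₁ - d) * (q₁ - e) * (w₁ - w₀) ≤ ((p₁ - d) ^ 2 + (q₁ - e) ^ 2) / 2 * β :=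
    (le_abs_self _).trans (abs_mul_le_mul (abs_mul_le_half_sq _ _) hdw)
  have t5 : a * e ^ 2 ≤ ρ₀ * e ^ 2 := mul_le_mul_of_nonneg_right hρ₀.1 (sq_nonneg e)
  have m1 : min c a * d ^ 2 ≤ c * d ^ 2 :=
    mul_le_mul_of_nonneg_right (min_le_left _ _) (sq_nonneg d)
  have m2 : min c a * e ^ 2 ≤ a * e ^ 2 :=
    mul_le_mul_of_nonneg_right (min_le_right _ _) (sq_nonneg e)
  have m3 : V * d ^ 2 ≤ c / 2 * d ^ 2 := mul_le_mul_of_nonneg_right hVc (sq_nonneg d)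
  have m4 : V * e ^ 2 ≤ a / 2 * e ^ 2 := mul_le_mul_of_nonneg_right hVa (sq_nonneg e)
  have y1 : (p₁ - d) ^ 2 ≤ 2 * p₁ ^ 2 + 2 * d ^ 2 := by
    linarith only [sq_nonneg (p₁ + d), add_sq p₁ d, sub_sq p₁ d]
  have y2 : (q₁ - e) ^ 2 ≤ 2 * q₁ ^ 2 + 2 * e ^ 2 := by
    linarith only [sq_nonneg (q₁ + e), add_sq q₁ e, sub_sq q₁ e]
  have z1 : 4 * L * β * ((p₁ - d) ^ 2 + p₁ ^ 2) ≤ 4 * L * β * (3 * p₁ ^ 2 + 2 * d ^ 2) :=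
    mul_le_mul_of_nonneg_left (by linarith only [y1]) (by positivity)
  have z2 := mul_le_mul_of_nonneg_left y1 hβ
  have z3 := mul_le_mul_of_nonneg_left y2 hβ
  have z4 : β ≤ L * β := le_mul_of_one_le_left hβ hL
  have z5 := mul_le_mul_of_nonneg_right z4 (sq_nonneg p₁)
  have z6 := mul_le_mul_of_nonneg_right z4 (sq_nonneg q₁)
  have z7 := mul_le_mul_of_nonneg_right z4 (sq_nonneg d)
  have z8 := mul_le_mul_of_nonneg_right z4 (sq_nonneg e)
  have w1 : 0 ≤ L * β * d ^ 2 := by positivity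
  have w2 : 0 ≤ L * β * q₁ ^ 2 := by positivity
  have w3 : 0 ≤ L * β * e ^ 2 := by positivity
  have w4 : 0 ≤ L * β * p₁ ^ 2 := by positivity
  linarith only [h1, hLβ, t1, t2, t3, t4, t5, m1, m2, m3, m4, z1, z2, z3, z5, z6, z7, z8,
    w1, w2, w3, w4]

theorem mul_le_young {ζ : ℝ} (hζ : 0 < ζ) (a b : ℝ) : a * b ≤ ζ * a ^ 2 + b ^ 2 / (4 * ζ) := by
  have h : ζ * a ^ 2 + b ^ 2 / (4 * ζ) - a * b = (2 * ζ * a - b) ^ 2 / (4 * ζ) := by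
    field_simp; ring
  have : 0 ≤ (2 * ζ * a - b) ^ 2 / (4 * ζ) := by positivity
  linarith

theorem half_mul_sq_le_friction (v w : ℝ) :
    (|v| + |w|) * (v - w) ^ 2 / 2 ≤ (|v| * v - |w| * w) * (v - w) := by
  rcases abs_cases v with ⟨hv, h1⟩ | ⟨hv, h1⟩ <;> rcases abs_cases w with ⟨hw, h2⟩ | ⟨hw, h2⟩ <;>
    rw [hv, hw]
  · nlinarith [mul_nonneg (add_nonneg h1 h2) (sq_nonneg (v - w))]
  · nlinarith [mul_nonneg (sub_nonneg.2 (h2.le.trans h1)) (sq_nonneg (v + w))]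
  · nlinarith [mul_nonneg (sub_nonneg.2 (h1.le.trans h2)) (sq_nonneg (v + w))]
  · nlinarith [mul_nonneg (add_nonneg (neg_nonneg.2 h1.le) (neg_nonneg.2 h2.le))
      (sq_nonneg (v - w))]

/-- The constant in front of the squared consistency error. -/
def errorConst (L κ γ μ ρhi δ ℓ : ℝ) : ℝ :=
  L + κ + (1 + γ + μ) * (ρhi + κ) + δ * (1 + γ + μ) + δ + δ * ℓ

theorem dissipative_terms_le {ρlo ρhi c V κ γ μ δ ℓ ζ : ℝ} (hc : 0 < c)
    (hγ : 0 ≤ γ) (hμ : 0 < μ) (hδ : 0 < δ) (hℓ : 0 < ℓ) (hζ : 0 < ζ) (hVκ : V ≤ κ)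
    (hV : V * (μ + 2 * γ * κ + 2 * δ) ≤ 2 * ζ) (hV' : δ * γ * V ≤ ζ) {r v w p q π F M : ℝ}
    (hlo : 0 < r) (hr₁ : ρlo ≤ r) (hr₂ : r ≤ ρhi) (hv : |v| ≤ V) (hw : |w| ≤ V)
    (hcp : c * p ^ 2 ≤ π * p) (hF : (|v| + |w|) * q ^ 2 / 2 ≤ F * q)
    (hFa : |F| ≤ (|v| + |w|) * |q|) :
    -(μ * q * (r * q + v * p)) - γ * F * (r * q + v * p) - δ * ((π + (v + w) / 2 * q) * p)
      + δ * ((r * q + v * p) * q) - δ * (μ * q * M) - δ * (γ * F * M)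
      ≤ - 2 * (γ / 4 * (r * q * (q * (|v| + |w|))))
        - (μ * ρlo - δ * (ρhi + 2 * μ ^ 2 * ℓ ^ 2 / c) - 2 * ζ) * q ^ 2
        - (δ * c - ζ) * p ^ 2 + (δ * c / (8 * ℓ ^ 2) + ζ) * M ^ 2 := by
  have hV0 : 0 ≤ V := (abs_nonneg _).trans hv
  have hFV : |F| ≤ 2 * V * |q| :=
    hFa.trans (mul_le_mul_of_nonneg_right (by linarith only [hv, hw]) (abs_nonneg _))
  have hvpq : |v * (p * q)| ≤ V * (|p| * |q|) := abs_mul_le_mul hv (abs_mul p q).le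
  have hvwpq : |(v + w) / 2 * (p * q)| ≤ V * (|p| * |q|) := by
    refine abs_mul_le_mul ?_ (abs_mul p q).le
    rw [abs_div, abs_two]; linarith only [abs_add_le v w, hv, hw]
  have T1 : -(μ * q * (r * q + v * p)) ≤ -(μ * ρlo * q ^ 2) + μ * V * (|p| * |q|) := by
    have h1 := mul_le_mul_of_nonneg_left (mul_le_mul_of_nonneg_right hr₁ (sq_nonneg q)) hμ.le
    have := mul_le_mul_of_nonneg_left ((neg_le_abs _).trans hvpq) hμ.le
    linarith only [h1, this]
  have T2 : -(γ * F * (r * q + v * p)) ≤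
      - 2 * (γ / 4 * (r * q * (q * (|v| + |w|)))) + 2 * γ * V * κ * (|p| * |q|) := by
    have h1 := mul_le_mul_of_nonneg_left hF (mul_nonneg hγ hlo.le)
    have h2 : -(F * (v * p)) ≤ 2 * V * |q| * (κ * |p|) :=
      (neg_le_abs _).trans (abs_mul_le_mul hFV (abs_mul_le_mul (hv.trans hVκ) le_rfl))
    have := mul_le_mul_of_nonneg_left h2 hγ
    linarith only [h1, this]
  have T3 : -(δ * ((π + (v + w) / 2 * q) * p)) ≤ -(δ * c * p ^ 2) + δ * V * (|p| * |q|) := by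
    have h1 := mul_le_mul_of_nonneg_left ((neg_le_abs _).trans hvwpq) hδ.le
    have h2 := mul_le_mul_of_nonneg_left hcp hδ.le
    linarith only [h1, h2]
  have T4 : δ * ((r * q + v * p) * q) ≤ δ * ρhi * q ^ 2 + δ * V * (|p| * |q|) := by
    have h1 : r * q ^ 2 ≤ ρhi * q ^ 2 := mul_le_mul_of_nonneg_right hr₂ (sq_nonneg q)
    have := mul_le_mul_of_nonneg_left (add_le_add h1 ((le_abs_self _).trans hvpq)) hδ.le
    linarith only [this]
  have T5 : -(δ * (μ * q * M)) ≤ δ * c / (8 * ℓ ^ 2) * M ^ 2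
      + δ * (2 * μ ^ 2 * ℓ ^ 2 / c) * q ^ 2 := by
    have h1 := mul_le_young (ζ := c / (8 * ℓ ^ 2)) (by positivity) M (-(μ * q))
    have h2 : (-(μ * q)) ^ 2 / (4 * (c / (8 * ℓ ^ 2))) = 2 * μ ^ 2 * ℓ ^ 2 / c * q ^ 2 := by
      field_simp; ring
    rw [h2] at h1
    have := mul_le_mul_of_nonneg_left h1 hδ.le
    have e : δ * (c / (8 * ℓ ^ 2) * M ^ 2) = δ * c / (8 * ℓ ^ 2) * M ^ 2 := by ring
    linarith only [this, e]
  have T6 : -(δ * (γ * F * M)) ≤ ζ * (q ^ 2 + M ^ 2) := by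
    have h1 : -(F * M) ≤ V * (q ^ 2 + M ^ 2) := by
      refine (neg_le_abs _).trans ((abs_mul_le_mul hFV le_rfl).trans ?_)
      have := abs_mul_le_half_sq q M
      rw [abs_mul] at this
      have := mul_le_mul_of_nonneg_left this (by positivity : 0 ≤ 2 * V)
      linarith only [this]
    have h2 := mul_le_mul_of_nonneg_left h1 (mul_nonneg hδ.le hγ)
    have h3 := mul_le_mul_of_nonneg_right hV' (by positivity : 0 ≤ q ^ 2 + M ^ 2)
    linarith only [h2, h3]
  have T7 : V * (μ + 2 * γ * κ + 2 * δ) * (|p| * |q|) ≤ ζ * (p ^ 2 + q ^ 2) := by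
    have h1 := mul_le_mul_of_nonneg_right hV (by positivity : 0 ≤ |p| * |q|)
    have h2 := abs_mul_le_half_sq p q
    rw [abs_mul] at h2
    have := mul_le_mul_of_nonneg_left h2 hζ.le
    linarith only [h1, this]
  linarith only [T1, T2, T3, T4, T5, T6, T7]

theorem consistency_terms_le {ρhi L κ γ μ δ ℓ ζ σ : ℝ} (hκ : 0 ≤ κ) (hhi : 0 < ρhi)
    (hγ : 0 ≤ γ) (hμ : 0 < μ) (hδ : 0 < δ) (hℓ : 0 < ℓ) (hζ : 0 < ζ) (hL : 1 ≤ L)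
    {p q e h M R A B Fr g IR : ℝ} (hR : |R| ≤ σ) (hA : |A| ≤ σ) (hB : |B| ≤ σ) (hFr : |Fr| ≤ σ)
    (hg : |g| ≤ σ) (hIR : |IR| ≤ ℓ * σ) (he : |e| ≤ ρhi * |q| + κ * |p|)
    (hh : |h| ≤ L * |p| + κ * |q|) :
    (h - g) * R + (A + γ * Fr + μ * B) * e
      + δ * ((A + γ * Fr + μ * B) * M + g * p - IR * q)
      ≤ ζ * (p ^ 2 + q ^ 2 + M ^ 2)
        + (3 * errorConst L κ γ μ ρhi δ ℓ ^ 2 / (4 * ζ) + 1) * σ ^ 2 := by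
  have hσ : 0 ≤ σ := (abs_nonneg _).trans hR
  have hS : |A + γ * Fr + μ * B| ≤ (1 + γ + μ) * σ := by
    refine (abs_add_three _ _ _).trans ?_
    have h1 := abs_mul_le_mul (abs_of_nonneg hγ).le hFr
    have h2 := abs_mul_le_mul (abs_of_pos hμ).le hB
    linarith only [h1, h2, hA]
  have E1 : (h - g) * R ≤ (L * |p| + κ * |q| + σ) * σ :=
    (le_abs_self _).trans (abs_mul_le_mul ((abs_sub _ _).trans (add_le_add hh hg)) hR)
  have E2 := (le_abs_self _).trans (abs_mul_le_mul hS he)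
  have E3 := mul_le_mul_of_nonneg_left
    ((le_abs_self _).trans (abs_mul_le_mul hS (le_refl |M|))) hδ.le
  have E4 := mul_le_mul_of_nonneg_left
    ((le_abs_self _).trans (abs_mul_le_mul hg (le_refl |p|))) hδ.le
  have E5 := mul_le_mul_of_nonneg_left
    ((neg_le_abs _).trans (abs_mul_le_mul hIR (le_refl |q|))) hδ.le
  have hE : errorConst L κ γ μ ρhi δ ℓ
      = L + κ + (1 + γ + μ) * (ρhi + κ) + δ * (1 + γ + μ) + δ + δ * ℓ := rfl
  generalize errorConst L κ γ μ ρhi δ ℓ = E at hE ⊢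
  have n1 : 0 ≤ (1 + γ + μ) * ρhi := by positivity
  have n2 : 0 ≤ δ * (1 + γ + μ) := by positivity
  have n3 : 0 ≤ δ * ℓ := by positivity
  have n4 : 0 ≤ (1 + γ + μ) * κ := by positivity
  have Ep : (L + (1 + γ + μ) * κ + δ) * (σ * |p|) ≤ E * (σ * |p|) :=
    mul_le_mul_of_nonneg_right (by linarith only [hE, hκ, n1, n2, n3]) (by positivity)
  have Eq : (κ + (1 + γ + μ) * ρhi + δ * ℓ) * (σ * |q|) ≤ E * (σ * |q|) :=
    mul_le_mul_of_nonneg_right (by linarith only [hE, hL, n2, n4, hδ]) (by positivity)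
  have EM : δ * (1 + γ + μ) * (σ * |M|) ≤ E * (σ * |M|) :=
    mul_le_mul_of_nonneg_right (by linarith only [hE, hL, hκ, hδ, n1, n3, n4]) (by positivity)
  have Yp := mul_le_young hζ |p| (E * σ)
  have Yq := mul_le_young hζ |q| (E * σ)
  have YM := mul_le_young hζ |M| (E * σ)
  rw [sq_abs] at Yp Yq YM
  have e3 : (E * σ) ^ 2 / (4 * ζ) = E ^ 2 / (4 * ζ) * σ ^ 2 := by ring
  have e4 : (3 * E ^ 2 / (4 * ζ) + 1) * σ ^ 2 = 3 * (E ^ 2 / (4 * ζ) * σ ^ 2) + σ ^ 2 := by ring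
  rw [e3] at Yp Yq YM
  rw [e4]
  linarith only [E1, E2, E3, E4, E5, Ep, Eq, EM, Yp, Yq, YM]

/-- Coercivity of the pointwise error dynamics up to consistency errors. -/
theorem PressureBounds.dissipation_le {P : ℝ → ℝ} {ρlo ρhi c L V κ γ μ δ ℓ ζ σ : ℝ}
    (hP : PressureBounds P ρlo ρhi c L) (hlo : 0 < ρlo) (hγ : 0 ≤ γ) (hμ : 0 < μ) (hδ : 0 < δ)
    (hℓ : 0 < ℓ) (hζ : 0 < ζ) (hL : 1 ≤ L) (hVκ : V ≤ κ)
    (hV : V * (μ + 2 * γ * κ + 2 * δ) ≤ 2 * ζ) (hV' : δ * γ * V ≤ ζ)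
    {ρ v r w M R A B Fr g IR : ℝ} (hρ : ρ ∈ Icc ρlo ρhi) (hr : r ∈ Icc ρlo ρhi)
    (hv : |v| ≤ V) (hw : |w| ≤ V) (hR : |R| ≤ σ) (hA : |A| ≤ σ) (hB : |B| ≤ σ) (hFr : |Fr| ≤ σ)
    (hg : |g| ≤ σ) (hIR : |IR| ≤ ℓ * σ) :
    (enthalpy P ρ v - enthalpy P r w - g) * R + A * (ρ * v - r * w)
      - γ * ((|v| * v - |w| * w) - Fr) * (ρ * v - r * w)
      + μ * (B - (v - w)) * (ρ * v - r * w)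
      + δ * (A * M - (enthalpy P ρ v - enthalpy P r w - g) * (ρ - r)
        - γ * ((|v| * v - |w| * w) - Fr) * M + μ * (B - (v - w)) * M
        + ((ρ * v - r * w) - IR) * (v - w))
      ≤ - 2 * (γ / 4 * (r * (v - w) * ((v - w) * (|v| + |w|))))
        - (μ * ρlo - δ * (ρhi + 2 * μ ^ 2 * ℓ ^ 2 / c) - 4 * ζ) * (v - w) ^ 2
        - (δ * c - 4 * ζ) * (ρ - r) ^ 2 + (δ * c / (8 * ℓ ^ 2) + 2 * ζ) * M ^ 2
        + (3 * errorConst L κ γ μ ρhi δ ℓ ^ 2 / (4 * ζ) + 1) * σ ^ 2 := by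
  have hc := hP.pos
  have hσ : 0 ≤ σ := (abs_nonneg _).trans hR
  have hV0 : 0 ≤ V := (abs_nonneg _).trans hv
  have hκ0 : 0 ≤ κ := hV0.trans hVκ
  have hr0 : 0 < r := hlo.trans_le hr.1
  have hhi : 0 < ρhi := hr0.trans_le hr.2
  have hπ := hP.abs_deriv_sub_le hρ hr
  have hcp := hP.mul_sq_le hρ hr
  have hF := half_mul_sq_le_friction v w
  have hFa := abs_mul_abs_sub_le v w
  obtain ⟨p, hp⟩ : ∃ p, p = ρ - r := ⟨_, rfl⟩
  obtain ⟨q, hq⟩ : ∃ q, q = v - w := ⟨_, rfl⟩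
  have hem : ρ * v - r * w = r * q + v * p := by rw [hp, hq]; ring
  have hh : enthalpy P ρ v - enthalpy P r w = (deriv P ρ - deriv P r) + (v + w) / 2 * q := by
    rw [hq]; unfold enthalpy; ring
  rw [hem, hh, ← hp, ← hq]
  rw [← hp] at hπ hcp
  rw [← hq] at hF hFa
  have hD := dissipative_terms_le (M := M) hc hγ hμ hδ hℓ hζ hVκ hV hV' hr0 hr.1 hr.2 hv hw hcp
    hF hFa
  have hC := consistency_terms_le (p := p) (q := q) (e := r * q + v * p) (M := M)
    (h := deriv P ρ - deriv P r + (v + w) / 2 * q) hκ0 hhi hγ hμ hδ hℓ hζ hL hR hA hB hFr hg hIR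
    ((abs_add_le _ _).trans (add_le_add
      (abs_mul_le_mul ((abs_of_pos hr0).trans_le hr.2) le_rfl)
      (abs_mul_le_mul (hv.trans hVκ) le_rfl)))
    ((abs_add_le _ _).trans (add_le_add hπ (abs_mul_le_mul (by
      rw [abs_div, abs_two]; linarith only [abs_add_le v w, hv, hw, hVκ]) le_rfl)))
  have w1 : 0 ≤ ζ * p ^ 2 := by positivity
  have w2 : 0 ≤ ζ * q ^ 2 := by positivity
  linarith only [hD, hC, w1, w2]


/-- One time step of the modified relative energy density, tested with the error equations. -/
theorem PressureBounds.modEnergyDensity_step_le {P : ℝ → ℝ}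
    {ρlo ρhi c L vbar V b κ γ μ δ ℓ ζ σ τ α : ℝ}
    (hP : PressureBounds P ρlo ρhi c L) (hlo : 0 < ρlo) (hγ : 0 ≤ γ) (hμ : 0 < μ) (hδ : 0 < δ)
    (hℓ : 0 < ℓ) (hζ : 0 < ζ) (hL : 1 ≤ L) (hτ : 0 < τ) (hα : 0 < α) (hvV : vbar ≤ V)
    (hVκ : V ≤ κ) (hV : V * (μ + 2 * γ * κ + 2 * δ) ≤ 2 * ζ) (hV' : δ * γ * V ≤ ζ)
    (hvc : vbar ≤ c / 2) (hva : vbar ≤ ρlo / 2) (hb : 15 * L * b ≤ ζ)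
    {ρ₁ ρ₀ v₁ v₀ ρh₁ ρh₀ vh₁ vh₀ r₁ r₀ w₁ w₀ M₁ M₀ R IR e' a J : ℝ}
    (hcons : ConsistentAt P τ V b σ ρh₁ ρh₀ vh₁ vh₀ r₁ r₀ w₁ w₀ (a - (w₁ - w₀) / τ) (J - w₁))
    (hρ₁ : ρ₁ ∈ Icc ρlo ρhi) (hρ₀ : ρ₀ ∈ Icc ρlo ρhi) (hr₁ : r₁ ∈ Icc ρlo ρhi)
    (hr₀ : r₀ ∈ Icc ρlo ρhi) (hv₁ : |v₁| ≤ vbar) (hR : |R| ≤ σ) (hIR : |IR| ≤ ℓ * σ)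
    (hmass : (ρ₁ - r₁) - (ρ₀ - r₀) = τ * (R - e'))
    (hM : M₁ - M₀ = τ * ((ρ₁ * v₁ - r₁ * w₁) - IR)) :
    relEnergyDensity P ρ₁ v₁ r₁ w₁ - relEnergyDensity P ρ₀ v₀ r₀ w₀
      + δ * (M₁ * (v₁ - w₁) - M₀ * (v₀ - w₀))
      - ((enthalpy P ρh₁ vh₁ - enthalpy P r₁ w₁) * (ρ₁ - r₁)
        - (enthalpy P ρh₀ vh₀ - enthalpy P r₀ w₀) * (ρ₀ - r₀))
      - τ * (((v₁ - v₀) / τ - a) * (ρ₁ * v₁ - r₁ * w₁)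
        - (enthalpy P ρ₁ v₁ - enthalpy P ρh₁ vh₁) * e'
        + γ * (|v₁| * v₁ - |vh₁| * vh₁) * (ρ₁ * v₁ - r₁ * w₁)
        - μ * (J - v₁) * (ρ₁ * v₁ - r₁ * w₁))
      - δ * τ * (((v₁ - v₀) / τ - a) * M₁
        - (enthalpy P ρ₁ v₁ - enthalpy P ρh₁ vh₁) * (-(ρ₁ - r₁))
        + γ * (|v₁| * v₁ - |vh₁| * vh₁) * M₁ - μ * (J - v₁) * M₁)
      ≤ τ * (-2 * (γ / 4 * (r₁ * (v₁ - w₁) * ((v₁ - w₁) * (|v₁| + |w₁|))))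
          - (μ * ρlo - δ * (ρhi + 2 * μ ^ 2 * ℓ ^ 2 / c) - 5 * ζ) * (v₁ - w₁) ^ 2
          - (δ * c - 5 * ζ) * (ρ₁ - r₁) ^ 2 + (δ * c / (8 * ℓ ^ 2) + 2 * ζ) * M₁ ^ 2
          + α * (ρ₀ - r₀) ^ 2
          + (3 * errorConst L κ γ μ ρhi δ ℓ ^ 2 / (4 * ζ) + 1 + 1 / (4 * α)) * σ ^ 2)
        - (min c ρlo / 4 - τ * ζ)
          * (((ρ₁ - r₁) - (ρ₀ - r₀)) ^ 2 + ((v₁ - w₁) - (v₀ - w₀)) ^ 2)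
        + δ / 2 * ((M₁ - M₀) ^ 2 + ((v₁ - w₁) - (v₀ - w₀)) ^ 2) := by
  have hE := hP.relEnergyDensity_step_le (β := b * τ) (v₀ := v₀) hL hvc hva hρ₁ hρ₀ hr₁ hr₀ hv₁
    hcons.dr hcons.dw
  have hD := hP.dissipation_le (M := M₁) hlo hγ hμ hδ hℓ hζ hL hVκ hV hV' hρ₁ hr₁
    (hv₁.trans hvV) hcons.w₁_le hR hcons.accel hcons.meas hcons.fric hcons.enth hIR
  have hg := hcons.denth
  obtain ⟨p₁, hp₁⟩ : ∃ p, p = ρ₁ - r₁ := ⟨_, rfl⟩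
  obtain ⟨p₀, hp₀⟩ : ∃ p, p = ρ₀ - r₀ := ⟨_, rfl⟩
  obtain ⟨q₁, hq₁⟩ : ∃ q, q = v₁ - w₁ := ⟨_, rfl⟩
  obtain ⟨q₀, hq₀⟩ : ∃ q, q = v₀ - w₀ := ⟨_, rfl⟩
  obtain ⟨g₁, hg₁⟩ : ∃ g, g = enthalpy P ρh₁ vh₁ - enthalpy P r₁ w₁ := ⟨_, rfl⟩
  obtain ⟨g₀, hg₀⟩ : ∃ g, g = enthalpy P ρh₀ vh₀ - enthalpy P r₀ w₀ := ⟨_, rfl⟩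
  obtain ⟨h, hh⟩ : ∃ h, h = enthalpy P ρ₁ v₁ - enthalpy P r₁ w₁ := ⟨_, rfl⟩
  obtain ⟨em, hem⟩ : ∃ e, e = ρ₁ * v₁ - r₁ * w₁ := ⟨_, rfl⟩
  obtain ⟨F, hF⟩ : ∃ F, F = |v₁| * v₁ - |w₁| * w₁ := ⟨_, rfl⟩
  obtain ⟨Fr, hFr⟩ : ∃ F, F = |vh₁| * vh₁ - |w₁| * w₁ := ⟨_, rfl⟩
  obtain ⟨A, hA⟩ : ∃ A, A = a - (w₁ - w₀) / τ := ⟨_, rfl⟩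
  obtain ⟨B, hB⟩ : ∃ B, B = J - w₁ := ⟨_, rfl⟩
  have c1 : (v₁ - v₀) / τ - a = (q₁ - q₀) / τ - A := by rw [hq₁, hq₀, hA]; ring
  have c2 : enthalpy P ρ₁ v₁ - enthalpy P ρh₁ vh₁ = h - g₁ := by rw [hh, hg₁]; ring
  have c3 : |v₁| * v₁ - |vh₁| * vh₁ = F - Fr := by rw [hF, hFr]; ring
  have c4 : J - v₁ = B - q₁ := by rw [hB, hq₁]; ring
  rw [← hp₁, ← hp₀] at hmass
  rw [← hem] at hM
  rw [← hp₁, ← hp₀, ← hq₁, ← hq₀, ← hh, ← hem] at hE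
  rw [← hp₁, ← hq₁, ← hh, ← hem, ← hA, ← hB, ← hF, ← hFr, ← hg₁] at hD
  rw [← hg₁, ← hg₀] at hg
  rw [c1, c2, c3, c4, ← hp₁, ← hp₀, ← hq₁, ← hq₀, ← hem, ← hg₁, ← hg₀]
  have s1 : -((g₁ - g₀) * p₀) ≤ τ * (α * p₀ ^ 2 + 1 / (4 * α) * σ ^ 2) := by
    have h1 := (neg_le_abs _).trans (abs_mul_le_mul hg (le_refl |p₀|))
    have h2 := mul_le_young hα |p₀| σ
    rw [sq_abs] at h2
    have h3 := mul_le_mul_of_nonneg_left h2 hτ.le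
    have e : σ ^ 2 / (4 * α) = 1 / (4 * α) * σ ^ 2 := by ring
    rw [e] at h3
    linarith only [h1, h3]
  have s2 : -(δ * ((M₁ - M₀) * (q₁ - q₀))) ≤ δ / 2 * ((M₁ - M₀) ^ 2 + (q₁ - q₀) ^ 2) := by
    have h1 := (neg_le_abs _).trans (abs_mul_le_half_sq (M₁ - M₀) (q₁ - q₀))
    linarith only [mul_le_mul_of_nonneg_left h1 hδ.le]
  have s3 : 15 * L * (b * τ) * (p₁ ^ 2 + q₁ ^ 2 + (p₁ - p₀) ^ 2 + (q₁ - q₀) ^ 2)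
      ≤ τ * ζ * (p₁ ^ 2 + q₁ ^ 2 + (p₁ - p₀) ^ 2 + (q₁ - q₀) ^ 2) := by
    refine mul_le_mul_of_nonneg_right ?_ (by positivity)
    linarith only [mul_le_mul_of_nonneg_right hb hτ.le]
  have s4 := mul_le_mul_of_nonneg_left hD hτ.le
  have key : h * (p₁ - p₀) + em * (q₁ - q₀)
      + δ * (M₁ * q₁ - M₀ * q₀) - (g₁ * p₁ - g₀ * p₀)
      - τ * (((q₁ - q₀) / τ - A) * em - (h - g₁) * e' + γ * (F - Fr) * em - μ * (B - q₁) * em)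
      - δ * τ * (((q₁ - q₀) / τ - A) * M₁ - (h - g₁) * (-p₁) + γ * (F - Fr) * M₁
        - μ * (B - q₁) * M₁)
      = τ * ((h - g₁) * R + A * em - γ * (F - Fr) * em + μ * (B - q₁) * em
        + δ * (A * M₁ - (h - g₁) * p₁ - γ * (F - Fr) * M₁ + μ * (B - q₁) * M₁ + (em - IR) * q₁))
        - δ * ((M₁ - M₀) * (q₁ - q₀)) - (g₁ - g₀) * p₀ := by
    have h1 : (h - g₁) * (p₁ - p₀) = (h - g₁) * (τ * (R - e')) := by rw [hmass]
    have h2 : (M₁ - M₀) * q₁ = τ * (em - IR) * q₁ := by rw [hM]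
    have h3 : τ * ((q₁ - q₀) / τ) = q₁ - q₀ := mul_div_cancel₀ _ hτ.ne'
    linear_combination h1 + δ * h2 - (em + δ * M₁) * h3
  linarith only [hE, key, s1, s2, s3, s4]

/-- Integrated form of a pointwise energy inequality. -/
theorem integral_energy_step_le {ℓ δ τ aq ap aM α C k : ℝ} (hℓ : 0 < ℓ) (hτ : 0 < τ)
    (hδ : 0 < δ) (haM : 0 ≤ aM) (hk : δ / 2 * (1 + ℓ ^ 2) ≤ k)
    {e₁ e₀ p₁ p₀ q₁ q₀ M₁ M₀ g₁ g₀ J₁ J₂ d : ℝ → ℝ}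
    (he₁ : EssBdd ℓ e₁) (he₀ : EssBdd ℓ e₀) (hp₁ : EssBdd ℓ p₁) (hp₀ : EssBdd ℓ p₀)
    (hq₁ : EssBdd ℓ q₁) (hq₀ : EssBdd ℓ q₀) (hM₁ : EssBdd ℓ M₁) (hM₀ : EssBdd ℓ M₀)
    (hg₁ : EssBdd ℓ g₁) (hg₀ : EssBdd ℓ g₀) (hJ₁ : EssBdd ℓ J₁) (hJ₂ : EssBdd ℓ J₂)
    (hd : EssBdd ℓ d)
    (h : ∀ᵐ x ∂(volume.restrict (Ioo 0 ℓ)),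
      e₁ x - e₀ x + δ * (M₁ x * q₁ x - M₀ x * q₀ x) - (g₁ x * p₁ x - g₀ x * p₀ x)
        - τ * J₁ x - δ * τ * J₂ x
      ≤ τ * (-2 * d x - aq * q₁ x ^ 2 - ap * p₁ x ^ 2 + aM * M₁ x ^ 2 + α * p₀ x ^ 2 + C)
        - k * ((p₁ x - p₀ x) ^ 2 + (q₁ x - q₀ x) ^ 2)
        + δ / 2 * ((M₁ x - M₀ x) ^ 2 + (q₁ x - q₀ x) ^ 2))
    (hM : normSq ℓ M₁ ≤ ℓ ^ 2 * normSq ℓ p₁)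
    (hdM : normSq ℓ (fun x => M₁ x - M₀ x) ≤ ℓ ^ 2 * normSq ℓ (fun x => p₁ x - p₀ x)) :
    (∫ x in (0 : ℝ)..ℓ, e₁ x) - (∫ x in (0 : ℝ)..ℓ, e₀ x)
        + δ * ((∫ x in (0 : ℝ)..ℓ, M₁ x * q₁ x) - ∫ x in (0 : ℝ)..ℓ, M₀ x * q₀ x)
        - ((∫ x in (0 : ℝ)..ℓ, g₁ x * p₁ x) - ∫ x in (0 : ℝ)..ℓ, g₀ x * p₀ x)
        - τ * (∫ x in (0 : ℝ)..ℓ, J₁ x) - δ * τ * ∫ x in (0 : ℝ)..ℓ, J₂ x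
      ≤ τ * (-2 * (∫ x in (0 : ℝ)..ℓ, d x) - aq * normSq ℓ q₁ - (ap - aM * ℓ ^ 2) * normSq ℓ p₁
        + α * normSq ℓ p₀ + C * ℓ) := by
  have hint := integral_mono_Ioo_ae hℓ.le (by fun_prop) (by fun_prop) h
  have n1 : 0 ≤ normSq ℓ (fun x => p₁ x - p₀ x) :=
    intervalIntegral.integral_nonneg hℓ.le fun x _ => sq_nonneg _
  have n2 : 0 ≤ normSq ℓ (fun x => q₁ x - q₀ x) :=
    intervalIntegral.integral_nonneg hℓ.le fun x _ => sq_nonneg _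
  have eL : ∫ x in (0 : ℝ)..ℓ, (e₁ x - e₀ x + δ * (M₁ x * q₁ x - M₀ x * q₀ x)
        - (g₁ x * p₁ x - g₀ x * p₀ x) - τ * J₁ x - δ * τ * J₂ x)
      = (∫ x in (0 : ℝ)..ℓ, e₁ x) - (∫ x in (0 : ℝ)..ℓ, e₀ x)
        + δ * ((∫ x in (0 : ℝ)..ℓ, M₁ x * q₁ x) - ∫ x in (0 : ℝ)..ℓ, M₀ x * q₀ x)
        - ((∫ x in (0 : ℝ)..ℓ, g₁ x * p₁ x) - ∫ x in (0 : ℝ)..ℓ, g₀ x * p₀ x)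
        - τ * (∫ x in (0 : ℝ)..ℓ, J₁ x) - δ * τ * ∫ x in (0 : ℝ)..ℓ, J₂ x := by
    rw [← EssBdd.integral_sub hℓ.le (f := e₁) (by fun_prop) (by fun_prop),
      ← EssBdd.integral_sub hℓ.le (f := fun x => M₁ x * q₁ x) (by fun_prop) (by fun_prop),
      ← EssBdd.integral_sub hℓ.le (f := fun x => g₁ x * p₁ x) (by fun_prop) (by fun_prop),
      ← intervalIntegral.integral_const_mul, ← intervalIntegral.integral_const_mul,
      ← intervalIntegral.integral_const_mul,
      ← EssBdd.integral_add hℓ.le (by fun_prop) (by fun_prop),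
      ← EssBdd.integral_sub hℓ.le (by fun_prop) (by fun_prop),
      ← EssBdd.integral_sub hℓ.le (by fun_prop) (by fun_prop),
      ← EssBdd.integral_sub hℓ.le (by fun_prop) (by fun_prop)]
  have eR : ∫ x in (0 : ℝ)..ℓ, (τ * (-2 * d x - aq * q₁ x ^ 2 - ap * p₁ x ^ 2 + aM * M₁ x ^ 2
          + α * p₀ x ^ 2 + C)
        - k * ((p₁ x - p₀ x) ^ 2 + (q₁ x - q₀ x) ^ 2)
        + δ / 2 * ((M₁ x - M₀ x) ^ 2 + (q₁ x - q₀ x) ^ 2))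
      = τ * (-2 * (∫ x in (0 : ℝ)..ℓ, d x) - aq * normSq ℓ q₁ - ap * normSq ℓ p₁
          + aM * normSq ℓ M₁ + α * normSq ℓ p₀ + C * ℓ)
        - k * (normSq ℓ (fun x => p₁ x - p₀ x) + normSq ℓ (fun x => q₁ x - q₀ x))
        + δ / 2 * (normSq ℓ (fun x => M₁ x - M₀ x) + normSq ℓ (fun x => q₁ x - q₀ x)) := by
    have eC : C * ℓ = ∫ _ in (0 : ℝ)..ℓ, C := by
      rw [intervalIntegral.integral_const, smul_eq_mul, sub_zero, mul_comm]
    unfold normSq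
    rw [eC, ← EssBdd.integral_add hℓ.le (f := fun x => (p₁ x - p₀ x) ^ 2)
        (by fun_prop) (by fun_prop),
      ← EssBdd.integral_add hℓ.le (f := fun x => (M₁ x - M₀ x) ^ 2) (by fun_prop) (by fun_prop)]
    simp only [← intervalIntegral.integral_const_mul]
    rw [← EssBdd.integral_sub hℓ.le (by fun_prop) (by fun_prop),
      ← EssBdd.integral_sub hℓ.le (by fun_prop) (by fun_prop),
      ← EssBdd.integral_add hℓ.le (by fun_prop) (by fun_prop),
      ← EssBdd.integral_add hℓ.le (by fun_prop) (by fun_prop),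
      ← EssBdd.integral_add hℓ.le (by fun_prop) (by fun_prop)]
    simp only [← intervalIntegral.integral_const_mul]
    rw [← EssBdd.integral_sub hℓ.le (by fun_prop) (by fun_prop),
      ← EssBdd.integral_add hℓ.le (by fun_prop) (by fun_prop)]
  rw [eL, eR] at hint
  refine hint.trans ?_
  have s1 := mul_le_mul_of_nonneg_left (mul_le_mul_of_nonneg_left hM haM) hτ.le
  have s2 := mul_le_mul_of_nonneg_left hdM (half_pos hδ).le
  have s3 := mul_le_mul_of_nonneg_right hk n1
  have s4 := mul_le_mul_of_nonneg_right hk n2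
  have s5 : 0 ≤ δ / 2 * ℓ ^ 2 * normSq ℓ (fun x => q₁ x - q₀ x) := by positivity
  have s6 : 0 ≤ δ / 2 * normSq ℓ (fun x => p₁ x - p₀ x) := by positivity
  linarith only [s1, s2, s3, s4, s5, s6]

/-- Weighted Cauchy-Schwarz and Young inequality for an `L²` and a bounded function. -/
theorem InL2.abs_ip_le {ℓ ε : ℝ} {f g : ℝ → ℝ} (hℓ : 0 ≤ ℓ) (hε : 0 < ε) (hf : InL2 ℓ f)
    (hg : EssBdd ℓ g) : ip ℓ f g ≤ ε * normSq ℓ g + normSq ℓ f / (4 * ε) := by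
  have hf2 : Integrable (fun x => f x ^ 2) (volume.restrict (Ioo 0 ℓ)) := MemLp.integrable_sq hf
  unfold ip normSq
  rw [intervalIntegral_eq hℓ, intervalIntegral_eq hℓ, intervalIntegral_eq hℓ,
    ← integral_const_mul, ← integral_div, ← integral_add ((hg.pow 2).integrable.const_mul ε)
      (hf2.div_const _)]
  refine integral_mono (hf.integrable_mul hg)
    (((hg.pow 2).integrable.const_mul ε).add (hf2.div_const _)) fun x => ?_
  have := mul_le_young hε (g x) (f x)
  linarith


theorem PressureBounds.essBdd_comp {P : ℝ → ℝ} {a b c L ℓ : ℝ} (hP : PressureBounds P a b c L)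
    (hab : a ≤ b) {ρ : ℝ → ℝ} (hρ : EssBdd ℓ ρ)
    (h : ∀ᵐ x ∂(volume.restrict (Ioo 0 ℓ)), ρ x ∈ Icc a b) :
    EssBdd ℓ (fun x => P (ρ x)) ∧ EssBdd ℓ (fun x => deriv P (ρ x)) :=
  ⟨.comp_continuousOn hab hP.continuousOn hρ h, .comp_continuousOn hab hP.continuousOn_deriv hρ h⟩

theorem essBdd_relEnergyDensity {P : ℝ → ℝ} {ℓ : ℝ} {ρ v r w : ℝ → ℝ} (hρ : EssBdd ℓ ρ)
    (hv : EssBdd ℓ v) (hr : EssBdd ℓ r) (hw : EssBdd ℓ w) (hPρ : EssBdd ℓ fun x => P (ρ x))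
    (hPr : EssBdd ℓ fun x => P (r x)) (hPr' : EssBdd ℓ fun x => deriv P (r x)) :
    EssBdd ℓ (fun x => relEnergyDensity P (ρ x) (v x) (r x) (w x)) := by
  have key : ∀ A B C : ℝ → ℝ, EssBdd ℓ A → EssBdd ℓ B → EssBdd ℓ C →
      EssBdd ℓ (fun x => ρ x * v x ^ 2 / 2 + A x - (r x * w x ^ 2 / 2 + B x)
        - ((w x ^ 2 / 2 + C x) * (ρ x - r x) + r x * w x * (v x - w x))) := by
    intro A B C hA hB hC
    fun_prop
  exact key _ _ _ hPρ hPr hPr'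

theorem relEnergy_eq_integral {P : ℝ → ℝ} {ℓ : ℝ} (hℓ : 0 ≤ ℓ) {ρ v r w : ℝ → ℝ}
    (hρ : EssBdd ℓ ρ) (hv : EssBdd ℓ v) (hr : EssBdd ℓ r) (hw : EssBdd ℓ w)
    (hPρ : EssBdd ℓ fun x => P (ρ x)) (hPr : EssBdd ℓ fun x => P (r x))
    (hPr' : EssBdd ℓ fun x => deriv P (r x)) :
    relEnergy ℓ P ρ v r w = ∫ x in (0 : ℝ)..ℓ, relEnergyDensity P (ρ x) (v x) (r x) (w x) := by
  have hh : EssBdd ℓ (fun x => enthalpy P (r x) (w x)) := by unfold enthalpy; fun_prop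
  have h₁ : EssBdd ℓ (fun x => ρ x * v x ^ 2 / 2 + P (ρ x)) := .add (by fun_prop) hPρ
  have h₂ : EssBdd ℓ (fun x => r x * w x ^ 2 / 2 + P (r x)) := .add (by fun_prop) hPr
  unfold relEnergy energy ip relEnergyDensity
  rw [← EssBdd.integral_sub hℓ h₁ h₂,
    ← EssBdd.integral_add hℓ (by fun_prop) (by fun_prop),
    ← EssBdd.integral_sub hℓ (h₁.sub h₂) (by fun_prop)]

section Step

variable {ℓ τ γ μ δ ζ α K κ ρlo ρhi vbar Ct c L : ℝ} {P : ℝ → ℝ} {s₁ s₂ : ℝ → ℝ → ℝ}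
  {mBd hBd : ℝ → ℝ} {ρ v : ℝ → ℝ → ℝ} {T : Mesh ℓ} {ηh ρh mh : ℕ → ℝ → ℝ}

/-- The error of the discrete mass flow. -/
def flowError (T : Mesh ℓ) (τ : ℝ) (ρ v : ℝ → ℝ → ℝ) (mh : ℕ → ℝ → ℝ) (n : ℕ) (x : ℝ) : ℝ :=
  mh n x - T.interp (fun y => ρ (n * τ) y * v (n * τ) y) x

/-- The error of the discrete density. -/
def densityError (T : Mesh ℓ) (τ : ℝ) (ρ : ℝ → ℝ → ℝ) (ρh : ℕ → ℝ → ℝ) (n : ℕ) (x : ℝ) : ℝ :=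
  ρh n x - T.projDensity τ ρ n x

/-- The error of the discrete velocity. -/
def velocityError (T : Mesh ℓ) (τ : ℝ) (ρ v : ℝ → ℝ → ℝ) (ρh mh : ℕ → ℝ → ℝ) (n : ℕ) (x : ℝ) :
    ℝ :=
  vel ρh mh n x - T.projVelocity τ ρ v n x

/-- One time step of the modified energy, before the measurement error is estimated. -/
theorem IsObserverSolution.modEnergy_step_le
    (hobs : IsObserverSolution T τ γ μ P s₁ s₂ mBd hBd
      (fun n x => T.interp (v (n * τ)) x + ηh n x) ρh mh)
    (hη : ∀ n, InL2 ℓ (ηh n)) (hu : IsUniformDiscrete ℓ ρlo ρhi vbar ρh mh)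
    (heul : IsEulerSolution ℓ γ P s₁ s₂ mBd hBd ρ v)
    (hst : IsUniformState ℓ ρlo ρhi vbar Ct K ρ v) (hK : 1 ≤ K)
    (hP : PressureBounds P ρlo ρhi c L) (hL : 1 ≤ L) (hlo : 0 < ρlo) (hρ : ρlo ≤ ρhi)
    (hℓ : 0 < ℓ) (hγ : 0 ≤ γ) (hμ : 0 < μ) (hδ : 0 < δ) (hζ : 0 < ζ) (hα : 0 < α)
    (hτ : 0 < τ) (hT : T.size ≤ 1) (hv0 : 0 ≤ vbar) (hv1 : vbar ≤ 1) (hCt : Ct ≤ 1)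
    (hκ : κ = ρhi / ρlo)
    (hV : κ * vbar * (μ + 2 * γ * κ + 2 * δ) ≤ 2 * ζ) (hV' : δ * γ * (κ * vbar) ≤ ζ)
    (hvc : vbar ≤ c / 2) (hva : vbar ≤ ρlo / 2)
    (hb : 15 * L * (((ρhi + 1 + κ) / ρlo + 1) * Ct) ≤ ζ)
    (hk : δ / 2 * (1 + ℓ ^ 2) ≤ min c ρlo / 4 - τ * ζ)
    {n : ℕ} (hn : 1 ≤ n) :
    modEnergy T τ δ P ρ v ρh mh n - modEnergy T τ δ P ρ v ρh mh (n - 1)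
      - (projPairing T τ P ρ v ρh n - projPairing T τ P ρ v ρh (n - 1))
      ≤ τ * (-2 * relDissipation ℓ γ (vel ρh mh n) (T.projDensity τ ρ n) (T.projVelocity τ ρ v n)
        - (μ * ρlo - δ * (ρhi + 2 * μ ^ 2 * ℓ ^ 2 / c) - 5 * ζ)
          * normSq ℓ (velocityError T τ ρ v ρh mh n)
        - (δ * c - 5 * ζ - (δ * c / (8 * ℓ ^ 2) + 2 * ζ) * ℓ ^ 2)
          * normSq ℓ (densityError T τ ρ ρh n)
        + α * normSq ℓ (densityError T τ ρ ρh (n - 1))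
        + (3 * errorConst L κ γ μ ρhi δ ℓ ^ 2 / (4 * ζ) + 1 + 1 / (4 * α))
          * (consistencyConst ρlo ρhi L (K * (ρhi + 2 * K + 1)) * (τ + T.size)) ^ 2 * ℓ)
        + τ * (μ * ip ℓ (ηh n) (flowError T τ ρ v mh n))
        + δ * τ * (μ * ip ℓ (ηh n) (negPrimitive (densityError T τ ρ ρh n))) := by
  have ht₁ : 0 ≤ (n : ℝ) * τ := by positivity
  have ht₀ : 0 ≤ ((n - 1 : ℕ) : ℝ) * τ := by positivity
  have hhi : 0 < ρhi := hlo.trans_le hρ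
  have hκ1 : 1 ≤ κ := by rw [hκ, one_le_div hlo]; exact hρ
  have hc := hP.pos
  set σ := consistencyConst ρlo ρhi L (K * (ρhi + 2 * K + 1)) * (τ + T.size) with hσ
  set R : ℝ → ℝ := fun x => T.proj (timeDeriv ρ (n * τ)) x
    - (T.projDensity τ ρ n x - T.projDensity τ ρ (n - 1) x) / τ with hRdef
  have hcons := T.ae_mem_cell.mono fun x h =>
    hst.consistentAt hP hL hlo hK hv1 hCt hτ T hT hn h.choose_spec.1 h.choose_spec.2
  rw [← hκ, ← hσ] at hcons
  have hRσ : ∀ᵐ x ∂(volume.restrict (Ioo 0 ℓ)), |R x| ≤ σ := hcons.mono fun x hx => hx.2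
  have hrmem : ∀ k : ℕ, ∀ᵐ x ∂(volume.restrict (Ioo 0 ℓ)),
      T.projDensity τ ρ k x ∈ Icc ρlo ρhi := by
    intro k
    have ht : 0 ≤ (k : ℝ) * τ := by positivity
    filter_upwards [T.ae_mem_cell] with x ⟨i, hi, hx⟩
    exact T.proj_mem_Icc (hst.regular_density.continuousOn ht) hi (Ioo_subset_Ico_self hx)
      fun y hy => hst.density _ ht y (T.cell_subset hi hy)
  have hρmem : ∀ k : ℕ, ∀ᵐ x ∂(volume.restrict (Ioo 0 ℓ)),
      (ρh k x ∈ Icc ρlo ρhi) ∧ |vel ρh mh k x| ≤ vbar := by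
    intro k
    filter_upwards [ae_restrict_mem measurableSet_Ioo] with x hx
    exact hu k x hx
  have bρ : ∀ k, EssBdd ℓ (ρh k) := fun k => (hobs.density_mem k).essBdd
  have qr : ∀ k, T.IsQ (T.projDensity τ ρ k) := fun k => T.isQ_proj _
  have br : ∀ k, EssBdd ℓ (T.projDensity τ ρ k) := fun k => (qr k).essBdd
  have bv : ∀ k, EssBdd ℓ (vel ρh mh k) := hu.essBdd_vel hobs
  have bw₁ : EssBdd ℓ (T.projVelocity τ ρ v n) :=
    (T.isR_interp _).essBdd.div_of_bdd (br n) (hcons.mono fun x hx => hx.1.w₁_le)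
  have bw₀ : EssBdd ℓ (T.projVelocity τ ρ v (n - 1)) :=
    (T.isR_interp _).essBdd.div_of_bdd (br (n - 1)) (hcons.mono fun x hx => hx.1.w₀_le)
  have bPρ := fun k => hP.essBdd_comp hρ (bρ k) ((hρmem k).mono fun x hx => hx.1)
  have bPr := fun k => hP.essBdd_comp hρ (br k) (hrmem k)
  have qp : ∀ k, T.IsQ (densityError T τ ρ ρh k) := fun k => (hobs.density_mem k).sub (qr k)
  have bp : ∀ k, EssBdd ℓ (densityError T τ ρ ρh k) := fun k => (qp k).essBdd
  have bq₁ : EssBdd ℓ (velocityError T τ ρ v ρh mh n) := (bv n).sub bw₁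
  have bq₀ : EssBdd ℓ (velocityError T τ ρ v ρh mh (n - 1)) := (bv (n - 1)).sub bw₀
  have rM : ∀ k, T.IsR (negPrimitive (densityError T τ ρ ρh k)) := fun k => (qp k).isR_negPrimitive
  have bM : ∀ k, EssBdd ℓ (negPrimitive (densityError T τ ρ ρh k)) := fun k => (rM k).essBdd
  have rem : T.IsR (flowError T τ ρ v mh n) := (hobs.flow_mem n).sub (T.isR_interp _)
  have em0 : flowError T τ ρ v mh n 0 = 0 := by
    unfold flowError
    rw [T.interp_zero, hobs.bc_left n hn, heul.bc_left _ ht₁, sub_self]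
  have qR : T.IsQ R := fun i hi => by
    obtain ⟨a, ha⟩ := T.isQ_proj (timeDeriv ρ (n * τ)) i hi
    obtain ⟨b, hb⟩ := qr n i hi
    obtain ⟨d, hd⟩ := qr (n - 1) i hi
    exact ⟨a - (b - d) / τ, fun x hx => by simp only [hRdef, ha x hx, hb x hx, hd x hx]⟩
  have bR := qR.essBdd
  have hmass : ∀ᵐ x ∂(volume.restrict (Ioo 0 ℓ)),
      densityError T τ ρ ρh n x - densityError T τ ρ ρh (n - 1) x
        = τ * (R x - deriv (flowError T τ ρ v mh n) x) := by
    filter_upwards [T.ae_mem_cell] with x ⟨i, hi, hx⟩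
    have h1 := hobs.mass_eq heul hst hτ hn hi hx
    have h2 : deriv (flowError T τ ρ v mh n) x = deriv (mh n) x
        - deriv (T.interp fun y => ρ (n * τ) y * v (n * τ) y) x :=
      (hobs.flow_mem n).deriv_sub (T.isR_interp _) hi hx
    have h3 : τ * ((ρh n x - ρh (n - 1) x) / τ) = ρh n x - ρh (n - 1) x :=
      mul_div_cancel₀ _ hτ.ne'
    have h4 : τ * ((T.projDensity τ ρ n x - T.projDensity τ ρ (n - 1) x) / τ)
      = T.projDensity τ ρ n x - T.projDensity τ ρ (n - 1) x := mul_div_cancel₀ _ hτ.ne'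
    rw [h2, hRdef]
    unfold densityError
    linear_combination τ * h1 - h3 + h4
  have hem : ∀ᵐ x ∂(volume.restrict (Ioo 0 ℓ)), flowError T τ ρ v mh n x
      = ρh n x * vel ρh mh n x - T.projDensity τ ρ n x * T.projVelocity τ ρ v n x := by
    filter_upwards [hρmem n, hrmem n] with x h1 h2
    unfold flowError vel Mesh.projVelocity
    rw [mul_div_cancel₀ _ (hlo.trans_le h1.1.1).ne', mul_div_cancel₀ _ (hlo.trans_le h2.1).ne']
  have hdM : ∀ x ∈ Icc 0 ℓ, negPrimitive (densityError T τ ρ ρh n) x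
      - negPrimitive (densityError T τ ρ ρh (n - 1)) x
      = negPrimitive (fun y => densityError T τ ρ ρh n y - densityError T τ ρ ρh (n - 1) y) x :=
    fun x hx => (bp n).negPrimitive_sub (bp (n - 1)) hx
  have hM : ∀ x ∈ Icc 0 ℓ, negPrimitive (densityError T τ ρ ρh n) x
      - negPrimitive (densityError T τ ρ ρh (n - 1)) x
      = τ * (flowError T τ ρ v mh n x - -negPrimitive R x) := by
    intro x hx
    have h0 : (0 : ℝ) ∈ Icc 0 ℓ := ⟨le_rfl, hℓ.le⟩
    have hac : AbsolutelyContinuousOnInterval (flowError T τ ρ v mh n) 0 x :=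
      rem.absolutelyContinuous.mono (by
        rw [uIcc_of_le hx.1, uIcc_of_le hℓ.le]; exact Icc_subset_Icc_right hx.2)
    rw [hdM x hx]
    unfold negPrimitive
    have : ∫ s in (0 : ℝ)..x, (densityError T τ ρ ρh n s - densityError T τ ρ ρh (n - 1) s)
        = ∫ s in (0 : ℝ)..x, τ * (R s - deriv (flowError T τ ρ v mh n) s) := by
      refine intervalIntegral.integral_congr_ae_restrict ?_
      rw [uIoc_of_le hx.1, ← restrict_Ioo_eq_restrict_Ioc]
      exact ae_restrict_of_ae_restrict_of_subset (Ioo_subset_Ioo_right hx.2) hmass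
    rw [this, intervalIntegral.integral_const_mul, intervalIntegral.integral_sub
      (bR.intervalIntegrable_of_mem h0 hx) hac.intervalIntegrable_deriv,
      hac.integral_deriv_eq_sub, em0]
    ring
  have hIR : ∀ x ∈ Icc 0 ℓ, |(-negPrimitive R x)| ≤ ℓ * σ := fun x hx => by
    rw [abs_neg]
    refine EssBdd.abs_negPrimitive_le ?_ hRσ hx
    have : ∃ x, |R x| ≤ σ := by
      have : (ae (volume.restrict (Ioo 0 ℓ))).NeBot := by
        rw [ae_restrict_neBot]
        simp [hℓ]
      exact hRσ.exists
    obtain ⟨x, hx⟩ := this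
    exact (abs_nonneg _).trans hx
  have hJ₁ := hobs.momentum_eq hη hu hP (by linarith only [hL]) hρ heul hst hτ hn rem em0
  have hJ₂ := hobs.momentum_eq hη hu hP (by linarith only [hL]) hρ heul hst hτ hn (rM n)
    (by simp [negPrimitive])
  have bvh : EssBdd ℓ (v (n * τ)) := .of_continuousOn (hst.regular_velocity.continuousOn ht₁)
  have btv : EssBdd ℓ (timeDeriv v (n * τ)) :=
    .of_continuousOn (hst.regular_velocity.continuousOn_timeDeriv ht₁)
  have bI : EssBdd ℓ (T.interp (v (n * τ))) := (T.isR_interp _).essBdd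
  have bH : ∀ k : ℕ, EssBdd ℓ (fun x => enthalpy P (ρ (k * τ) x) (v (k * τ) x)) := fun k => by
    refine .of_continuousOn ?_
    have := (hst.enthalpy_absolutelyContinuous hℓ.le hP (by linarith only [hL])
      (by positivity : 0 ≤ (k : ℝ) * τ)).continuousOn
    rwa [uIcc_of_le hℓ.le] at this
  have bhd : EssBdd ℓ (fun x => enthalpy P (ρh n x) (vel ρh mh n x)) := by
    have := (bPρ n).2
    have := bv n
    unfold enthalpy; fun_prop
  have bhp₁ : EssBdd ℓ (fun x => enthalpy P (T.projDensity τ ρ n x)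
      (T.projVelocity τ ρ v n x)) := by
    have := (bPr n).2
    unfold enthalpy; fun_prop
  have bhp₀ : EssBdd ℓ (fun x => enthalpy P (T.projDensity τ ρ (n - 1) x)
      (T.projVelocity τ ρ v (n - 1) x)) := by
    have := (bPr (n - 1)).2
    unfold enthalpy; fun_prop
  have bv₁ := bv n
  have bv₀ := bv (n - 1)
  have br₁ := br n
  have bem := rem.essBdd
  have bem' := rem.isQ_deriv.essBdd
  have bM₁ := bM n
  have bM₁' := (rM n).isQ_deriv.essBdd
  have e₁ := relEnergy_eq_integral hℓ.le (bρ n) (bv n) (br n) bw₁ (bPρ n).1 (bPr n).1 (bPr n).2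
  have e₀ := relEnergy_eq_integral hℓ.le (bρ (n - 1)) (bv (n - 1)) (br (n - 1)) bw₀
    (bPρ (n - 1)).1 (bPr (n - 1)).1 (bPr (n - 1)).2
  have hG : ∀ k, auxG ℓ (ρh k) (vel ρh mh k) (T.projDensity τ ρ k) (T.projVelocity τ ρ v k)
      = ∫ x in (0 : ℝ)..ℓ, negPrimitive (densityError T τ ρ ρh k) x
        * velocityError T τ ρ v ρh mh k x := fun k => by
    unfold auxG ip
    refine integral_congr_Ioo_ae hℓ.le ?_
    filter_upwards [ae_restrict_mem measurableSet_Ioo] with x hx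
    rw [(bρ k).negPrimitive_sub (br k) (Ioo_subset_Icc_self hx)]
    rfl
  have hdiss : relDissipation ℓ γ (vel ρh mh n) (T.projDensity τ ρ n) (T.projVelocity τ ρ v n)
      = ∫ x in (0 : ℝ)..ℓ, γ / 4 * (T.projDensity τ ρ n x * velocityError T τ ρ v ρh mh n x
        * (velocityError T τ ρ v ρh mh n x
          * (|vel ρh mh n x| + |T.projVelocity τ ρ v n x|))) := by
    unfold relDissipation ip
    rw [intervalIntegral.integral_const_mul]
    rfl
  have hfin := integral_energy_step_le (α := α) hℓ hτ hδ
    (by positivity : 0 ≤ δ * c / (8 * ℓ ^ 2) + 2 * ζ) hk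
    (essBdd_relEnergyDensity (bρ n) (bv n) (br n) bw₁ (bPρ n).1 (bPr n).1 (bPr n).2)
    (essBdd_relEnergyDensity (bρ (n - 1)) (bv (n - 1)) (br (n - 1)) bw₀
      (bPρ (n - 1)).1 (bPr (n - 1)).1 (bPr (n - 1)).2)
    (bp n) (bp (n - 1)) bq₁ bq₀ (bM n) (bM (n - 1)) ((bH n).sub bhp₁) ((bH (n - 1)).sub bhp₀)
    (J₁ := fun x => ((vel ρh mh n x - vel ρh mh (n - 1) x) / τ - timeDeriv v (n * τ) x)
        * flowError T τ ρ v mh n x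
        - (enthalpy P (ρh n x) (vel ρh mh n x) - enthalpy P (ρ (n * τ) x) (v (n * τ) x))
          * deriv (flowError T τ ρ v mh n) x
        + γ * (|vel ρh mh n x| * vel ρh mh n x - |v (n * τ) x| * v (n * τ) x)
          * flowError T τ ρ v mh n x
        - μ * (T.interp (v (n * τ)) x - vel ρh mh n x) * flowError T τ ρ v mh n x)
    (J₂ := fun x => ((vel ρh mh n x - vel ρh mh (n - 1) x) / τ - timeDeriv v (n * τ) x)
        * negPrimitive (densityError T τ ρ ρh n) x
        - (enthalpy P (ρh n x) (vel ρh mh n x) - enthalpy P (ρ (n * τ) x) (v (n * τ) x))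
          * deriv (negPrimitive (densityError T τ ρ ρh n)) x
        + γ * (|vel ρh mh n x| * vel ρh mh n x - |v (n * τ) x| * v (n * τ) x)
          * negPrimitive (densityError T τ ρ ρh n) x
        - μ * (T.interp (v (n * τ)) x - vel ρh mh n x)
          * negPrimitive (densityError T τ ρ ρh n) x)
    (d := fun x => γ / 4 * (T.projDensity τ ρ n x * velocityError T τ ρ v ρh mh n x
        * (velocityError T τ ρ v ρh mh n x * (|vel ρh mh n x| + |T.projVelocity τ ρ v n x|))))
    (aq := μ * ρlo - δ * (ρhi + 2 * μ ^ 2 * ℓ ^ 2 / c) - 5 * ζ) (ap := δ * c - 5 * ζ)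
    (C := (3 * errorConst L κ γ μ ρhi δ ℓ ^ 2 / (4 * ζ) + 1 + 1 / (4 * α)) * σ ^ 2)
    (by fun_prop) (by fun_prop) (by fun_prop)
    (by
      filter_upwards [hcons, hρmem n, hρmem (n - 1), hrmem n, hrmem (n - 1), hmass, hem,
        T.ae_mem_cell, ae_restrict_mem measurableSet_Ioo]
        with x hc hρ₁ hρ₀ hr₁ hr₀ hm hemx ⟨i, hi, hxi⟩ hx
      have hxI := Ioo_subset_Icc_self hx
      have hMx := hM x hxI
      rw [hemx] at hMx ⊢
      rw [(qp n).deriv_negPrimitive hi hxi]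
      exact hP.modEnergyDensity_step_le hlo hγ hμ hδ hℓ hζ hL hτ hα
        (le_mul_of_one_le_left hv0 hκ1)
        (mul_le_of_le_one_right (by linarith only [hκ1]) hv1) hV hV' hvc hva hb hc.1 hρ₁.1 hρ₀.1
        hr₁ hr₀ hρ₁.2 hc.2 (hIR x hxI) hm hMx)
    ((bp n).normSq_negPrimitive_le hℓ)
    (by
      refine le_of_eq_of_le ?_ (((bp n).sub (bp (n - 1))).normSq_negPrimitive_le hℓ)
      refine integral_congr_Ioo_ae hℓ.le ?_
      filter_upwards [ae_restrict_mem measurableSet_Ioo] with x hx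
      rw [hdM x (Ioo_subset_Icc_self hx)])
  rw [hJ₁, hJ₂, ← e₁, ← e₀, ← hG, ← hG, ← hdiss] at hfin
  unfold modEnergy projPairing ip at *
  unfold densityError at *
  linarith only [hfin]

end Step

section ErrorBounds

variable {ℓ τ γ μ δ ζ ε α K κ ρlo ρhi vbar Ct c L : ℝ} {P : ℝ → ℝ} {s₁ s₂ : ℝ → ℝ → ℝ}
  {mBd hBd : ℝ → ℝ} {ρ v : ℝ → ℝ → ℝ} {T : Mesh ℓ} {y ηh ρh mh : ℕ → ℝ → ℝ}

theorem normSq_nonneg (hℓ : 0 ≤ ℓ) (f : ℝ → ℝ) : 0 ≤ normSq ℓ f :=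
  intervalIntegral.integral_nonneg hℓ fun _ _ => sq_nonneg _

theorem errSq_eq (n : ℕ) : errSq T τ ρ v ρh mh n
    = normSq ℓ (densityError T τ ρ ρh n) + normSq ℓ (velocityError T τ ρ v ρh mh n) := rfl

theorem IsUniformState.projDensity_mem (hst : IsUniformState ℓ ρlo ρhi vbar Ct K ρ v)
    (hτ : 0 < τ) (n : ℕ) {x : ℝ} (hx : x ∈ Ico 0 ℓ) : T.projDensity τ ρ n x ∈ Icc ρlo ρhi := by
  obtain ⟨i, hi, hxi⟩ := T.exists_mem_cell hx
  have ht : 0 ≤ (n : ℝ) * τ := by positivity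
  exact T.proj_mem_Icc (hst.regular_density.continuousOn ht) hi hxi
    fun y hy => hst.density _ ht y (T.cell_subset hi hy)

theorem IsUniformState.relDissipation_nonneg (hst : IsUniformState ℓ ρlo ρhi vbar Ct K ρ v)
    (hlo : 0 < ρlo) (hγ : 0 ≤ γ) (hτ : 0 < τ) (n : ℕ) :
    0 ≤ relDissipation ℓ γ (vel ρh mh n) (T.projDensity τ ρ n) (T.projVelocity τ ρ v n) := by
  unfold relDissipation ip
  refine mul_nonneg (by positivity) ?_
  rw [intervalIntegral_eq T.nonneg_length]
  refine integral_nonneg_of_ae ?_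
  filter_upwards [ae_restrict_mem measurableSet_Ioo] with x hx
  have hr := hlo.trans_le (hst.projDensity_mem (T := T) hτ n (Ioo_subset_Ico_self hx)).1
  have : T.projDensity τ ρ n x * (vel ρh mh n x - T.projVelocity τ ρ v n x)
      * ((vel ρh mh n x - T.projVelocity τ ρ v n x)
        * (|vel ρh mh n x| + |T.projVelocity τ ρ v n x|))
      = T.projDensity τ ρ n x * (vel ρh mh n x - T.projVelocity τ ρ v n x) ^ 2
        * (|vel ρh mh n x| + |T.projVelocity τ ρ v n x|) := by ring
  simp only [Pi.zero_apply]
  rw [this]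
  positivity

theorem IsObserverSolution.essBdd_errors
    (hobs : IsObserverSolution T τ γ μ P s₁ s₂ mBd hBd y ρh mh)
    (hu : IsUniformDiscrete ℓ ρlo ρhi vbar ρh mh)
    (hst : IsUniformState ℓ ρlo ρhi vbar Ct K ρ v) (hlo : 0 < ρlo) (hτ : 0 < τ) (n : ℕ) :
    EssBdd ℓ (densityError T τ ρ ρh n) ∧ EssBdd ℓ (velocityError T τ ρ v ρh mh n) := by
  refine ⟨((hobs.density_mem n).sub (T.isQ_proj _)).essBdd, (hu.essBdd_vel hobs n).sub ?_⟩
  have hI : EssBdd ℓ (T.interp fun y => ρ (n * τ) y * v (n * τ) y) := (T.isR_interp _).essBdd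
  obtain ⟨C, hC⟩ := hI.bdd
  refine hI.div_of_bdd (C := C / ρlo) (T.isQ_proj (ρ (n * τ))).essBdd ?_
  filter_upwards [hC, ae_restrict_mem measurableSet_Ioo] with x h hx
  have hr := (hst.projDensity_mem (T := T) hτ n (Ioo_subset_Ico_self hx)).1
  refine abs_le_div_of_mul hlo hr ?_
  rwa [mul_div_cancel₀ _ (hlo.trans_le hr).ne']

/-- The flow error is controlled by the errors of density and velocity. -/
theorem IsObserverSolution.normSq_flowError_le
    (hobs : IsObserverSolution T τ γ μ P s₁ s₂ mBd hBd y ρh mh)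
    (hu : IsUniformDiscrete ℓ ρlo ρhi vbar ρh mh)
    (hst : IsUniformState ℓ ρlo ρhi vbar Ct K ρ v) (hlo : 0 < ρlo) (hτ : 0 < τ) (hv : vbar ≤ κ)
    (n : ℕ) : normSq ℓ (flowError T τ ρ v mh n)
      ≤ 2 * ρhi ^ 2 * normSq ℓ (velocityError T τ ρ v ρh mh n)
        + 2 * κ ^ 2 * normSq ℓ (densityError T τ ρ ρh n) := by
  have hℓ := T.nonneg_length
  obtain ⟨bp, bq⟩ := hobs.essBdd_errors hu hst hlo hτ n
  have bem : EssBdd ℓ (flowError T τ ρ v mh n) :=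
    ((hobs.flow_mem n).sub (T.isR_interp _)).essBdd
  unfold normSq
  rw [← intervalIntegral.integral_const_mul, ← intervalIntegral.integral_const_mul,
    ← EssBdd.integral_add hℓ (by fun_prop) (by fun_prop)]
  refine integral_mono_Ioo_ae hℓ (by fun_prop) (by fun_prop) ?_
  filter_upwards [ae_restrict_mem measurableSet_Ioo] with x hx
  have hr := hst.projDensity_mem (T := T) hτ n (Ioo_subset_Ico_self hx)
  have hr0 := hlo.trans_le hr.1
  have hx' := hu n x hx
  have hρ0 := hlo.trans_le hx'.1.1
  have e : flowError T τ ρ v mh n x = T.projDensity τ ρ n x * velocityError T τ ρ v ρh mh n x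
      + vel ρh mh n x * densityError T τ ρ ρh n x := by
    have h1 : ρh n x * vel ρh mh n x = mh n x := mul_div_cancel₀ _ hρ0.ne'
    have h2 : T.projDensity τ ρ n x * T.projVelocity τ ρ v n x
      = T.interp (fun y => ρ (n * τ) y * v (n * τ) y) x := mul_div_cancel₀ _ hr0.ne'
    unfold flowError velocityError densityError
    rw [← h1, ← h2]; ring
  have h1 : T.projDensity τ ρ n x ^ 2 ≤ ρhi ^ 2 := pow_le_pow_left₀ hr0.le hr.2 2
  have h2 : vel ρh mh n x ^ 2 ≤ κ ^ 2 := by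
    rw [← sq_abs]; exact pow_le_pow_left₀ (abs_nonneg _) (hx'.2.trans hv) 2
  have h3 := mul_le_mul_of_nonneg_right h1 (sq_nonneg (velocityError T τ ρ v ρh mh n x))
  have h4 := mul_le_mul_of_nonneg_right h2 (sq_nonneg (densityError T τ ρ ρh n x))
  rw [e]
  nlinarith [sq_nonneg (T.projDensity τ ρ n x * velocityError T τ ρ v ρh mh n x
      - vel ρh mh n x * densityError T τ ρ ρh n x)]

/-- The contribution of the measurement error. -/
theorem IsObserverSolution.measurement_le
    (hobs : IsObserverSolution T τ γ μ P s₁ s₂ mBd hBd y ρh mh)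
    (hη : ∀ n, InL2 ℓ (ηh n)) (hu : IsUniformDiscrete ℓ ρlo ρhi vbar ρh mh)
    (hst : IsUniformState ℓ ρlo ρhi vbar Ct K ρ v) (hℓ : 0 < ℓ) (hlo : 0 < ρlo)
    (hτ : 0 < τ) (hv : vbar ≤ κ) (hμ : 0 < μ) (hδ : 0 < δ) (hε : 0 < ε)
    (hεζ : μ * ε * (2 * ρhi ^ 2 + 2 * κ ^ 2 + δ * ℓ ^ 2) ≤ ζ) (n : ℕ) :
    μ * ip ℓ (ηh n) (flowError T τ ρ v mh n)
      + δ * (μ * ip ℓ (ηh n) (negPrimitive (densityError T τ ρ ρh n)))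
      ≤ ζ * errSq T τ ρ v ρh mh n + μ * (1 + δ) / (4 * ε) * normSq ℓ (ηh n) := by
  have bem : EssBdd ℓ (flowError T τ ρ v mh n) :=
    ((hobs.flow_mem n).sub (T.isR_interp _)).essBdd
  have qp : T.IsQ (densityError T τ ρ ρh n) := (hobs.density_mem n).sub (T.isQ_proj _)
  have h1 := mul_le_mul_of_nonneg_left ((hη n).abs_ip_le hℓ.le hε bem) hμ.le
  have h2 := mul_le_mul_of_nonneg_left
    ((hη n).abs_ip_le hℓ.le hε qp.isR_negPrimitive.essBdd) (mul_pos hδ hμ).le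
  have h3 := mul_le_mul_of_nonneg_left (hobs.normSq_flowError_le hu hst hlo hτ hv n)
    (mul_pos hμ hε).le
  have h4 := mul_le_mul_of_nonneg_left (qp.essBdd.normSq_negPrimitive_le hℓ)
    (mul_pos (mul_pos hδ hμ) hε).le
  have n1 := normSq_nonneg hℓ.le (densityError T τ ρ ρh n)
  have n2 := normSq_nonneg hℓ.le (velocityError T τ ρ v ρh mh n)
  rw [errSq_eq]
  have h5 := mul_le_mul_of_nonneg_right hεζ (add_nonneg n1 n2)
  have m1 : 0 ≤ μ * ε * (2 * ρhi ^ 2) * normSq ℓ (densityError T τ ρ ρh n) := by positivity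
  have m2 : 0 ≤ μ * ε * (2 * κ ^ 2 + δ * ℓ ^ 2) * normSq ℓ (velocityError T τ ρ v ρh mh n) := by
    positivity
  have e1 : μ * (1 + δ) / (4 * ε) * normSq ℓ (ηh n)
      = μ * (normSq ℓ (ηh n) / (4 * ε)) + δ * μ * (normSq ℓ (ηh n) / (4 * ε)) := by ring
  rw [e1]
  linarith only [h1, h2, h3, h4, h5, m1, m2]

theorem normSq_le_linftyL2_sq (hℓ : 0 ≤ ℓ) {η : ℝ → ℝ → ℝ} {f : ℝ → ℝ} (hη : InLinftyL2 ℓ η)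
    {t : ℝ} (ht : 0 ≤ t) (h : l2norm ℓ f ≤ l2norm ℓ (η t)) : normSq ℓ f ≤ linftyL2 ℓ η ^ 2 := by
  have h1 : l2norm ℓ (η t) ≤ linftyL2 ℓ η := le_csSup hη.bdd ⟨t, ht, rfl⟩
  have h2 : normSq ℓ f = l2norm ℓ f ^ 2 := (Real.sq_sqrt (normSq_nonneg hℓ f)).symm
  rw [h2]
  exact pow_le_pow_left₀ (Real.sqrt_nonneg _) (h.trans h1) 2

theorem coercivity_constants {ρlo ρhi c μ δ ℓ ζ : ℝ} (hℓ : 0 < ℓ) (hζ : 0 < ζ)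
    (hδ : δ * (ρhi + 2 * μ ^ 2 * ℓ ^ 2 / c) ≤ μ * ρlo / 4)
    (hζ' : 32 * ζ * (1 + ℓ ^ 2) ≤ min (δ * c) (μ * ρlo)) :
    min (δ * c) (μ * ρlo) / 2 ≤ μ * ρlo - δ * (ρhi + 2 * μ ^ 2 * ℓ ^ 2 / c) - 6 * ζ
    ∧ min (δ * c) (μ * ρlo) / 2
      ≤ δ * c - 6 * ζ - (δ * c / (8 * ℓ ^ 2) + 2 * ζ) * ℓ ^ 2 := by
  have e : (δ * c / (8 * ℓ ^ 2) + 2 * ζ) * ℓ ^ 2 = δ * c / 8 + 2 * ζ * ℓ ^ 2 := by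
    field_simp
  have h1 := min_le_left (δ * c) (μ * ρlo)
  have h2 := min_le_right (δ * c) (μ * ρlo)
  have h3 : 0 ≤ ζ * ℓ ^ 2 := by positivity
  rw [e]
  constructor <;> linarith only [h1, h2, h3, hζ', hδ, hζ]

end ErrorBounds
end BarotropicObserver
end

open BarotropicObserver in
theorem mainTheorem3
    (ℓ γ ρlo ρhi : ℝ) (P : ℝ → ℝ) (hℓ : 0 < ℓ) (hγ : 0 ≤ γ) (hρlo : 0 < ρlo) (hρ : ρlo ≤ ρhi)
    (hP : BarotropicObserver.IsPressurePotential P ρlo ρhi)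
    (μ : ℝ) (hμ : 0 < μ) :
    ∃ δ₀ : ℝ, 0 < δ₀ ∧ ∀ δ : ℝ, 0 < δ → δ ≤ δ₀ →
    ∃ v₀ Ct₀ : ℝ, 0 < v₀ ∧ 0 < Ct₀ ∧
    ∀ vbar Ct K : ℝ, 0 < vbar → vbar ≤ v₀ → 0 < Ct → Ct ≤ Ct₀ →
    ∃ (α₀ τmax h₀ : ℝ) (C₁ : ℝ → ℝ → ℝ) (C₂ C₃ C₄ : ℝ),
      0 < α₀ ∧ 0 < τmax ∧ 0 < h₀ ∧ 0 < C₂ ∧ 0 < C₃ ∧ 0 < C₄ ∧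
      (∀ α τ₀ : ℝ, 0 < α → α ≤ α₀ → 0 < τ₀ → τ₀ ≤ τmax →
        0 < C₁ α τ₀ ∧
        ∀ (s₁ s₂ : ℝ → ℝ → ℝ) (mBd hBd : ℝ → ℝ) (ρ v : ℝ → ℝ → ℝ),
          BarotropicObserver.IsEulerSolution ℓ γ P s₁ s₂ mBd hBd ρ v →
          BarotropicObserver.IsUniformState ℓ ρlo ρhi vbar Ct K ρ v →
        ∀ η : ℝ → ℝ → ℝ, BarotropicObserver.InLinftyL2 ℓ η →
        ∀ (τ : ℝ) (T : BarotropicObserver.Mesh ℓ), 0 < τ → τ ≤ τ₀ → T.size ≤ h₀ →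
        ∀ ηh : ℕ → ℝ → ℝ,
          (∀ n : ℕ, BarotropicObserver.InL2 ℓ (ηh n) ∧
            BarotropicObserver.l2norm ℓ (ηh n) ≤ BarotropicObserver.l2norm ℓ (η (n * τ))) →
        ∀ ρh mh : ℕ → ℝ → ℝ,
          BarotropicObserver.IsObserverSolution T τ γ μ P s₁ s₂ mBd hBd
            (fun n x => T.interp (v (n * τ)) x + ηh n x) ρh mh →
          BarotropicObserver.IsUniformDiscrete ℓ ρlo ρhi vbar ρh mh →
        ∀ n : ℕ, 1 ≤ n →
          BarotropicObserver.backwardDiff τ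
              (BarotropicObserver.modEnergy T τ δ P ρ v ρh mh) n
            ≤ - C₁ α τ₀ * BarotropicObserver.errSq T τ ρ v ρh mh n
              + (α + τ₀) * C₂ * BarotropicObserver.errSq T τ ρ v ρh mh (n - 1)
              - 1 / 2 * BarotropicObserver.relDissipation ℓ γ (BarotropicObserver.vel ρh mh n)
                  (T.projDensity τ ρ n) (T.projVelocity τ ρ v n)
              + (1 + 1 / α) * (τ ^ 2 + T.size ^ 2) * C₃
              + μ ^ 2 * C₄ / α * BarotropicObserver.linftyL2 ℓ η ^ 2
              + BarotropicObserver.backwardDiff τ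
                  (BarotropicObserver.projPairing T τ P ρ v ρh) n) ∧
      (∃ α₁ τ₁ : ℝ, 0 < α₁ ∧ α₁ ≤ α₀ ∧ 0 < τ₁ ∧ τ₁ ≤ τmax ∧
        ∀ α τ₀ : ℝ, 0 < α → α ≤ α₁ → 0 < τ₀ → τ₀ ≤ τ₁ →
          - C₁ α τ₀ + (α + τ₀) * C₂ < 0) := by
  obtain ⟨c, L, hL, hPB⟩ := hP.exists_bounds hρlo
  have hc := hPB.pos
  have hhi : 0 < ρhi := hρlo.trans_le hρ
  obtain ⟨κ, hκ⟩ : ∃ κ, κ = ρhi / ρlo := ⟨_, rfl⟩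
  have hκ1 : 1 ≤ κ := by rw [hκ, one_le_div hρlo]; exact hρ
  have hκ0 : 0 < κ := by linarith only [hκ1]
  have hm : 0 < min c ρlo := lt_min hc hρlo
  refine ⟨min (μ * ρlo / 4 / (ρhi + 2 * μ ^ 2 * ℓ ^ 2 / c)) (min c ρlo / 4 / (1 + ℓ ^ 2)),
    by positivity, fun δ hδ hδ₀ => ?_⟩
  have hδ1 : δ * (ρhi + 2 * μ ^ 2 * ℓ ^ 2 / c) ≤ μ * ρlo / 4 :=
    (le_div_iff₀ (by positivity)).1 (hδ₀.trans (min_le_left _ _))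
  have hδ2 : δ * (1 + ℓ ^ 2) ≤ min c ρlo / 4 :=
    (le_div_iff₀ (by positivity)).1 (hδ₀.trans (min_le_right _ _))
  obtain ⟨Z, hZ⟩ : ∃ Z, Z = min (δ * c) (μ * ρlo) := ⟨_, rfl⟩
  have hZ0 : 0 < Z := by rw [hZ]; positivity
  obtain ⟨ζ, hζ⟩ : ∃ ζ, ζ = Z / (32 * (1 + ℓ ^ 2)) := ⟨_, rfl⟩
  have hζ0 : 0 < ζ := by rw [hζ]; positivity
  have hζZ : 32 * ζ * (1 + ℓ ^ 2) ≤ min (δ * c) (μ * ρlo) := by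
    rw [← hZ, hζ]; apply le_of_eq; field_simp
  obtain ⟨hcq, hcp⟩ := coercivity_constants hℓ hζ0 hδ1 hζZ
  rw [← hZ] at hcq hcp
  refine ⟨min 1 (min (min c ρlo / 2) (ζ / (κ * (μ + 2 * γ * κ + 2 * δ + δ * γ)))),
    min 1 (ζ / (15 * L * ((ρhi + 1 + κ) / ρlo + 1))), by positivity, by positivity,
    fun vbar Ct K hv0 hv hCt0 hCt => ?_⟩
  have hv1 : vbar ≤ 1 := hv.trans (min_le_left _ _)
  have hv2 : vbar ≤ min c ρlo / 2 := hv.trans ((min_le_right _ _).trans (min_le_left _ _))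
  have hv3 : vbar * (κ * (μ + 2 * γ * κ + 2 * δ + δ * γ)) ≤ ζ :=
    (le_div_iff₀ (by positivity)).1 (hv.trans ((min_le_right _ _).trans (min_le_right _ _)))
  have hCt1 : Ct ≤ 1 := hCt.trans (min_le_left _ _)
  have hCt2 : Ct * (15 * L * ((ρhi + 1 + κ) / ρlo + 1)) ≤ ζ :=
    (le_div_iff₀ (by positivity)).1 (hCt.trans (min_le_right _ _))
  have hV : κ * vbar * (μ + 2 * γ * κ + 2 * δ) ≤ 2 * ζ := by
    have : 0 ≤ vbar * κ * (δ * γ) := by positivity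
    linarith only [this, hv3, hζ0]
  have hV' : δ * γ * (κ * vbar) ≤ ζ := by
    have : 0 ≤ vbar * κ * (μ + 2 * γ * κ + 2 * δ) := by positivity
    linarith only [this, hv3]
  obtain ⟨Kc, hKc⟩ : ∃ k, k = consistencyConst ρlo ρhi L
    (max K 1 * (ρhi + 2 * max K 1 + 1)) := ⟨_, rfl⟩
  obtain ⟨Cσ, hCσ⟩ : ∃ C, C = 3 * errorConst L κ γ μ ρhi δ ℓ ^ 2 / (4 * ζ) + 1 := ⟨_, rfl⟩
  have hCσ1 : 1 ≤ Cσ := by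
    have : 0 ≤ 3 * errorConst L κ γ μ ρhi δ ℓ ^ 2 / (4 * ζ) := by positivity
    linarith only [this, hCσ]
  obtain ⟨ε, hε⟩ : ∃ ε, ε = ζ / (μ * (2 * ρhi ^ 2 + 2 * κ ^ 2 + δ * ℓ ^ 2)) := ⟨_, rfl⟩
  have hε0 : 0 < ε := by rw [hε]; positivity
  have hεζ : μ * ε * (2 * ρhi ^ 2 + 2 * κ ^ 2 + δ * ℓ ^ 2) ≤ ζ := by
    rw [hε]; apply le_of_eq; field_simp
  refine ⟨1, min 1 (min c ρlo / (8 * ζ)), 1, fun _ _ => Z / 2, 1,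
    2 * Kc ^ 2 * ℓ * (Cσ + 1) + 1, (1 + δ) / (4 * ε * μ), one_pos, by positivity, one_pos, one_pos,
    by positivity, by positivity, fun α τ₀ hα hα1 hτ₀ hτ₀m => ⟨by positivity, ?_⟩, ?_⟩
  · intro s₁ s₂ mBd hBd ρ v heul hst η hη τ T hτ hττ₀ hT ηh hηh ρh mh hobs hu n hn
    have hst' := hst.mono (le_max_left K 1)
    have hη2 : ∀ n, InL2 ℓ (ηh n) := fun n => (hηh n).1
    have hτζ : τ * (8 * ζ) ≤ min c ρlo :=
      (le_div_iff₀ (by positivity)).1 (hττ₀.trans (hτ₀m.trans (min_le_right _ _)))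
    have hstep := hobs.modEnergy_step_le (α := α) hη2 hu heul hst' (le_max_right K 1) hPB hL hρlo hρ
      hℓ hγ hμ hδ hζ0 hα hτ hT hv0.le hv1 hCt1 hκ hV hV'
      (hv2.trans (by linarith only [min_le_left c ρlo]))
      (hv2.trans (by linarith only [min_le_right c ρlo]))
      (by linarith only [hCt2]) (by linarith only [hδ2, hτζ]) hn
    have hmeas := hobs.measurement_le hη2 hu hst hℓ hρlo hτ (hv1.trans hκ1) hμ hδ hε0 hεζ n
    have hnη := normSq_le_linftyL2_sq hℓ.le hη (by positivity) (hηh n).2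
    have hD := hst.relDissipation_nonneg (T := T) (ρh := ρh) (mh := mh) hρlo hγ hτ n
    rw [← hKc, ← hCσ] at hstep
    have n1 := normSq_nonneg hℓ.le (densityError T τ ρ ρh n)
    have n2 := normSq_nonneg hℓ.le (velocityError T τ ρ v ρh mh n)
    have n3 := normSq_nonneg hℓ.le (densityError T τ ρ ρh (n - 1))
    have n4 := normSq_nonneg hℓ.le (velocityError T τ ρ v ρh mh (n - 1))
    rw [errSq_eq] at hmeas
    rw [errSq_eq, errSq_eq]
    have hα' : 1 ≤ 1 / α := (one_le_div hα).2 hα1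
    have b1 := mul_le_mul_of_nonneg_right hcq n2
    have b2 := mul_le_mul_of_nonneg_right hcp n1
    have b3 : α * normSq ℓ (densityError T τ ρ ρh (n - 1)) ≤ (α + τ₀) * 1
        * (normSq ℓ (densityError T τ ρ ρh (n - 1))
          + normSq ℓ (velocityError T τ ρ v ρh mh (n - 1))) := by
      have : 0 ≤ τ₀ * normSq ℓ (densityError T τ ρ ρh (n - 1)) := by positivity
      have : 0 ≤ (α + τ₀) * normSq ℓ (velocityError T τ ρ v ρh mh (n - 1)) := by positivity
      linarith
    have b4 : (Cσ + 1 / (4 * α)) * (Kc * (τ + T.size)) ^ 2 * ℓ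
        ≤ (1 + 1 / α) * (τ ^ 2 + T.size ^ 2) * (2 * Kc ^ 2 * ℓ * (Cσ + 1) + 1) := by
      have e1 : (τ + T.size) ^ 2 ≤ 2 * (τ ^ 2 + T.size ^ 2) := add_sq_le
      have e2 : Cσ + 1 / (4 * α) ≤ (1 + 1 / α) * (Cσ + 1) := by
        have e : 1 / (4 * α) = 1 / α / 4 := by field_simp
        have : 0 ≤ 1 / α * Cσ := by positivity
        rw [e]; linarith only [this, hα', hCσ1]
      have e3 : (Kc * (τ + T.size)) ^ 2 * ℓ ≤ 2 * Kc ^ 2 * ℓ * (τ ^ 2 + T.size ^ 2) := by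
        have := mul_le_mul_of_nonneg_left e1 (by positivity : 0 ≤ Kc ^ 2 * ℓ)
        linarith only [this]
      have e4 := mul_le_mul e2 e3 (by positivity) (by positivity)
      have e5 : 0 ≤ (1 + 1 / α) * (τ ^ 2 + T.size ^ 2) := by positivity
      linarith only [e4, e5]
    have b5 : μ * (1 + δ) / (4 * ε) * normSq ℓ (ηh n)
        ≤ μ ^ 2 * ((1 + δ) / (4 * ε * μ)) / α * linftyL2 ℓ η ^ 2 := by
      have e : μ ^ 2 * ((1 + δ) / (4 * ε * μ)) / α = μ * (1 + δ) / (4 * ε) * (1 / α) := by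
        field_simp
      rw [e]
      refine mul_le_mul (le_mul_of_one_le_right (by positivity) hα') hnη
        (normSq_nonneg hℓ.le _) (by positivity)
    have hdiv : backwardDiff τ (modEnergy T τ δ P ρ v ρh mh) n
        - backwardDiff τ (projPairing T τ P ρ v ρh) n
        = (modEnergy T τ δ P ρ v ρh mh n - modEnergy T τ δ P ρ v ρh mh (n - 1)
          - (projPairing T τ P ρ v ρh n - projPairing T τ P ρ v ρh (n - 1))) / τ := by
      unfold backwardDiff; ring
    rw [← sub_le_iff_le_add, hdiv, div_le_iff₀' hτ]
    refine hstep.trans ?_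
    rw [mul_assoc δ τ, mul_left_comm δ τ, ← mul_add, ← mul_add]
    refine mul_le_mul_of_nonneg_left ?_ hτ.le
    linarith only [hmeas, hD, b1, b2, b3, b4, b5]
  · refine ⟨min 1 (Z / 8), min (min 1 (min c ρlo / (8 * ζ))) (Z / 8), by positivity,
      min_le_left _ _, by positivity, min_le_left _ _, fun α τ₀ _ hα' _ hτ' => ?_⟩
    have h1 := hα'.trans (min_le_right _ _)
    have h2 := hτ'.trans (min_le_right _ _)
    linarith only [h1, h2, hZ0]
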